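/- **Setting.** Let $\mathcal C$ (contexts), $S$ (states), $A\neq\emptyset$ (actions) be finite sets, $H\in\mathbb N$, and let $S=S_0\sqcup\dots\sqcup S_H$ be a partition into layers with $S_0=\{s_0\}$, $S_H=\{s_H\}$. Let $P(\cdot\mid s,a)$, for $s\in S_h$, $h<H$, $a\in A$, be a probability distribution supported on $S_{h+1}$ (the same dynamics for every context), $\mathcal D$ a probability distribution on $\mathcal C$, and for each $(c,s,a)$ let $R^c(s,a)$ be a probability distribution on $[0,1]$ with mean $r^c(s,a)$. For $\pi:S\to A$ let $V^{\pi}_{c}$ be the expected total reward $\mathbb E[\sum_{h<H} r^c(s_h,\pi(s_h))]$ of an episode started at $s_0$ and played with $\pi$. Assume minimum reachability: for some $p_{\min}\in(0,1]$ every $\pi:S\to A$ visits every state with probability at least $p_{\min}$. Let $\mathcal F$ be a finite set of functions $\mathcal C\times S\times A\to[0,1]$ that is realizable: some $f_\star\in\mathcal F$ satisfies $f_\star(c,s,a)=r^c(s,a)$ for all $c,a$ and all $s\ne s_H$. The learner knows the layers, $p_{\min}$, $\mathcal F$, $T$ and $\delta$, but not $P$, $\mathcal D$, $R$. In each round $t=1,\dots,T$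 the learner fixes a context-dependent policy $\pi_t:\mathcal C\times S\to A$ from the past observations (and possibly internal randomness), a fresh context $c_t\sim\mathcal D$ is drawn, and a trajectory $(s^t_0,a^t_0,r^t_0,\dots,s^t_{H-1},a^t_{H-1},r^t_{H-1},s^t_H)$ with $s^t_0=s_0$, $a^t_h=\pi_t(c_t;s^t_h)$, $r^t_h\sim R^{c_t}(s^t_h,a^t_h)$, $s^t_{h+1}\sim P(\cdot\mid s^t_h,a^t_h)$ is observed. **Algorithm RM-UCID.** Rounds $i=1,\dots,|A|$ play the constant policies $\pi_i\equiv a_i$, where $A=\{a_1,\dots,a_{|A|}\}$. For $|A|<t\le T$: 1. $\hat f_t\in\arg\min_{f\in\mathcal F}\sum_{i<t}\sum_{h<H}(f(c_i,s^i_h,a^i_h)-r^i_h)^2$. 2. With $N_t(s,a)$, $N_t(s,a,s')$ the numbers of rounds $i<t$ whose trajectory contains $(s,a)$, respectively $(s,a,s')$, put $\bar P_t(s'\mid s,a)=N_t(s,a,s')/\max\{1,N_t(s,a)\}$ and $\xi_t(s,a)=2\sqrt{\frac{|S|+2\log(4|S||A|T^2/\delta)}{\max\{1,N_t(s,a)\}}}$.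 3. For every context $c$ put $\hat r^c_t(s,a)=\hat f_t(c,s,a)+\dfrac{\beta_t}{p_{\min}\sum_{i<t}\mathbb I[a=\pi_i(c;s)]}$ with $\beta_t=\sqrt{\frac{17\,t\log(8|\mathcal F|t^3/\delta)}{|S||A|}}$. 4. For every context $c$ let $\hat q$ maximize $\sum_{h<H}\sum_{s\in S_h}\sum_a \hat r^c_t(s,a)\sum_{s'\in S_{h+1}}q(s,a,s')$ over $q\in[0,1]^{S\times A\times S}$ subject to: $\sum_{s\in S_h,\,a,\,s'\in S_{h+1}}q(s,a,s')=1$ for $h<H$; $\sum_{s'\in S_{h+1},\,a}q(s,a,s')=\sum_{s'\in S_{h-1},\,a}q(s',a,s)$ for $1\le h<H$, $s\in S_h$; and $\sum_{s'\in S_{h+1}}\bigl|q(s,a,s')-\bar P_t(s'\mid s,a)\,m_q(s,a)\bigr|\le\xi_t(s,a)\,m_q(s,a)$ for $h<H$, $s\in S_h$, $a\in A$, where $m_q(s,a)=\sum_{s''\in S_{h+1}}q(s,a,s'')$. Let $\hat P^c_t(s'\mid s,a)=\hat q(s,a,s')/m_{\hat q}(s,a)$ for $s'\in S_{h+1}$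 where $m_{\hat q}(s,a)>0$; where $m_{\hat q}(s,a)=0$ let $\hat P^c_t(\cdot\mid s,a)$ be any distribution on $S_{h+1}$ with $\|\hat P^c_t(\cdot\mid s,a)-\bar P_t(\cdot\mid s,a)\|_1\le\xi_t(s,a)$. 5. $\pi_t(c;\cdot)$ is a deterministic policy that is optimal from $s_0$ in the MDP with dynamics $\hat P^c_t$ and rewards $\hat r^c_t$. All ties may be broken arbitrarily. Let $\pi^\star$ be an optimal deterministic context-dependent policy and $\mathrm{Regret}_T=\sum_{t=1}^T\bigl(V^{\pi^\star(c_t;\cdot)}_{c_t}-V^{\pi_t(c_t;\cdot)}_{c_t}\bigr)$. **Theorem.** There is a universal constant $K>0$ such that in this setting, for every $T\ge|S||A|$ and $\delta\in(0,1)$, with probability at least $1-\delta$, $$\mathrm{Regret}_T\le K\Bigl(H^{1.5}|S|\sqrt{T|A|}\,\log\tfrac{|S||A|T^2}{\delta}+\Bigl(H+\tfrac{1+\log(T/|A|)}{p_{\min}}\Bigr)\sqrt{|S||A|T\log\tfrac{8|\mathcal F|T^3}{\delta}}+|A|H\Bigr),$$ that is, $\widetilde O\bigl(H^{1.5}|S|\sqrt{T|A|}\log\frac1\delta+(H+\frac1{p_{\min}})\sqrt{|S||A|T\log\frac{|\mathcal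 F|}{\delta}}+|A|H\bigr)$. Moreover, if $\mathcal F=\mathcal G^S$, i.e. $\mathcal F$ consists of all $f(c,s,a)=g_s(c,a)$ with $g_s\in\mathcal G$ for a finite set $\mathcal G$ of functions on $\mathcal C\times A$, then with probability at least $1-\delta$, $$\mathrm{Regret}_T\le K\Bigl(H^{1.5}|S|\sqrt{T|A|}\,\log\tfrac{|S||A|T^2}{\delta}+\Bigl(H+\tfrac{1+\log(T/|A|)}{p_{\min}}\Bigr)|S|\sqrt{|A|T\log\tfrac{8|\mathcal G|T^3}{\delta}}+|A|H\Bigr).$$ -/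

import Mathlib

open MeasureTheory Finset

noncomputable section

namespace RMUCID

/-- A partition of the finite state space into layers `S_0, …, S_H` with a unique start state and a
unique final state: `S_0 = {s0}` and `S_H = {sH}`. -/
structure Layering (S : Type*) (H : ℕ) where
  layer : S → ℕ
  layer_le : ∀ s, layer s ≤ H
  s0 : S
  sH : S
  layer_eq_zero_iff : ∀ s, layer s = 0 ↔ s = s0
  layer_eq_H_iff : ∀ s, layer s = H ↔ s = sH

open scoped Classical in
/-- The layer `S_h`. -/
def Layering.states {S : Type*} [Fintype S] {H : ℕ} (L : Layering S H) (h : ℕ) : Finset S :=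
  univ.filter fun s => L.layer s = h

/-- `P(· | s, a)` is a probability vector supported on the layer that follows the one of `s`, for
every non-final state `s` and every action `a` (no transition is made from the final state). -/
structure Layering.IsDynamics {S A : Type*} [Fintype S] {H : ℕ} (L : Layering S H)
    (P : S → A → S → ℝ) : Prop where
  nonneg : ∀ s a s', L.layer s < H → 0 ≤ P s a s'
  sum_eq_one : ∀ s a, L.layer s < H → ∑ s', P s a s' = 1
  eq_zero : ∀ s a s', L.layer s < H → L.layer s' ≠ L.layer s + 1 → P s a s' = 0

/-- A layered contextual MDP with context-independent dynamics `P`, context distribution `D`, and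
reward distributions `R c s a` on `[0,1]`. -/
structure CMDP (C S A : Type*) [Fintype C] [Fintype S] (H : ℕ) where
  lay : Layering S H
  P : S → A → S → ℝ
  isDynamics : lay.IsDynamics P
  D : C → ℝ
  D_nonneg : ∀ c, 0 ≤ D c
  D_sum : ∑ c, D c = 1
  R : C → S → A → Measure ℝ
  R_prob : ∀ c s a, IsProbabilityMeasure (R c s a)
  R_mem : ∀ c s a, ∀ᵐ x ∂(R c s a), x ∈ Set.Icc (0 : ℝ) 1

/-- The expected reward `r^c(s,a)`. -/
def CMDP.r {C S A : Type*} [Fintype C] [Fintype S] {H : ℕ} (M : CMDP C S A H)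
    (c : C) (s : S) (a : A) : ℝ :=
  ∫ x, x ∂(M.R c s a)

/-- The expected total reward collected in `n` steps from `s` by the deterministic policy `π`. -/
def value {S A : Type*} [Fintype S] (P : S → A → S → ℝ) (r : S → A → ℝ) (π : S → A) :
    ℕ → S → ℝ
  | 0, _ => 0
  | n + 1, s => r s (π s) + ∑ s', P s (π s) s' * value P r π n s'

open scoped Classical in
/-- The occupancy measure `q_h(s | π, P)`: the probability that step `h` of an episode started in
`s0` and played with `π` is in state `s`. -/
def occ {S A : Type*} [Fintype S] (P : S → A → S → ℝ) (s0 : S) (π : S → A) : ℕ → S → ℝ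
  | 0, s => if s = s0 then 1 else 0
  | h + 1, s => ∑ s', occ P s0 π h s' * P s' (π s') s

/-- The value `V^π_{M(c)}(s0)` in the true model of context `c`. -/
def CMDP.V {C S A : Type*} [Fintype C] [Fintype S] {H : ℕ} (M : CMDP C S A H)
    (c : C) (π : S → A) : ℝ :=
  value M.P (M.r c) π H M.lay.s0

/-- Minimum reachability: every deterministic policy visits every state of every layer with
probability at least `pmin`. -/
def CMDP.MinReach {C S A : Type*} [Fintype C] [Fintype S] {H : ℕ} (M : CMDP C S A H)
    (pmin : ℝ) : Prop :=
  ∀ (π : S → A) (s : S), pmin ≤ occ M.P M.lay.s0 π (M.lay.layer s) s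

/-- `πs` is an optimal deterministic context-dependent policy of the true model. -/
def CMDP.IsOptimal {C S A : Type*} [Fintype C] [Fintype S] {H : ℕ} (M : CMDP C S A H)
    (πs : C → S → A) : Prop :=
  ∀ c (π : S → A), M.V c π ≤ M.V c (πs c)

/-- What is observed in one episode: `(c; s_0, a_0, r_0, …, s_{H-1}, a_{H-1}, r_{H-1}, s_H)`.
Only the entries `st h` for `h ≤ H` and `act h`, `rew h` for `h < H` are meaningful. -/
structure Episode (C S A : Type*) where
  ctx : C
  st : ℕ → S
  act : ℕ → A
  rew : ℕ → ℝ

/-! ### The algorithm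

A history is `σ : ℕ → Episode C S A`, where `σ i` is the episode of round `i = 1, 2, …`; all
quantities of round `t` depend on `σ i` for `1 ≤ i < t` only. The algorithm knows the layering `L`,
the function class `F`, the number of rounds `T`, the confidence `δ` and `pmin`. -/

section Algorithm

variable {C S A : Type*} [Fintype S] [Fintype A]

open scoped Classical in
/-- `N_t(s,a)`: the number of rounds before round `t` whose episode contains `(s,a)`. -/
def visits (H : ℕ) (σ : ℕ → Episode C S A) (t : ℕ) (s : S) (a : A) : ℕ :=
  #{i ∈ Ico 1 t | ∃ h < H, (σ i).st h = s ∧ (σ i).act h = a}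

open scoped Classical in
/-- `N_t(s,a,s')`. -/
def visitsNext (H : ℕ) (σ : ℕ → Episode C S A) (t : ℕ) (s : S) (a : A) (s' : S) : ℕ :=
  #{i ∈ Ico 1 t | ∃ h < H, (σ i).st h = s ∧ (σ i).act h = a ∧ (σ i).st (h + 1) = s'}

/-- The empirical dynamics of round `t`. -/
def empP (H : ℕ) (σ : ℕ → Episode C S A) (t : ℕ) (s : S) (a : A) (s' : S) : ℝ :=
  (visitsNext H σ t s a s' : ℝ) / max 1 (visits H σ t s a : ℝ)

/-- The confidence radius `ξ_t(s,a)`. -/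
def xi (H T : ℕ) (δ : ℝ) (σ : ℕ → Episode C S A) (t : ℕ) (s : S) (a : A) : ℝ :=
  2 * Real.sqrt
    ((Fintype.card S + 2 * Real.log (4 * Fintype.card S * Fintype.card A * (T : ℝ) ^ 2 / δ))
      / max 1 (visits H σ t s a : ℝ))

/-- The squared loss of `f` on the data of the rounds before round `t`. -/
def sqLoss (H : ℕ) (σ : ℕ → Episode C S A) (t : ℕ) (f : C → S → A → ℝ) : ℝ :=
  ∑ i ∈ Ico 1 t, ∑ h ∈ range H,
    (f (σ i).ctx ((σ i).st h) ((σ i).act h) - (σ i).rew h) ^ 2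

/-- `f` is a possible answer of the least squares regression oracle in round `t`. -/
def IsLSR (H : ℕ) (F : Finset (C → S → A → ℝ)) (σ : ℕ → Episode C S A) (t : ℕ)
    (f : C → S → A → ℝ) : Prop :=
  f ∈ F ∧ ∀ g ∈ F, sqLoss H σ t f ≤ sqLoss H σ t g

variable (S A) in
/-- The tuning parameter `β_t`, for a class of `n` functions. -/
def beta (n : ℕ) (δ : ℝ) (t : ℕ) : ℝ :=
  Real.sqrt (17 * t * Real.log (8 * n * (t : ℝ) ^ 3 / δ)
    / (Fintype.card S * Fintype.card A))

open scoped Classical in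
/-- The optimistic reward function of round `t` for context `c`, where `b` is the tuning parameter
of the round, `f` the estimate of the round, and `pol i` the policy of round `i`. -/
def rhat (b pmin : ℝ) (f : C → S → A → ℝ) (pol : ℕ → C → S → A) (t : ℕ) (c : C)
    (s : S) (a : A) : ℝ :=
  f c s a + b / (pmin * ∑ i ∈ Ico 1 t, if a = pol i c s then (1 : ℝ) else 0)

variable {H : ℕ}

/-- The mass that `q` gives to `(s,a)` (with successor in the next layer). -/
def mass (L : Layering S H) (q : S → A → S → ℝ) (s : S) (a : A) : ℝ :=
  ∑ s' ∈ L.states (L.layer s + 1), q s a s'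

/-- The constraints of the linear program over extended occupancy measures, for the empirical
dynamics `Pbar` and the confidence radii `ξ`. -/
structure LPFeasible (L : Layering S H) (Pbar : S → A → S → ℝ) (ξ : S → A → ℝ)
    (q : S → A → S → ℝ) : Prop where
  mem_Icc : ∀ s a s', q s a s' ∈ Set.Icc (0 : ℝ) 1
  total : ∀ h < H, ∑ s ∈ L.states h, ∑ a, ∑ s' ∈ L.states (h + 1), q s a s' = 1
  flow : ∀ h, 1 ≤ h → h < H → ∀ s ∈ L.states h,
    ∑ s' ∈ L.states (h + 1), ∑ a, q s a s' = ∑ s' ∈ L.states (h - 1), ∑ a, q s' a s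
  conf : ∀ h < H, ∀ s ∈ L.states h, ∀ a,
    ∑ s' ∈ L.states (h + 1), |q s a s' - Pbar s a s' * ∑ s'' ∈ L.states (h + 1), q s a s''|
      ≤ ξ s a * ∑ s'' ∈ L.states (h + 1), q s a s''

/-- The objective of the linear program. -/
def lpObj (L : Layering S H) (r : S → A → ℝ) (q : S → A → S → ℝ) : ℝ :=
  ∑ h ∈ range H, ∑ s ∈ L.states h, ∑ a, r s a * ∑ s' ∈ L.states (h + 1), q s a s'

/-- `Phat` is a dynamics induced by `q`: `q(s,a,s') / ∑_{s''} q(s,a,s'')` where the denominator is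
positive; where it vanishes the quotient is undefined and `Phat(·|s,a)` may be any distribution on
the next layer within the confidence radius. -/
structure IsInduced (L : Layering S H) (Pbar : S → A → S → ℝ) (ξ : S → A → ℝ)
    (q Phat : S → A → S → ℝ) : Prop where
  isDynamics : L.IsDynamics Phat
  eq_div : ∀ s a, L.layer s < H → mass L q s a ≠ 0 → ∀ s' ∈ L.states (L.layer s + 1),
    Phat s a s' = q s a s' / mass L q s a
  conf : ∀ s a, L.layer s < H → mass L q s a = 0 → ∑ s', |Phat s a s' - Pbar s a s'| ≤ ξ s a

/-- `π` is a possible output policy of the subroutine FOA for the reward function `r`: solve the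
linear program, form the induced dynamics, and take a deterministic policy that is optimal for
it. -/
def IsFOA (L : Layering S H) (Pbar : S → A → S → ℝ) (ξ : S → A → ℝ) (r : S → A → ℝ)
    (π : S → A) : Prop :=
  ∃ q Phat : S → A → S → ℝ,
    LPFeasible L Pbar ξ q ∧
    (∀ q', LPFeasible L Pbar ξ q' → lpObj L r q' ≤ lpObj L r q) ∧
    IsInduced L Pbar ξ q Phat ∧
    ∀ π' : S → A, value Phat r π' H L.s0 ≤ value Phat r π H L.s0

/-- The context-dependent policies `pol 1, …, pol T` are chosen by RM-UCID along the history `σ`: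
the first `|A|` rounds play the constant policies, in the order `a_1, a_2, …` given by `enum`;
afterwards `pol t c` is, for every context `c`, an output of FOA for the optimistic reward function
built from a least squares estimate and the previous policies. -/
structure IsRun (L : Layering S H) (F : Finset (C → S → A → ℝ)) (T : ℕ) (δ pmin : ℝ)
    (enum : Fin (Fintype.card A) ≃ A) (σ : ℕ → Episode C S A) (pol : ℕ → C → S → A) : Prop where
  init : ∀ i : Fin (Fintype.card A), ∀ c s, pol (i + 1) c s = enum i
  step : ∀ t, Fintype.card A < t → t ≤ T → ∃ f, IsLSR H F σ t f ∧
    ∀ c, IsFOA L (empP H σ t) (xi H T δ σ t)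
      (rhat (beta S A #F δ t) pmin f pol t c) (pol t c)

end Algorithm

/-- The interaction protocol. `𝓕 t` is the information available before round `t` (it contains the
observed history, and possibly internal randomness of the learner); `pol t` is the policy of round
`t` and `σ t` the episode that is observed in it. Given `𝓕 t`, the context is drawn from `D` and
the trajectory is generated by `pol t` in the model of the drawn context: this is `law`, which gives
the conditional distribution of contexts, state sequences and rewards. -/
structure IsInteraction {C S A Ω : Type*} [Fintype C] [Fintype S] {H : ℕ}
    {mΩ : MeasurableSpace Ω} (M : CMDP C S A H) (T : ℕ) (μ : Measure Ω) (𝓕 : Filtration ℕ mΩ)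
    (σ : ℕ → Ω → Episode C S A) (pol : ℕ → Ω → C → S → A) : Prop where
  pol_meas : ∀ t ∈ Icc 1 T, ∀ p, MeasurableSet[𝓕 t] {ω | pol t ω = p}
  ctx_meas : ∀ t ∈ Icc 1 T, ∀ c, MeasurableSet[𝓕 (t + 1)] {ω | (σ t ω).ctx = c}
  st_meas : ∀ t ∈ Icc 1 T, ∀ h ≤ H, ∀ s, MeasurableSet[𝓕 (t + 1)] {ω | (σ t ω).st h = s}
  act_meas : ∀ t ∈ Icc 1 T, ∀ h < H, ∀ a, MeasurableSet[𝓕 (t + 1)] {ω | (σ t ω).act h = a}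
  rew_meas : ∀ t ∈ Icc 1 T, ∀ h < H, Measurable[𝓕 (t + 1)] fun ω => (σ t ω).rew h
  start : ∀ t ∈ Icc 1 T, ∀ᵐ ω ∂μ, (σ t ω).st 0 = M.lay.s0
  act_eq : ∀ t ∈ Icc 1 T, ∀ h < H, ∀ᵐ ω ∂μ,
    (σ t ω).act h = pol t ω (σ t ω).ctx ((σ t ω).st h)
  law : ∀ t ∈ Icc 1 T, ∀ (p : C → S → A) (E : Set Ω),
    MeasurableSet[𝓕 t] E → (∀ ω ∈ E, pol t ω = p) →
    ∀ (c : C) (x : ℕ → S) (B : ℕ → Set ℝ), x 0 = M.lay.s0 → (∀ h, MeasurableSet (B h)) →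
      μ.real {ω ∈ E | (σ t ω).ctx = c ∧ (∀ h ≤ H, (σ t ω).st h = x h) ∧
          ∀ h < H, (σ t ω).rew h ∈ B h}
        = μ.real E * M.D c *
          ∏ h ∈ range H,
            ((M.R c (x h) (p c (x h))).real (B h) * M.P (x h) (p c (x h)) (x (h + 1)))

/-- The regret of the policies `pol 1, …, pol T` on the contexts of the history `σ`, relative to
the policy `πs`. -/
def regret {C S A : Type*} [Fintype C] [Fintype S] {H : ℕ} (M : CMDP C S A H) (T : ℕ)
    (πs : C → S → A) (σ : ℕ → Episode C S A) (pol : ℕ → C → S → A) : ℝ :=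
  ∑ t ∈ Icc 1 T, (M.V (σ t).ctx (πs (σ t).ctx) - M.V (σ t).ctx (pol t (σ t).ctx))

end RMUCID

end

/-! The regret of a round splits into reward error, bonus and dynamics error. If the true `P` lies
in the confidence set, every policy gives a feasible point of the linear program whose objective is
its value (`extOcc_feasible`, `lpObj_extOcc`), while a feasible `q` is worth no more than the best
deterministic policy in its induced dynamics (`lpObj_le_value`). The played policy is therefore
optimistic for the reward `rhat`, and the simulation lemma brings its value back to `P`; this is
`regret_round_le`.

The reward error needs no confidence interval per context. By AM-GM, |d| ≤ b/w + w d²/(4b)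
(`abs_le_div_add`), where w is `pmin` times the number of past policies that prescribe the action at
(c,s). The first term is exactly the bonus. In the second, minimum reachability bounds `pmin` by an
occupancy, so the sum over states is at most the squared error expected under the past policies in
context c (`sum_countBefore_mul_le`). Only the average of this over contexts matters, and least
squares keeps that average below 4H log(8|F|t³/δ) (`measure_regression_le`). The bonus counts what
the policies prescribe, whether or not (c,s) was met, so for every fixed (c,s) the inverse counts
form harmonic sums of total order |A| log(T/|A|) (`sum_one_div_countBefore_le`). The tuning
parameter `beta` balances the two contributions.

The dynamics error is H times the expected confidence radii. These are compared with the radii along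
the observed trajectories, whose sum is controlled by visit counting and Cauchy–Schwarz
(`IsConsistent.sum_div_sqrt_visits_le`).

Four events of failure probability at most δ/4 are used: regression, confidence set, expected versus
observed radii, observed versus expected contexts. All rest on one exponential supermartingale
bound, `measure_log_le_sum_round_le`. -/

noncomputable section

namespace RMUCID

set_option linter.unusedSectionVars false

/-! ### Occupancy measures, values and the simulation lemma. -/

section Planning

variable {S A : Type*} [Fintype S] {H : ℕ}

lemma mem_states {L : Layering S H} {h : ℕ} {s : S} : s ∈ L.states h ↔ L.layer s = h := by
  simp [Layering.states]

lemma Layering.layer_s0 (L : Layering S H) : L.layer L.s0 = 0 := (L.layer_eq_zero_iff _).2 rfl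

section Occupancy

variable {L : Layering S H} {P : S → A → S → ℝ}

lemma occ_eq_zero (hP : L.IsDynamics P) (π : S → A) :
    ∀ h ≤ H, ∀ s, L.layer s ≠ h → occ P L.s0 π h s = 0 := by
  intro h
  induction h with
  | zero =>
    intro _ s hs
    simp only [occ]
    rw [if_neg]
    exact fun e => hs ((L.layer_eq_zero_iff s).2 e)
  | succ h ih =>
    intro hh s hs
    simp only [occ]
    refine Finset.sum_eq_zero fun s' _ => ?_
    by_cases h' : L.layer s' = h
    · rw [hP.eq_zero s' _ s (by omega) (by omega), mul_zero]
    · rw [ih (by omega) s' h', zero_mul]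

lemma occ_nonneg (hP : L.IsDynamics P) (π : S → A) :
    ∀ h ≤ H, ∀ s, 0 ≤ occ P L.s0 π h s := by
  intro h
  induction h with
  | zero => intro _ s; simp only [occ]; split_ifs <;> norm_num
  | succ h ih =>
    intro hh s
    simp only [occ]
    refine Finset.sum_nonneg fun s' _ => ?_
    by_cases h' : L.layer s' = h
    · exact mul_nonneg (ih (by omega) s') (hP.nonneg _ _ _ (by omega))
    · rw [occ_eq_zero hP π h (by omega) s' h', zero_mul]

lemma occ_sum (hP : L.IsDynamics P) (π : S → A) :
    ∀ h ≤ H, ∑ s, occ P L.s0 π h s = 1 := by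
  intro h
  induction h with
  | zero => intro _; classical simp [occ]
  | succ h ih =>
    intro hh
    simp only [occ]
    rw [Finset.sum_comm, ← ih (by omega)]
    refine Finset.sum_congr rfl fun s' _ => ?_
    rw [← Finset.mul_sum]
    by_cases h' : L.layer s' = h
    · rw [hP.sum_eq_one _ _ (by omega), mul_one]
    · rw [occ_eq_zero hP π h (by omega) s' h', zero_mul]

lemma occ_le_one (hP : L.IsDynamics P) (π : S → A) {h : ℕ} (hh : h ≤ H) (s : S) :
    occ P L.s0 π h s ≤ 1 := by
  rw [← occ_sum hP π h hh]
  exact Finset.single_le_sum (fun s _ => occ_nonneg hP π h hh s) (Finset.mem_univ s)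

/-- Expectations of a function of the state, summed over an episode, as a sum over non-final
states. -/
lemma sum_occ_mul_eq (hP : L.IsDynamics P) (π : S → A) (u : S → ℝ) :
    ∑ h ∈ range H, ∑ s, occ P L.s0 π h s * u s
      = ∑ s with L.layer s < H, occ P L.s0 π (L.layer s) s * u s := by
  rw [Finset.sum_comm, Finset.sum_filter]
  refine Finset.sum_congr rfl fun s _ => ?_
  split_ifs with hs
  · rw [Finset.sum_eq_single_of_mem (L.layer s) (by simpa using hs)]
    intro h hh hne
    rw [occ_eq_zero hP π h (by simp at hh; omega) s hne.symm, zero_mul]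
  · refine Finset.sum_eq_zero fun h hh => ?_
    simp at hh
    rw [occ_eq_zero hP π h (by omega) s (by omega), zero_mul]

lemma sum_occ_mul_le_sum (hP : L.IsDynamics P) (π : S → A) {u : S → ℝ} (hu : ∀ s, 0 ≤ u s) :
    ∑ h ∈ range H, ∑ s, occ P L.s0 π h s * u s ≤ ∑ s with L.layer s < H, u s := by
  rw [sum_occ_mul_eq hP]
  refine Finset.sum_le_sum fun s _ => ?_
  exact mul_le_of_le_one_left (hu s) (occ_le_one hP π (L.layer_le s) s)

lemma sum_occ_mul_mono (hP : L.IsDynamics P) (π : S → A) {u v : S → ℝ}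
    (huv : ∀ s, L.layer s < H → u s ≤ v s) :
    ∑ h ∈ range H, ∑ s, occ P L.s0 π h s * u s
      ≤ ∑ h ∈ range H, ∑ s, occ P L.s0 π h s * v s := by
  rw [sum_occ_mul_eq hP, sum_occ_mul_eq hP]
  refine Finset.sum_le_sum fun s hs => ?_
  exact mul_le_mul_of_nonneg_left (huv s (by simpa using hs)) (occ_nonneg hP π _ (L.layer_le s) s)

lemma sum_occ_mul_nonneg (hP : L.IsDynamics P) (π : S → A) {u : S → ℝ}
    (hu : ∀ s, L.layer s < H → 0 ≤ u s) :
    0 ≤ ∑ h ∈ range H, ∑ s, occ P L.s0 π h s * u s := by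
  have := sum_occ_mul_mono hP π (u := fun _ => 0) hu
  simpa using this

end Occupancy

lemma sum_occ_zero_mul (P : S → A → S → ℝ) (s0 : S) (π : S → A) (u : S → ℝ) :
    ∑ s, occ P s0 π 0 s * u s = u s0 := by
  classical
  simp [occ]

lemma sum_occ_succ_mul (P : S → A → S → ℝ) (s0 : S) (π : S → A) (h : ℕ) (u : S → ℝ) :
    ∑ s, occ P s0 π (h + 1) s * u s
      = ∑ s, occ P s0 π h s * ∑ s', P s (π s) s' * u s' := by
  simp only [occ, Finset.sum_mul, Finset.mul_sum]
  rw [Finset.sum_comm]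
  exact Finset.sum_congr rfl fun s _ => Finset.sum_congr rfl fun s' _ => by ring

lemma sum_occ_mul_value (P : S → A → S → ℝ) (s0 : S) (r : S → A → ℝ) (π : S → A) :
    ∀ n h, ∑ s, occ P s0 π h s * value P r π n s
      = ∑ k ∈ range n, ∑ s, occ P s0 π (h + k) s * r s (π s) := by
  intro n
  induction n with
  | zero => intro h; simp [value]
  | succ n ih =>
    intro h
    simp only [value, mul_add, Finset.sum_add_distrib]
    rw [← sum_occ_succ_mul, ih, Finset.sum_range_succ', add_comm]
    congr 1
    refine Finset.sum_congr rfl fun k _ => ?_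
    rw [show h + 1 + k = h + (k + 1) by ring]

/-- The value as a sum of expected rewards. -/
lemma value_eq_sum_occ (P : S → A → S → ℝ) (s0 : S) (r : S → A → ℝ) (π : S → A) (n : ℕ) :
    value P r π n s0 = ∑ h ∈ range n, ∑ s, occ P s0 π h s * r s (π s) := by
  rw [← sum_occ_zero_mul P s0 π (value P r π n), sum_occ_mul_value]
  simp

/-- One Bellman step writes the gap as `Q - P` applied to the `Q`-value, plus the `P`-expectation of
the gap one step later. The starting time `h` is general because the induction moves it. -/
lemma sum_occ_mul_value_sub (P Q : S → A → S → ℝ) (s0 : S) (r : S → A → ℝ) (π : S → A) :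
    ∀ n h, ∑ s, occ P s0 π h s * (value Q r π n s - value P r π n s)
      = ∑ k ∈ range n, ∑ s, occ P s0 π (h + k) s *
          ∑ s', (Q s (π s) s' - P s (π s) s') * value Q r π (n - 1 - k) s' := by
  intro n
  induction n with
  | zero => intro h; simp [value]
  | succ n ih =>
    intro h
    have e : ∀ s, value Q r π (n + 1) s - value P r π (n + 1) s
        = ∑ s', (Q s (π s) s' - P s (π s) s') * value Q r π n s'
          + ∑ s', P s (π s) s' * (value Q r π n s' - value P r π n s') := by
      intro s
      simp only [value]
      rw [← Finset.sum_add_distrib, add_sub_add_left_eq_sub, ← Finset.sum_sub_distrib]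
      exact Finset.sum_congr rfl fun s' _ => by ring
    simp only [e, mul_add, Finset.sum_add_distrib]
    rw [← sum_occ_succ_mul, ih, Finset.sum_range_succ', add_comm]
    congr 1
    refine Finset.sum_congr rfl fun k _ => ?_
    rw [show h + 1 + k = h + (k + 1) by ring, show n + 1 - 1 - (k + 1) = n - 1 - k by omega]

/-- The simulation lemma. -/
lemma value_sub_value (P Q : S → A → S → ℝ) (s0 : S) (r : S → A → ℝ) (π : S → A) (n : ℕ) :
    value Q r π n s0 - value P r π n s0
      = ∑ h ∈ range n, ∑ s, occ P s0 π h s *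
          ∑ s', (Q s (π s) s' - P s (π s) s') * value Q r π (n - 1 - h) s' := by
  rw [← sum_occ_zero_mul P s0 π (fun s => value Q r π n s - value P r π n s),
    sum_occ_mul_value_sub]
  simp

lemma value_mem_Icc {L : Layering S H} {P : S → A → S → ℝ} (hP : L.IsDynamics P)
    {r : S → A → ℝ} (hr : ∀ s a, L.layer s < H → r s a ∈ Set.Icc (0 : ℝ) 1) (π : S → A) :
    ∀ n s, L.layer s + n ≤ H → value P r π n s ∈ Set.Icc (0 : ℝ) n := by
  intro n
  induction n with
  | zero => intro s _; simp [value]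
  | succ n ih =>
    intro s hs
    have hlt : L.layer s < H := by omega
    obtain ⟨hr0, hr1⟩ := hr s (π s) hlt
    have key : ∀ s', 0 ≤ P s (π s) s' * value P r π n s' ∧
        P s (π s) s' * value P r π n s' ≤ P s (π s) s' * n := by
      intro s'
      by_cases h' : L.layer s' = L.layer s + 1
      · obtain ⟨h0, h1⟩ := ih s' (by omega)
        have := hP.nonneg s (π s) s' hlt
        exact ⟨mul_nonneg this h0, mul_le_mul_of_nonneg_left h1 this⟩
      · simp [hP.eq_zero s (π s) s' hlt h']
    have h1 : 0 ≤ ∑ s', P s (π s) s' * value P r π n s' :=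
      Finset.sum_nonneg fun s' _ => (key s').1
    have h2 : ∑ s', P s (π s) s' * value P r π n s' ≤ n := by
      calc _ ≤ ∑ s', P s (π s) s' * (n : ℝ) := Finset.sum_le_sum fun s' _ => (key s').2
        _ = n := by rw [← Finset.sum_mul, hP.sum_eq_one _ _ hlt, one_mul]
    simp only [value, Set.mem_Icc]
    push_cast
    constructor <;> linarith

/-- The value error caused by an error `e` of the dynamics in total variation. -/
lemma value_sub_value_le {L : Layering S H} {P Q : S → A → S → ℝ} (hP : L.IsDynamics P)
    (hQ : L.IsDynamics Q) {r : S → A → ℝ}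
    (hr : ∀ s a, L.layer s < H → r s a ∈ Set.Icc (0 : ℝ) 1) (π : S → A) {e : S → ℝ}
    (he : ∀ s, L.layer s < H → ∑ s' ∈ L.states (L.layer s + 1), |Q s (π s) s' - P s (π s) s'| ≤ e s) :
    value Q r π H L.s0 - value P r π H L.s0
      ≤ H * ∑ h ∈ range H, ∑ s, occ P L.s0 π h s * e s := by
  rw [value_sub_value, Finset.mul_sum]
  refine Finset.sum_le_sum fun h hh => ?_
  have hh : h < H := by simpa using hh
  rw [Finset.mul_sum]
  refine Finset.sum_le_sum fun s _ => ?_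
  by_cases hs : L.layer s = h
  swap
  · simp [occ_eq_zero hP π h hh.le s hs]
  have hlt : L.layer s < H := by omega
  rw [mul_left_comm]
  refine mul_le_mul_of_nonneg_left ?_ (occ_nonneg hP π h hh.le s)
  calc ∑ s', (Q s (π s) s' - P s (π s) s') * value Q r π (H - 1 - h) s'
      = ∑ s' ∈ L.states (L.layer s + 1),
          (Q s (π s) s' - P s (π s) s') * value Q r π (H - 1 - h) s' := by
        symm
        refine Finset.sum_subset (Finset.subset_univ _) fun s' _ hs' => ?_
        rw [mem_states] at hs'
        rw [hP.eq_zero s _ s' hlt hs', hQ.eq_zero s _ s' hlt hs', sub_zero, zero_mul]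
    _ ≤ ∑ s' ∈ L.states (L.layer s + 1), |Q s (π s) s' - P s (π s) s'| * H := by
        refine Finset.sum_le_sum fun s' hs' => ?_
        rw [mem_states] at hs'
        -- The successor lies in layer `h + 1`, so the remaining `H - 1 - h` steps end exactly in
        -- layer `H`.
        obtain ⟨h0, h1⟩ := value_mem_Icc hQ hr π (H - 1 - h) s' (by omega)
        have h2 : ((H - 1 - h : ℕ) : ℝ) ≤ H := by exact_mod_cast (by omega)
        calc _ ≤ |Q s (π s) s' - P s (π s) s'| * value Q r π (H - 1 - h) s' :=
              mul_le_mul_of_nonneg_right (le_abs_self _) h0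
          _ ≤ _ := mul_le_mul_of_nonneg_left (h1.trans h2) (abs_nonneg _)
    _ ≤ H * e s := by
        rw [← Finset.sum_mul, mul_comm]
        exact mul_le_mul_of_nonneg_left (he s hlt) (Nat.cast_nonneg _)

end Planning

/-! ### The linear program: optimism and the regret of one round. -/

section LinearProgram

variable {S A : Type*} [Fintype S] [Fintype A] {H : ℕ} {L : Layering S H}

open scoped Classical in
/-- The extended occupancy measure of a deterministic policy. -/
def extOcc (L : Layering S H) (P : S → A → S → ℝ) (π : S → A) (s : S) (a : A) (s' : S) : ℝ :=
  if L.layer s < H ∧ π s = a then occ P L.s0 π (L.layer s) s * P s a s' else 0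

lemma sum_states_eq_sum {P : S → A → S → ℝ} (hP : L.IsDynamics P) {s : S} {a : A}
    (hs : L.layer s < H) (u : S → ℝ) :
    ∑ s' ∈ L.states (L.layer s + 1), P s a s' * u s' = ∑ s', P s a s' * u s' := by
  refine Finset.sum_subset (Finset.subset_univ _) fun s' _ hs' => ?_
  rw [mem_states] at hs'
  rw [hP.eq_zero s _ s' hs hs', zero_mul]

lemma sum_extOcc {P : S → A → S → ℝ} (hP : L.IsDynamics P) (π : S → A) {s : S} {a : A}
    (hs : L.layer s < H) :
    ∑ s' ∈ L.states (L.layer s + 1), extOcc L P π s a s'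
      = open scoped Classical in if π s = a then occ P L.s0 π (L.layer s) s else 0 := by
  classical
  by_cases ha : π s = a
  · simp only [extOcc, hs, ha, and_self, if_true]
    have := sum_states_eq_sum hP (a := a) hs (fun _ => 1)
    simp only [mul_one, hP.sum_eq_one _ _ hs] at this
    rw [← Finset.mul_sum, this, mul_one]
  · simp [extOcc, ha]

lemma sum_states_occ {P : S → A → S → ℝ} (hP : L.IsDynamics P) (π : S → A) {h : ℕ} (hh : h ≤ H)
    (u : S → ℝ) :
    ∑ s ∈ L.states h, occ P L.s0 π h s * u s = ∑ s, occ P L.s0 π h s * u s := by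
  refine Finset.sum_subset (Finset.subset_univ _) fun s' _ hs' => ?_
  rw [mem_states] at hs'
  rw [occ_eq_zero hP π h hh s' hs', zero_mul]

/-- Total mass and flow are the Chapman–Kolmogorov equations of the occupancy. Each confidence
constraint is the hypothesis on `Pbar - P` multiplied by the occupancy of `s`. -/
lemma extOcc_feasible {P Pbar : S → A → S → ℝ} {ξ : S → A → ℝ} (hP : L.IsDynamics P)
    (hconf : ∀ s a, L.layer s < H → ∑ s', |Pbar s a s' - P s a s'| ≤ ξ s a) (π : S → A) :
    LPFeasible L Pbar ξ (extOcc L P π) where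
  mem_Icc s a s' := by
    unfold extOcc
    split_ifs with hs
    · have h0 := hP.nonneg s a s' hs.1
      have h1 : P s a s' ≤ 1 := by
        rw [← hP.sum_eq_one s a hs.1]
        exact Finset.single_le_sum (fun s' _ => hP.nonneg s a s' hs.1) (Finset.mem_univ s')
      have h2 := occ_nonneg hP π _ (L.layer_le s) s
      have h3 := occ_le_one hP π (L.layer_le s) s
      exact ⟨mul_nonneg h2 h0, mul_le_one₀ h3 h0 h1⟩
    · simp
  total h hh := by
    classical
    rw [← occ_sum hP π h hh.le]
    have := sum_states_occ hP π hh.le (fun _ => 1)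
    simp only [mul_one] at this
    rw [← this]
    refine Finset.sum_congr rfl fun s hs => ?_
    rw [mem_states] at hs
    subst hs
    simp [sum_extOcc hP π hh]
  flow h h1 hh s hs := by
    classical
    rw [mem_states] at hs
    subst hs
    rw [Finset.sum_comm]
    simp only [sum_extOcc hP π hh, Finset.sum_ite_eq, Finset.mem_univ, if_true]
    obtain ⟨k, hk⟩ : ∃ k, L.layer s = k + 1 := ⟨L.layer s - 1, by omega⟩
    rw [hk, Nat.add_sub_cancel]
    simp only [occ]
    rw [← sum_states_occ hP π (by omega) (fun s' => P s' (π s') s)]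
    refine Finset.sum_congr rfl fun s' hs' => ?_
    rw [mem_states] at hs'
    have hlt : L.layer s' < H := by omega
    simp only [extOcc, hlt, true_and, Finset.sum_ite_eq, Finset.mem_univ, if_true]
    rw [hs']
  conf h hh s hs a := by
    classical
    rw [mem_states] at hs
    subst hs
    rw [sum_extOcc hP π hh]
    split_ifs with ha
    · simp only [extOcc, hh, ha, and_self, if_true]
      have h2 := occ_nonneg hP π _ (L.layer_le s) s
      calc _ = ∑ s' ∈ L.states (L.layer s + 1),
              |Pbar s a s' - P s a s'| * occ P L.s0 π (L.layer s) s := by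
            refine Finset.sum_congr rfl fun s' _ => ?_
            rw [mul_comm, ← sub_mul, abs_mul, abs_of_nonneg h2, abs_sub_comm]
        _ ≤ _ := by
            rw [← Finset.sum_mul]
            refine mul_le_mul_of_nonneg_right (le_trans ?_ (hconf s a hh)) h2
            exact Finset.sum_le_sum_of_subset_of_nonneg (Finset.subset_univ _)
              fun _ _ _ => abs_nonneg _
    · simp [extOcc, ha]

lemma lpObj_extOcc {P : S → A → S → ℝ} (hP : L.IsDynamics P) (r : S → A → ℝ) (π : S → A) :
    lpObj L r (extOcc L P π) = value P r π H L.s0 := by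
  classical
  rw [value_eq_sum_occ, lpObj]
  refine Finset.sum_congr rfl fun h hh => ?_
  have hh : h < H := by simpa using hh
  rw [← sum_states_occ hP π hh.le]
  refine Finset.sum_congr rfl fun s hs => ?_
  rw [mem_states] at hs
  subst hs
  simp [sum_extOcc hP π hh, mul_comm]

/-- A deterministic policy, chosen by backward induction, that is at least as good as every
action at every state, and its value-to-go. -/
lemma exists_greedy [Nonempty A] (L : Layering S H) (Q : S → A → S → ℝ) (r : S → A → ℝ) :
    ∃ (π : S → A) (W : ℕ → S → ℝ), (∀ s, W 0 s = 0) ∧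
      (∀ n s a, r s a + ∑ s', Q s a s' * W n s' ≤ W (n + 1) s) ∧
      (L.IsDynamics Q → ∀ n s, L.layer s + n = H → value Q r π n s = W n s) := by
  classical
  let W : ℕ → S → ℝ := fun n => Nat.rec (fun _ => 0)
    (fun _ w s => univ.sup' univ_nonempty fun a => r s a + ∑ s', Q s a s' * w s') n
  have hW : ∀ n s, W (n + 1) s
      = univ.sup' univ_nonempty fun a => r s a + ∑ s', Q s a s' * W n s' := fun _ _ => rfl
  -- A policy without time index suffices, since the layer of `s` determines the number of remaining
  -- steps. In the final layer the choice is irrelevant.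
  have hex : ∀ s, ∃ a, W (H - L.layer s - 1 + 1) s
      = r s a + ∑ s', Q s a s' * W (H - L.layer s - 1) s' := by
    intro s
    obtain ⟨a, -, ha⟩ := Finset.exists_mem_eq_sup' (univ_nonempty (α := A))
      (fun a => r s a + ∑ s', Q s a s' * W (H - L.layer s - 1) s')
    exact ⟨a, by rw [hW, ha]⟩
  choose π hπ using hex
  refine ⟨π, W, fun _ => rfl, fun n s a => ?_, fun hQ n => ?_⟩
  · rw [hW]
    exact Finset.le_sup' (fun a => r s a + ∑ s', Q s a s' * W n s') (Finset.mem_univ a)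
  · induction n with
    | zero => intro s _; simp [value, W]
    | succ n ih =>
      intro s hs
      have e : H - L.layer s - 1 = n := by omega
      have := hπ s
      rw [e] at this
      rw [this, value]
      congr 1
      have hlt : L.layer s < H := by omega
      rw [← sum_states_eq_sum hQ hlt, ← sum_states_eq_sum hQ hlt]
      refine Finset.sum_congr rfl fun s' hs' => ?_
      rw [mem_states] at hs'
      rw [ih s' (by omega)]

/-- Where the mass vanishes, the nonnegative entries of `q` vanish too, so the arbitrary choice of
the induced dynamics there is harmless. -/
lemma mass_mul_induced {Pbar q Q : S → A → S → ℝ} {ξ : S → A → ℝ} (hq : LPFeasible L Pbar ξ q)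
    (hQ : IsInduced L Pbar ξ q Q) {s : S} (hs : L.layer s < H) (a : A) {s' : S}
    (hs' : s' ∈ L.states (L.layer s + 1)) : mass L q s a * Q s a s' = q s a s' := by
  by_cases hm : mass L q s a = 0
  · rw [hm, zero_mul]
    have := (Finset.sum_eq_zero_iff_of_nonneg fun s' _ => (hq.mem_Icc s a s').1).1 hm s' hs'
    exact this.symm
  · rw [hQ.eq_div s a hs hm s' hs', mul_div_cancel₀ _ hm]

lemma mass_nonneg {Pbar q : S → A → S → ℝ} {ξ : S → A → ℝ} (hq : LPFeasible L Pbar ξ q)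
    (s : S) (a : A) : 0 ≤ mass L q s a :=
  Finset.sum_nonneg fun s' _ => (hq.mem_Icc s a s').1

/-- `q` is the flow of a possibly randomized policy in the dynamics `Q`. The greedy value-to-go `W`
dominates every action, hence every mixture: the reward of a layer plus `W` of the mass it sends on
is at most `W` of its own mass. Flow conservation telescopes this over the layers. -/
lemma lpObj_le_value [Nonempty A] {Pbar q Q : S → A → S → ℝ} {ξ r : S → A → ℝ}
    (hq : LPFeasible L Pbar ξ q) (hQ : IsInduced L Pbar ξ q Q) :
    ∃ π : S → A, lpObj L r q ≤ value Q r π H L.s0 := by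
  obtain ⟨π, W, hW0, hW1, hWv⟩ := exists_greedy L Q r
  refine ⟨π, ?_⟩
  rw [hWv hQ.isDynamics H L.s0 (by rw [L.layer_s0, zero_add])]
  have hmass : ∀ h, ∀ s ∈ L.states h, ∀ a, ∑ s' ∈ L.states (h + 1), q s a s' = mass L q s a := by
    intro h s hs a
    rw [mem_states] at hs
    rw [mass, hs]
  have hobj : lpObj L r q = ∑ h ∈ range H, ∑ s ∈ L.states h, ∑ a, mass L q s a * r s a := by
    refine Finset.sum_congr rfl fun h _ => Finset.sum_congr rfl fun s hs =>
      Finset.sum_congr rfl fun a _ => ?_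
    rw [hmass h s hs, mul_comm]
  rw [hobj]
  have hstep : ∀ h < H, ∑ s ∈ L.states h, ∑ a, mass L q s a * r s a
      + ∑ s' ∈ L.states (h + 1), (∑ s ∈ L.states h, ∑ a, q s a s') * W (H - (h + 1)) s'
      ≤ ∑ s ∈ L.states h, (∑ a, mass L q s a) * W (H - h) s := by
    intro h hh
    have e : ∑ s' ∈ L.states (h + 1), (∑ s ∈ L.states h, ∑ a, q s a s') * W (H - (h + 1)) s'
        = ∑ s ∈ L.states h, ∑ a, mass L q s a * ∑ s', Q s a s' * W (H - (h + 1)) s' := by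
      simp only [Finset.sum_mul]
      rw [Finset.sum_comm]
      refine Finset.sum_congr rfl fun s hs => ?_
      rw [Finset.sum_comm]
      refine Finset.sum_congr rfl fun a _ => ?_
      rw [mem_states] at hs
      subst hs
      rw [← sum_states_eq_sum hQ.isDynamics hh, Finset.mul_sum]
      refine Finset.sum_congr rfl fun s' hs' => ?_
      rw [← mul_assoc, mass_mul_induced hq hQ hh a hs']
    rw [e, ← Finset.sum_add_distrib]
    refine Finset.sum_le_sum fun s _ => ?_
    rw [← Finset.sum_add_distrib, Finset.sum_mul]
    refine Finset.sum_le_sum fun a _ => ?_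
    rw [← mul_add, show H - h = H - (h + 1) + 1 by omega]
    exact mul_le_mul_of_nonneg_left (hW1 _ _ _) (mass_nonneg hq s a)
  have main : ∀ k h, h + k = H → h < H →
      ∑ j ∈ Ico h H, ∑ s ∈ L.states j, ∑ a, mass L q s a * r s a
        ≤ ∑ s ∈ L.states h, (∑ a, mass L q s a) * W (H - h) s := by
    intro k
    induction k with
    | zero => intro h h1 h2; omega
    | succ k ih =>
      intro h h1 hh
      rw [Finset.sum_eq_sum_Ico_succ_bot hh]
      refine le_trans ?_ (hstep h hh)
      gcongr
      -- The flow constraints concern inner layers only; past the last transition `W 0 = 0` takes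
      -- their place.
      by_cases hlast : h + 1 < H
      · refine (ih (h + 1) (by omega) hlast).trans (le_of_eq ?_)
        refine Finset.sum_congr rfl fun s hs => ?_
        have := hq.flow (h + 1) (by omega) hlast s hs
        rw [Finset.sum_comm, Nat.add_sub_cancel] at this
        rw [← this]
        congr 1
        exact Finset.sum_congr rfl fun a _ => (hmass _ s hs a).symm
      · have : H - (h + 1) = 0 := by omega
        rw [this, Finset.Ico_eq_empty (by omega)]
        simp [hW0]
  rcases Nat.eq_zero_or_pos H with h0 | hpos
  · subst h0
    simp [hW0]
  · rw [Finset.range_eq_Ico]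
    refine (main H 0 (by omega) hpos).trans (le_of_eq ?_)
    have hs0 : L.states 0 = {L.s0} := by
      ext s; simp [mem_states, L.layer_eq_zero_iff]
    have := hq.total 0 hpos
    rw [hs0, Finset.sum_singleton] at this
    rw [hs0, Finset.sum_singleton, Nat.sub_zero]
    have e : ∑ a, mass L q L.s0 a = 1 := by
      rw [← this]
      exact Finset.sum_congr rfl fun a _ => (hmass 0 L.s0 (by simp [hs0]) a).symm
    rw [e, one_mul]

lemma induced_dist_le {Pbar q Q : S → A → S → ℝ} {ξ : S → A → ℝ} (hq : LPFeasible L Pbar ξ q)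
    (hQ : IsInduced L Pbar ξ q Q) {s : S} (hs : L.layer s < H) (a : A) :
    ∑ s' ∈ L.states (L.layer s + 1), |Q s a s' - Pbar s a s'| ≤ ξ s a := by
  by_cases hm : mass L q s a = 0
  · refine le_trans ?_ (hQ.conf s a hs hm)
    exact Finset.sum_le_sum_of_subset_of_nonneg (Finset.subset_univ _) fun _ _ _ => abs_nonneg _
  · have hpos : 0 < mass L q s a := lt_of_le_of_ne (mass_nonneg hq s a) (Ne.symm hm)
    have := hq.conf (L.layer s) hs s (mem_states.2 rfl) a
    change _ ≤ ξ s a * mass L q s a at this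
    refine le_of_mul_le_mul_right (le_trans (le_of_eq ?_) this) hpos
    rw [Finset.sum_mul]
    refine Finset.sum_congr rfl fun s' hs' => ?_
    change _ = |q s a s' - Pbar s a s' * mass L q s a|
    rw [← mass_mul_induced hq hQ hs a hs', ← abs_of_pos hpos, ← abs_mul, abs_of_pos hpos]
    congr 1
    ring

lemma dist_le_two {P Q : S → A → S → ℝ} (hP : L.IsDynamics P) (hQ : L.IsDynamics Q) {s : S}
    (hs : L.layer s < H) (a : A) (B : Finset S) : ∑ s' ∈ B, |Q s a s' - P s a s'| ≤ 2 := by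
  calc _ ≤ ∑ s', |Q s a s' - P s a s'| :=
        Finset.sum_le_sum_of_subset_of_nonneg (Finset.subset_univ _) fun _ _ _ => abs_nonneg _
    _ ≤ ∑ s', (Q s a s' + P s a s') := by
        refine Finset.sum_le_sum fun s' _ => ?_
        have h1 := hP.nonneg s a s' hs
        have h2 := hQ.nonneg s a s' hs
        rw [abs_le]; constructor <;> linarith
    _ = 2 := by
        rw [Finset.sum_add_distrib, hP.sum_eq_one _ _ hs, hQ.sum_eq_one _ _ hs]; norm_num

/-- The regret of one round in one context, when the true dynamics lie in the confidence set and
the reward estimate `f` has error at most the bonus `b` plus `g`. -/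
lemma regret_round_le [Nonempty A] {P Pbar : S → A → S → ℝ} {ξ : S → A → ℝ}
    (hP : L.IsDynamics P)
    (hconf : ∀ s a, L.layer s < H → ∑ s', |Pbar s a s' - P s a s'| ≤ ξ s a)
    {r f b g : S → A → ℝ} (hf : ∀ s a, f s a ∈ Set.Icc (0 : ℝ) 1)
    (hb : ∀ s a, 0 ≤ b s a) (π' π : S → A)
    (herr' : ∀ s, L.layer s < H → |f s (π' s) - r s (π' s)| ≤ b s (π' s) + g s (π' s))
    (herr : ∀ s, L.layer s < H → |f s (π s) - r s (π s)| ≤ b s (π s) + g s (π s))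
    (hπ : IsFOA L Pbar ξ (fun s a => f s a + b s a) π) :
    value P r π' H L.s0 - value P r π H L.s0
      ≤ ∑ h ∈ range H, ∑ s, occ P L.s0 π' h s * g s (π' s)
        + ∑ h ∈ range H, ∑ s, occ P L.s0 π h s * g s (π s)
        + 3 * ∑ s with L.layer s < H, b s (π s)
        + 2 * H * ∑ h ∈ range H, ∑ s, occ P L.s0 π h s * min 1 (ξ s (π s)) := by
  obtain ⟨q, Q, hq, hopt, hQ, hbest⟩ := hπ
  obtain ⟨π₀, hπ₀⟩ := lpObj_le_value (r := fun s a => f s a + b s a) hq hQ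
  have hoptim : value P (fun s a => f s a + b s a) π' H L.s0
      ≤ value Q (fun s a => f s a + b s a) π H L.s0 := by
    rw [← lpObj_extOcc hP]
    exact (hopt _ (extOcc_feasible hP hconf π')).trans (hπ₀.trans (hbest π₀))
  -- The bonus is split off before the dynamics are exchanged: it may exceed 1, so the simulation
  -- bound is applied to `f` alone. The bonus is bounded by its sum over states, because occupancies
  -- are at most 1.
  have hadd : ∀ (P : S → A → S → ℝ) (π : S → A), value P (fun s a => f s a + b s a) π H L.s0
      = value P f π H L.s0 + value P b π H L.s0 := by
    intro P π
    simp only [value_eq_sum_occ, mul_add, Finset.sum_add_distrib]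
  have h1 : value P r π' H L.s0 ≤ value P (fun s a => f s a + b s a) π' H L.s0
      + ∑ h ∈ range H, ∑ s, occ P L.s0 π' h s * g s (π' s) := by
    simp only [value_eq_sum_occ, ← Finset.sum_add_distrib, ← mul_add]
    refine sum_occ_mul_mono hP π' fun s hs => ?_
    have := neg_le_of_abs_le (herr' s hs)
    linarith
  have h2 : value P f π H L.s0 ≤ value P r π H L.s0
      + value P b π H L.s0 + ∑ h ∈ range H, ∑ s, occ P L.s0 π h s * g s (π s) := by
    simp only [value_eq_sum_occ, ← Finset.sum_add_distrib, ← mul_add]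
    refine sum_occ_mul_mono hP π fun s hs => ?_
    have := le_of_abs_le (herr s hs)
    linarith
  have hbP : ∀ {P : S → A → S → ℝ}, L.IsDynamics P →
      value P b π H L.s0 ≤ ∑ s with L.layer s < H, b s (π s) := by
    intro P hP
    rw [value_eq_sum_occ]
    exact sum_occ_mul_le_sum hP π fun s => hb s (π s)
  have hb1 := hbP hP
  have hb2 := hbP hQ.isDynamics
  -- The chain of inequalities spends the bonus twice, once under `Q` and once under `P`;
  -- nonnegativity absorbs the third copy in the statement.
  have hb0 : 0 ≤ ∑ s with L.layer s < H, b s (π s) := Finset.sum_nonneg fun s _ => hb _ _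
  -- Both `P` and `Q` are within `ξ` of `Pbar`, hence within `2ξ` of each other, and two
  -- distributions never differ by more than 2.
  have h3 := value_sub_value_le hP hQ.isDynamics (r := f) (fun s a _ => hf s a) π
    (e := fun s => 2 * min 1 (ξ s (π s))) (fun s hs => by
      rw [mul_min_of_nonneg _ _ (by norm_num : (0 : ℝ) ≤ 2), mul_one]
      refine le_min (dist_le_two hP hQ.isDynamics hs _ _) ?_
      have e1 := induced_dist_le hq hQ hs (π s)
      have e2 : ∑ s' ∈ L.states (L.layer s + 1), |Pbar s (π s) s' - P s (π s) s'|
          ≤ ξ s (π s) :=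
        (Finset.sum_le_sum_of_subset_of_nonneg (Finset.subset_univ _)
          fun _ _ _ => abs_nonneg _).trans (hconf s (π s) hs)
      calc _ ≤ ∑ s' ∈ L.states (L.layer s + 1), (|Q s (π s) s' - Pbar s (π s) s'|
            + |Pbar s (π s) s' - P s (π s) s'|) :=
            Finset.sum_le_sum fun s' _ => abs_sub_le _ _ _
        _ ≤ 2 * ξ s (π s) := by rw [Finset.sum_add_distrib]; linarith)
  have e3 : (H : ℝ) * ∑ h ∈ range H, ∑ s, occ P L.s0 π h s * (2 * min 1 (ξ s (π s)))
      = 2 * H * ∑ h ∈ range H, ∑ s, occ P L.s0 π h s * min 1 (ξ s (π s)) := by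
    rw [mul_comm (2 : ℝ) (H : ℝ), mul_assoc]
    congr 1
    simp only [Finset.mul_sum]
    exact Finset.sum_congr rfl fun h _ => Finset.sum_congr rfl fun s _ => by ring
  rw [e3] at h3
  rw [hadd Q π] at hoptim
  linarith

end LinearProgram

/-! ### The law of the state sequence of an episode. -/

section Paths

variable {S A : Type*} [Fintype S] {H : ℕ} {L : Layering S H} {P : S → A → S → ℝ}

open scoped Classical in
/-- The probability of the state sequence `x` in an episode of length `n`. -/
def pathW (P : S → A → S → ℝ) (s0 : S) (π : S → A) (n : ℕ) (x : Fin (n + 1) → S) : ℝ :=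
  (if x 0 = s0 then 1 else 0) *
    ∏ h : Fin n, P (x h.castSucc) (π (x h.castSucc)) (x h.succ)

/-- `P` is unconstrained at the final state, so arbitrary sequences are badly behaved. Those of
nonzero weight start at `s0` and climb one layer per step; later proofs discard all others. -/
lemma pathW_layer (hP : L.IsDynamics P) {π : S → A} {n : ℕ} (hn : n ≤ H) {x : Fin (n + 1) → S}
    (hx : pathW P L.s0 π n x ≠ 0) (i : Fin (n + 1)) : L.layer (x i) = i := by
  obtain ⟨h0, h1⟩ := mul_ne_zero_iff.1 hx
  have h0 : x 0 = L.s0 := by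
    by_contra h
    exact h0 (if_neg h)
  rw [Finset.prod_ne_zero_iff] at h1
  induction i using Fin.induction with
  | zero => rw [h0, L.layer_s0]; rfl
  | succ i ih =>
    by_contra hne
    refine h1 i (Finset.mem_univ _) (hP.eq_zero _ _ _ ?_ ?_)
    · rw [ih]; have := i.2; simp; omega
    · rw [ih]; simpa using hne

lemma pathW_nonneg (hP : L.IsDynamics P) (π : S → A) {n : ℕ} (hn : n ≤ H) (x : Fin (n + 1) → S) :
    0 ≤ pathW P L.s0 π n x := by
  by_cases hx : pathW P L.s0 π n x = 0
  · exact hx.ge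
  · unfold pathW
    refine mul_nonneg (by split_ifs <;> norm_num) (Finset.prod_nonneg fun h _ => ?_)
    refine hP.nonneg _ _ _ ?_
    rw [pathW_layer hP hn hx]
    have := h.2; simp; omega

lemma sum_path_snoc {n : ℕ} (f : (Fin (n + 2) → S) → ℝ) :
    ∑ x, f x = ∑ y : Fin (n + 1) → S, ∑ s : S, f (Fin.snoc (α := fun _ => S) y s) := by
  rw [← (Fin.snocEquiv fun _ => S).sum_comp, Fintype.sum_prod_type, Finset.sum_comm]
  rfl

lemma pathW_snoc (s0 : S) (π : S → A) {n : ℕ} (y : Fin (n + 1) → S) (s : S) :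
    pathW P s0 π (n + 1) (Fin.snoc (α := fun _ => S) y s)
      = pathW P s0 π n y * P (y (Fin.last n)) (π (y (Fin.last n))) s := by
  unfold pathW
  rw [Fin.prod_univ_castSucc]
  have h0 : (Fin.snoc (α := fun _ => S) y s : Fin (n + 2) → S) 0 = y 0 := by
    rw [← Fin.castSucc_zero, Fin.snoc_castSucc]
  simp only [Fin.snoc_castSucc, Fin.succ_castSucc, Fin.succ_last, Fin.snoc_last]
  by_cases h : y 0 = s0
  · rw [if_pos (h0.trans h), if_pos h, mul_assoc]
  · rw [if_neg (h0 ▸ h), if_neg h, mul_assoc]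

lemma sum_pathW_mul_last (s0 : S) (π : S → A) :
    ∀ (n : ℕ) (u : S → ℝ), ∑ x, pathW P s0 π n x * u (x (Fin.last n))
      = ∑ s, occ P s0 π n s * u s := by
  intro n
  induction n with
  | zero =>
    intro u
    classical
    rw [sum_occ_zero_mul, ← (Equiv.funUnique (Fin 1) S).symm.sum_comp]
    simp [pathW]
  | succ n ih =>
    intro u
    rw [sum_path_snoc, sum_occ_succ_mul, ← ih]
    refine Finset.sum_congr rfl fun y _ => ?_
    rw [Finset.mul_sum]
    refine Finset.sum_congr rfl fun s _ => ?_
    rw [pathW_snoc, Fin.snoc_last, mul_assoc]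

/-- Forgetting the last state leaves the law of the shorter path, because transition rows from
non-final layers sum to one. -/
lemma sum_pathW_succ_mul_init (hP : L.IsDynamics P) (π : S → A) {n : ℕ} (hn : n < H)
    (ψ : (Fin (n + 1) → S) → ℝ) :
    ∑ x, pathW P L.s0 π (n + 1) x * ψ (Fin.init (α := fun _ => S) x)
      = ∑ y, pathW P L.s0 π n y * ψ y := by
  rw [sum_path_snoc]
  refine Finset.sum_congr rfl fun y _ => ?_
  simp only [pathW_snoc, Fin.init_snoc]
  by_cases hy : pathW P L.s0 π n y = 0
  · simp [hy]
  · have hl := pathW_layer hP hn.le hy (Fin.last n)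
    rw [← Finset.sum_mul, ← Finset.mul_sum, hP.sum_eq_one _ _ (by rw [hl]; simpa using hn), mul_one]

/-- The joint law of two consecutive states. -/
lemma sum_pathW_mul_pair (hP : L.IsDynamics P) (π : S → A) :
    ∀ n ≤ H, ∀ (h : Fin n) (ψ : S → S → ℝ),
      ∑ x, pathW P L.s0 π n x * ψ (x h.castSucc) (x h.succ)
        = ∑ s, occ P L.s0 π h s * ∑ s', P s (π s) s' * ψ s s' := by
  intro n
  induction n with
  | zero => intro _ h; exact h.elim0
  | succ n ih =>
    intro hn h ψ
    induction h using Fin.lastCases with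
    | last =>
      rw [sum_path_snoc, Fin.val_last, ← sum_pathW_mul_last]
      refine Finset.sum_congr rfl fun y _ => ?_
      rw [Finset.mul_sum]
      refine Finset.sum_congr rfl fun s _ => ?_
      rw [pathW_snoc, Fin.snoc_castSucc, Fin.succ_last, Fin.snoc_last, mul_assoc]
    | cast j =>
      have := ih (by omega) j ψ
      rw [Fin.val_castSucc, ← this]
      exact sum_pathW_succ_mul_init hP π (by omega) fun y => ψ (y j.castSucc) (y j.succ)

lemma sum_pathW_mul_state (hP : L.IsDynamics P) (π : S → A) (h : Fin H) (u : S → ℝ) :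
    ∑ x, pathW P L.s0 π H x * u (x h.castSucc) = ∑ s, occ P L.s0 π h s * u s := by
  rw [sum_pathW_mul_pair hP π H le_rfl h fun s _ => u s]
  refine Finset.sum_congr rfl fun s _ => ?_
  rw [← Finset.sum_mul]
  by_cases hs : L.layer s = h
  · rw [hP.sum_eq_one _ _ (by rw [hs]; exact h.2), one_mul]
  · rw [occ_eq_zero hP π h h.2.le s hs, zero_mul, zero_mul]

lemma sum_pathW (hP : L.IsDynamics P) (π : S → A) {n : ℕ} (hn : n ≤ H) :
    ∑ x, pathW P L.s0 π n x = 1 := by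
  have := sum_pathW_mul_last (P := P) L.s0 π n fun _ => 1
  simpa [occ_sum hP π n hn] using this

lemma sum_pathW_mul_sum (hP : L.IsDynamics P) (π : S → A) (u : S → ℝ) :
    ∑ x, pathW P L.s0 π H x * ∑ h : Fin H, u (x h.castSucc)
      = ∑ h ∈ range H, ∑ s, occ P L.s0 π h s * u s := by
  simp only [Finset.mul_sum]
  rw [Finset.sum_comm, Finset.sum_range]
  exact Finset.sum_congr rfl fun h _ => sum_pathW_mul_state hP π h u

end Paths

/-! ### Exponential supermartingales and Hoeffding's lemma. -/

section Supermartingale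

open scoped ENNReal

variable {Ω : Type*} {mΩ : MeasurableSpace Ω} {μ : Measure Ω}

/-- The hypothesis says that the conditional expectation of `X` given `m` is at most 1. In terms of
measures: `μ` with density `X`, restricted to `m`, is below `μ` restricted to `m`, and the
`m`-measurable `W` can be integrated against both. -/
lemma lintegral_mul_le_of_setLIntegral_le {m : MeasurableSpace Ω} (hm : m ≤ mΩ)
    {X W : Ω → ℝ≥0∞} (hX : Measurable[mΩ] X) (hW : Measurable[m] W)
    (h : ∀ E, MeasurableSet[m] E → ∫⁻ ω in E, X ω ∂μ ≤ μ E) :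
    ∫⁻ ω, W ω * X ω ∂μ ≤ ∫⁻ ω, W ω ∂μ := by
  have h1 : (μ.withDensity X).trim hm ≤ μ.trim hm := by
    refine (@Measure.le_iff _ m _ _).2 fun E hE => ?_
    rw [trim_measurableSet_eq hm hE, trim_measurableSet_eq hm hE, withDensity_apply _ (hm _ hE)]
    exact h E hE
  have h2 := @lintegral_mono' _ m _ _ h1 _ _ (le_refl W)
  rw [lintegral_trim hm hW, lintegral_trim hm hW,
    lintegral_withDensity_eq_lintegral_mul μ hX (hW.mono hm le_rfl)] at h2
  simpa [mul_comm] using h2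

lemma lintegral_prod_le_one [IsProbabilityMeasure μ] {𝓕 : Filtration ℕ mΩ} {T : ℕ}
    {X : ℕ → Ω → ℝ≥0∞} (hX : ∀ i ∈ Icc 1 T, Measurable[𝓕 (i + 1)] (X i))
    (h : ∀ i ∈ Icc 1 T, ∀ E, MeasurableSet[𝓕 i] E → ∫⁻ ω in E, X i ω ∂μ ≤ μ E) :
    ∀ t ≤ T + 1, ∫⁻ ω, ∏ i ∈ Ico 1 t, X i ω ∂μ ≤ 1 := by
  intro t
  induction t with
  | zero => intro _; simp
  | succ t ih =>
    intro ht
    rcases Nat.eq_zero_or_pos t with h0 | hpos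
    · subst h0; simp
    · have htT : t ∈ Icc 1 T := by simp; omega
      simp only [Finset.prod_Ico_succ_top hpos]
      refine le_trans ?_ (ih (by omega))
      refine lintegral_mul_le_of_setLIntegral_le (𝓕.le t) ((hX t htT).mono (𝓕.le _) le_rfl) ?_
        (h t htT)
      refine Finset.measurable_prod (Ico 1 t) fun i hi => ?_
      simp only [Finset.mem_Ico] at hi
      exact (hX i (by simp; omega)).mono (𝓕.mono (by omega)) le_rfl

/-- A Chernoff bound for an adapted process whose conditional exponential moments are at most
one. -/
lemma measure_log_le_sum_le [IsProbabilityMeasure μ] {𝓕 : Filtration ℕ mΩ} {T : ℕ}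
    {Y : ℕ → Ω → ℝ} (hY : ∀ i ∈ Icc 1 T, Measurable[𝓕 (i + 1)] (Y i))
    (h : ∀ i ∈ Icc 1 T, ∀ E, MeasurableSet[𝓕 i] E →
      ∫⁻ ω in E, ENNReal.ofReal (Real.exp (Y i ω)) ∂μ ≤ μ E)
    {t : ℕ} (ht : t ≤ T + 1) {ε : ℝ} (hε : 0 < ε) :
    μ {ω | Real.log (1 / ε) ≤ ∑ i ∈ Ico 1 t, Y i ω} ≤ ENNReal.ofReal ε := by
  set X : ℕ → Ω → ℝ≥0∞ := fun i ω => ENNReal.ofReal (Real.exp (Y i ω)) with hXdef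
  have hX : ∀ i ∈ Icc 1 T, Measurable[𝓕 (i + 1)] (X i) := fun i hi =>
    (Real.measurable_exp.comp (hY i hi)).ennreal_ofReal
  have h1 := lintegral_prod_le_one hX h t ht
  have hm : Measurable fun ω => ∏ i ∈ Ico 1 t, X i ω := by
    refine Finset.measurable_prod (Ico 1 t) fun i hi => ?_
    simp only [Finset.mem_Ico] at hi
    exact (hX i (by simp; omega)).mono (𝓕.le _) le_rfl
  -- Markov's inequality for the product of the exponentials, at level `1/ε`.
  have h2 := (mul_meas_ge_le_lintegral (μ := μ) hm (ENNReal.ofReal (1 / ε))).trans h1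
  have hsub : {ω | Real.log (1 / ε) ≤ ∑ i ∈ Ico 1 t, Y i ω}
      ⊆ {ω | ENNReal.ofReal (1 / ε) ≤ ∏ i ∈ Ico 1 t, X i ω} := by
    intro ω hω
    simp only [Set.mem_ofPred_eq] at hω ⊢
    rw [hXdef]
    simp only
    rw [← ENNReal.ofReal_prod_of_nonneg fun i _ => (Real.exp_pos _).le, ← Real.exp_sum]
    refine ENNReal.ofReal_le_ofReal ?_
    rw [← Real.exp_log (by positivity : 0 < 1 / ε)]
    exact Real.exp_le_exp.2 hω
  refine (measure_mono hsub).trans ?_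
  have h3 : ENNReal.ofReal ε * (ENNReal.ofReal (1 / ε) *
      μ {ω | ENNReal.ofReal (1 / ε) ≤ ∏ i ∈ Ico 1 t, X i ω}) ≤ ENNReal.ofReal ε * 1 := by
    gcongr
  rwa [← mul_assoc, ← ENNReal.ofReal_mul hε.le, mul_one_div_cancel hε.ne', ENNReal.ofReal_one,
    one_mul, mul_one] at h3

lemma setLIntegral_eq_tsum_fiber {κ : Type*} [Countable κ] {k : Ω → κ}
    (hk : ∀ j, MeasurableSet {ω | k ω = j}) {E : Set Ω} (hE : MeasurableSet E) (f : Ω → ℝ≥0∞) :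
    ∫⁻ ω in E, f ω ∂μ = ∑' j, ∫⁻ ω in E ∩ {ω | k ω = j}, f ω ∂μ := by
  rw [← lintegral_iUnion (fun j => hE.inter (hk j))]
  · congr 2
    ext ω; simp
  · intro i j hij
    refine Set.disjoint_left.2 fun ω h1 h2 => hij ?_
    exact h1.2.symm.trans h2.2

/-- Hoeffding's lemma. -/
lemma lintegral_exp_le_of_mem_Icc [IsProbabilityMeasure μ] {X : Ω → ℝ} {a b : ℝ}
    (hm : AEMeasurable X μ) (hb : ∀ᵐ ω ∂μ, X ω ∈ Set.Icc a b) (t : ℝ) :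
    ∫⁻ ω, ENNReal.ofReal (Real.exp (t * (X ω - ∫ ω, X ω ∂μ))) ∂μ
      ≤ ENNReal.ofReal (Real.exp (t ^ 2 * (b - a) ^ 2 / 8)) := by
  have h := ProbabilityTheory.hasSubgaussianMGF_of_mem_Icc hm hb
  rw [← ofReal_integral_eq_lintegral_ofReal (h.integrable_exp_mul t)
    (Filter.Eventually.of_forall fun _ => (Real.exp_pos _).le)]
  refine ENNReal.ofReal_le_ofReal ((h.mgf_le t).trans (le_of_eq ?_))
  congr 1
  simp only [NNReal.coe_pow, NNReal.coe_div, coe_nnnorm, Real.norm_eq_abs, NNReal.coe_ofNat,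
    div_pow, sq_abs]
  ring

/-- Hoeffding's lemma for the finite distribution `w`, realized as a `PMF` on the discrete
σ-algebra. -/
lemma sum_mul_exp_le {ι : Type*} [Fintype ι] {w x : ι → ℝ} (hw : ∀ i, 0 ≤ w i)
    (hw1 : ∑ i, w i = 1) {a b : ℝ} (hx : ∀ i, x i ∈ Set.Icc a b) (t : ℝ) :
    ∑ i, w i * Real.exp (t * (x i - ∑ j, w j * x j)) ≤ Real.exp (t ^ 2 * (b - a) ^ 2 / 8) := by
  let _ : MeasurableSpace ι := ⊤
  let p : PMF ι := PMF.ofFintype (fun i => ENNReal.ofReal (w i)) (by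
    rw [← ENNReal.ofReal_sum_of_nonneg fun i _ => hw i, hw1, ENNReal.ofReal_one])
  have hp : ∀ i, (p i).toReal = w i := fun i => by
    simp [p, PMF.ofFintype_apply, ENNReal.toReal_ofReal (hw i)]
  have h := ProbabilityTheory.hasSubgaussianMGF_of_mem_Icc (μ := p.toMeasure) (X := x) (a := a)
    (b := b) measurable_from_top.aemeasurable (Filter.Eventually.of_forall hx)
  have h' := h.mgf_le t
  rw [ProbabilityTheory.mgf, PMF.integral_eq_sum, PMF.integral_eq_sum] at h'
  simp only [hp, smul_eq_mul] at h'
  refine h'.trans (le_of_eq ?_)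
  congr 1
  simp only [NNReal.coe_pow, NNReal.coe_div, coe_nnnorm, Real.norm_eq_abs, NNReal.coe_ofNat,
    div_pow, sq_abs]
  ring

end Supermartingale

/-! ### The conditional law of one episode. -/

section Round

open scoped ENNReal

variable {C S A Ω : Type*} [Fintype C] [Fintype S] {H T : ℕ}
  {mΩ : MeasurableSpace Ω} {μ : Measure Ω} [IsProbabilityMeasure μ] {M : CMDP C S A H}
  {𝓕 : Filtration ℕ mΩ} {σ : ℕ → Ω → Episode C S A} {pol : ℕ → Ω → C → S → A}

/-- The sequence of states of an episode. -/
def Episode.path (H : ℕ) (e : Episode C S A) (h : Fin (H + 1)) : S := e.st h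

lemma law_cell (hI : IsInteraction M T μ 𝓕 σ pol) {t : ℕ} (ht : t ∈ Icc 1 T) {p : C → S → A}
    {E : Set Ω} (hE : MeasurableSet[𝓕 t] E) (hp : ∀ ω ∈ E, pol t ω = p) (c : C)
    (x : Fin (H + 1) → S) {B : Fin H → Set ℝ} (hB : ∀ h, MeasurableSet (B h)) :
    μ {ω ∈ E | (σ t ω).ctx = c ∧ (σ t ω).path H = x ∧ ∀ h : Fin H, (σ t ω).rew h ∈ B h}
      = μ E * ENNReal.ofReal (M.D c * pathW M.P M.lay.s0 (p c) H x) *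
        ∏ h : Fin H, M.R c (x h.castSucc) (p c (x h.castSucc)) (B h) := by
  classical
  have := M.R_prob
  by_cases hx : x 0 = M.lay.s0
  swap
  -- The protocol's `law` covers only sequences that start in `s0`; for any other sequence both
  -- sides vanish.
  · have : pathW M.P M.lay.s0 (p c) H x = 0 := by simp [pathW, hx]
    rw [this, mul_zero, ENNReal.ofReal_zero, mul_zero, zero_mul]
    refine measure_mono_null (fun ω hω => ?_) (ae_iff.1 (hI.start t ht))
    obtain ⟨-, -, h1, -⟩ := hω
    intro h0
    apply hx
    rw [← h1, ← h0]
    rfl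
  -- The default values lie beyond the indices that `law` inspects, so their choice does not matter.
  set x' : ℕ → S := fun h => if hh : h < H + 1 then x ⟨h, hh⟩ else M.lay.s0 with hx'
  set B' : ℕ → Set ℝ := fun h => if hh : h < H then B ⟨h, hh⟩ else Set.univ with hB'
  have hxc : ∀ h : Fin H, x' h = x h.castSucc := fun h => by
    simp only [hx']; rw [dif_pos (by omega)]; rfl
  have hxs : ∀ h : Fin H, x' (h + 1) = x h.succ := fun h => by
    simp only [hx']; rw [dif_pos (by omega)]; rfl
  have hBc : ∀ h : Fin H, B' h = B h := fun h => by
    simp only [hB']; rw [dif_pos h.2]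
  have key := hI.law t ht p E hE hp c x' B' (by simpa [hx'] using hx) (fun h => by
    simp only [hB']; split_ifs; exacts [hB _, MeasurableSet.univ])
  have hset : {ω ∈ E | (σ t ω).ctx = c ∧ (∀ h ≤ H, (σ t ω).st h = x' h) ∧
      ∀ h < H, (σ t ω).rew h ∈ B' h}
      = {ω ∈ E | (σ t ω).ctx = c ∧ (σ t ω).path H = x ∧ ∀ h : Fin H, (σ t ω).rew h ∈ B h} := by
    ext ω
    have e1 : (∀ h ≤ H, (σ t ω).st h = x' h) ↔ (σ t ω).path H = x := by
      constructor
      · intro h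
        funext i
        have := h i (by omega)
        simp only [hx', dif_pos i.2] at this
        exact this
      · intro h i hi
        simp only [hx', dif_pos (Nat.lt_succ_of_le hi), ← h]
        rfl
    have e2 : (∀ h < H, (σ t ω).rew h ∈ B' h) ↔ ∀ h : Fin H, (σ t ω).rew h ∈ B h := by
      constructor
      · intro h i
        rw [← hBc]
        exact h i i.2
      · intro h i hi
        have := h ⟨i, hi⟩
        rwa [← hBc] at this
    simp only [Set.mem_ofPred_eq, e1, e2]
  rw [hset] at key
  rw [← ofReal_measureReal, key, Finset.prod_range]
  simp only [hxc, hxs, hBc, Finset.prod_mul_distrib]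
  have hw : pathW M.P M.lay.s0 (p c) H x
      = ∏ h : Fin H, M.P (x h.castSucc) (p c (x h.castSucc)) (x h.succ) := by
    simp [pathW, hx]
  rw [hw]
  have e3 : ∀ h : Fin H, M.R c (x h.castSucc) (p c (x h.castSucc)) (B h)
      = ENNReal.ofReal ((M.R c (x h.castSucc) (p c (x h.castSucc))).real (B h)) :=
    fun h => by rw [ofReal_measureReal]
  simp only [e3]
  rw [← ENNReal.ofReal_prod_of_nonneg fun h _ => measureReal_nonneg, ← ofReal_measureReal (s := E),
    ← ENNReal.ofReal_mul measureReal_nonneg, ← ENNReal.ofReal_mul]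
  · congr 1; ring
  · rw [← hw]
    exact mul_nonneg measureReal_nonneg
      (mul_nonneg (M.D_nonneg c) (pathW_nonneg M.isDynamics _ le_rfl _))

lemma measurableSet_path (hI : IsInteraction M T μ 𝓕 σ pol) {t : ℕ} (ht : t ∈ Icc 1 T)
    (x : Fin (H + 1) → S) : MeasurableSet[𝓕 (t + 1)] {ω | (σ t ω).path H = x} := by
  have : {ω | (σ t ω).path H = x} = ⋂ h : Fin (H + 1), {ω | (σ t ω).st h = x h} := by
    ext ω
    simp [funext_iff, Episode.path]
  rw [this]
  exact MeasurableSet.iInter fun h => hI.st_meas t ht h (by omega) (x h)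

lemma lintegral_prod_pi {n : ℕ} (ν : Fin n → Measure ℝ) [∀ h, IsProbabilityMeasure (ν h)]
    {G : Fin n → ℝ → ℝ≥0∞} (hG : ∀ h, Measurable (G h)) :
    ∫⁻ y, ∏ h, G h (y h) ∂(Measure.pi ν) = ∏ h, ∫⁻ z, G h z ∂(ν h) := by
  have hind := ProbabilityTheory.iIndepFun_pi (μ := ν) (X := G) fun h => (hG h).aemeasurable
  rw [ProbabilityTheory.lintegral_prod_eq_prod_lintegral_of_indepFun univ _ hind
    fun h => (hG h).comp (measurable_pi_apply h)]
  refine Finset.prod_congr rfl fun h _ => ?_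
  exact (measurePreserving_eval ν h).lintegral_comp (hG h)

/-- On a cell of fixed context and path, `law_cell` gives the mass of every box of rewards. Boxes
form a generating π-system, so the rewards are distributed as a multiple of a product measure, and
the integral of a product factorizes. -/
lemma lintegral_cell (hI : IsInteraction M T μ 𝓕 σ pol) {t : ℕ} (ht : t ∈ Icc 1 T)
    {p : C → S → A} {E : Set Ω} (hE : MeasurableSet[𝓕 t] E) (hp : ∀ ω ∈ E, pol t ω = p) (c : C)
    (x : Fin (H + 1) → S) {G : Fin H → ℝ → ℝ≥0∞} (hG : ∀ h, Measurable (G h)) :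
    ∫⁻ ω in E ∩ {ω | (σ t ω).ctx = c ∧ (σ t ω).path H = x}, ∏ h, G h ((σ t ω).rew h) ∂μ
      = μ E * ENNReal.ofReal (M.D c * pathW M.P M.lay.s0 (p c) H x) *
        ∏ h : Fin H, ∫⁻ z, G h z ∂(M.R c (x h.castSucc) (p c (x h.castSucc))) := by
  have hR := M.R_prob
  set ν : Fin H → Measure ℝ := fun h => M.R c (x h.castSucc) (p c (x h.castSucc)) with hν
  have : ∀ h, IsProbabilityMeasure (ν h) := fun h => hR _ _ _
  set cell : Set Ω := E ∩ {ω | (σ t ω).ctx = c ∧ (σ t ω).path H = x} with hcell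
  set b : ℝ≥0∞ := μ E * ENNReal.ofReal (M.D c * pathW M.P M.lay.s0 (p c) H x) with hb
  have hbtop : b ≠ ∞ := ENNReal.mul_ne_top (measure_ne_top _ _) ENNReal.ofReal_ne_top
  let X : Ω → Fin H → ℝ := fun ω h => (σ t ω).rew h
  have hX : Measurable X := measurable_pi_lambda _ fun h =>
    (hI.rew_meas t ht h h.2).mono (𝓕.le _) le_rfl
  have hbox : ∀ B : Fin H → Set ℝ, (∀ h, MeasurableSet (B h)) →
      (μ.restrict cell).map X (Set.pi Set.univ B) = (b • Measure.pi ν) (Set.pi Set.univ B) := by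
    intro B hB
    have hBm : MeasurableSet (Set.pi Set.univ B) := MeasurableSet.univ_pi hB
    rw [Measure.map_apply hX hBm, Measure.restrict_apply (hX hBm), Measure.smul_apply,
      Measure.pi_pi, smul_eq_mul, hb, ← law_cell hI ht hE hp c x hB]
    congr 1
    ext ω
    simp only [hcell, X, Set.mem_inter_iff, Set.mem_preimage, Set.mem_pi, Set.mem_univ, true_imp_iff,
      Set.mem_ofPred_eq]
    tauto
  have hmap : (μ.restrict cell).map X = b • Measure.pi ν := by
    have : IsFiniteMeasure ((μ.restrict cell).map X) :=
      Measure.isFiniteMeasure_map _ _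
    refine ext_of_generate_finite _ generateFrom_pi.symm isPiSystem_pi ?_ ?_
    · rintro _ ⟨B, hB, rfl⟩
      exact hbox B fun h => hB h (Set.mem_univ h)
    · have := hbox (fun _ => Set.univ) fun _ => MeasurableSet.univ
      simpa using this
  have hGm : Measurable fun y : Fin H → ℝ => ∏ h, G h (y h) :=
    Finset.measurable_prod _ fun h _ => (hG h).comp (measurable_pi_apply h)
  calc ∫⁻ ω in cell, ∏ h, G h ((σ t ω).rew h) ∂μ
      = ∫⁻ y, ∏ h, G h (y h) ∂((μ.restrict cell).map X) := (lintegral_map hGm hX).symm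
    _ = b * ∏ h, ∫⁻ z, G h z ∂(ν h) := by
        rw [hmap, lintegral_smul_measure, lintegral_prod_pi ν hG, smul_eq_mul]

/-- There are finitely many triples of policy, context and path, and those of path weight zero have
probability zero by `law_cell`. -/
lemma ae_layer [Finite A] (hI : IsInteraction M T μ 𝓕 σ pol) {t : ℕ} (ht : t ∈ Icc 1 T) :
    ∀ᵐ ω ∂μ, ∀ h ≤ H, M.lay.layer ((σ t ω).st h) = h := by
  have h1 : ∀ (p : C → S → A) (c : C) (x : Fin (H + 1) → S),
      ∀ᵐ ω ∂μ, pol t ω = p → (σ t ω).ctx = c → (σ t ω).path H = x →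
        pathW M.P M.lay.s0 (p c) H x ≠ 0 := by
    intro p c x
    by_cases hx : pathW M.P M.lay.s0 (p c) H x = 0
    swap
    · exact Filter.Eventually.of_forall fun _ _ _ _ => hx
    have := law_cell hI ht (hI.pol_meas t ht p) (fun ω hω => hω) c x
      (B := fun _ => Set.univ) fun _ => MeasurableSet.univ
    rw [hx, mul_zero, ENNReal.ofReal_zero, mul_zero, zero_mul] at this
    refine measure_mono_null (fun ω hω => ?_) this
    simp only [Set.mem_compl_iff, Set.mem_ofPred_eq, hx, ne_eq, not_true_eq_false, imp_false,
      not_forall, not_not, exists_prop, Set.mem_univ, implies_true, and_true] at hω ⊢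
    exact hω
  have h2 := ae_all_iff.2 fun p => ae_all_iff.2 fun c => ae_all_iff.2 fun x => h1 p c x
  filter_upwards [h2] with ω hω h hh
  have := hω _ _ _ rfl rfl rfl
  exact pathW_layer M.isDynamics le_rfl this ⟨h, by omega⟩

end Round

/-! ### The generic concentration inequality of the interaction. -/

section Concentration

open scoped ENNReal

variable {C S A Ω : Type*} [Fintype C] [Fintype S] [Fintype A] {H T : ℕ}
  {mΩ : MeasurableSpace Ω} {μ : Measure Ω} [IsProbabilityMeasure μ] {M : CMDP C S A H}
  {𝓕 : Filtration ℕ mΩ} {σ : ℕ → Ω → Episode C S A} {pol : ℕ → Ω → C → S → A}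

/-- Only episodes before round `t` enter, so the counts are known before the round and may
parametrize its increment. -/
lemma measurableSet_visits (hI : IsInteraction M T μ 𝓕 σ pol) {t : ℕ} (ht : t ∈ Icc 1 T)
    (N : S → A → ℕ) :
    MeasurableSet[𝓕 t] {ω | (fun s a => visits H (fun j => σ j ω) t s a) = N} := by
  classical
  have h1 : ∀ s a, Measurable[𝓕 t] fun ω => visits H (fun j => σ j ω) t s a := by
    intro s a
    simp only [visits, Finset.card_filter]
    refine Finset.measurable_sum _ fun i hi => ?_
    simp only [Finset.mem_Ico, Finset.mem_Icc] at hi ht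
    refine Measurable.ite ?_ measurable_const measurable_const
    have : {ω | ∃ h < H, (σ i ω).st h = s ∧ (σ i ω).act h = a}
        = ⋃ h : Fin H, {ω | (σ i ω).st h = s} ∩ {ω | (σ i ω).act h = a} := by
      ext ω
      simp only [Set.mem_ofPred_eq, Set.mem_iUnion, Set.mem_inter_iff]
      exact ⟨fun ⟨h, hh, h1⟩ => ⟨⟨h, hh⟩, h1⟩, fun ⟨h, h1⟩ => ⟨h, h.2, h1⟩⟩
    rw [this]
    have hi' : i ∈ Icc 1 T := by simp; omega
    refine MeasurableSet.iUnion fun h => ?_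
    exact 𝓕.mono (by omega : i + 1 ≤ t) _
      ((hI.st_meas i hi' h h.2.le s).inter (hI.act_meas i hi' h h.2 a))
  have : {ω | (fun s a => visits H (fun j => σ j ω) t s a) = N}
      = ⋂ s, ⋂ a, {ω | visits H (fun j => σ j ω) t s a = N s a} := by
    ext ω; simp [funext_iff]
  rw [this]
  exact MeasurableSet.iInter fun s => MeasurableSet.iInter fun a =>
    h1 s a (measurableSet_singleton _)

lemma measurable_comp_countable {Ω κ : Type*} [Countable κ] {m : MeasurableSpace Ω} {k : Ω → κ}
    (hk : ∀ q, MeasurableSet {ω | k ω = q}) {n : ℕ} {X : Ω → Fin n → ℝ}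
    (hX : ∀ h, Measurable fun ω => X ω h) {Z : κ → (Fin n → ℝ) → ℝ} (hZ : ∀ q, Measurable (Z q)) :
    Measurable fun ω => Z (k ω) (X ω) := by
  let _ : MeasurableSpace κ := ⊤
  have h1 : Measurable k := measurable_to_countable' hk
  have h3 : Measurable (Function.uncurry Z) := measurable_from_prod_countable_right hZ
  exact h3.comp (h1.prodMk (measurable_pi_lambda _ hX))

/-- The generic concentration inequality along the interaction. Per round, the increment consists
of a function `y` of the policy, the visit counts, the context and the state sequence, and of a
function `g` of the individual rewards, whose exponential moments are controlled by `B`. -/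
lemma measure_log_le_sum_round_le (hI : IsInteraction M T μ 𝓕 σ pol)
    (y : (C → S → A) → (S → A → ℕ) → C → (Fin (H + 1) → S) → ℝ)
    (g : C → S → A → ℝ → ℝ) (hg : ∀ c s a, Measurable (g c s a)) (B : C → S → A → ℝ)
    (hB : ∀ c s a, M.lay.layer s < H →
      ∫⁻ z, ENNReal.ofReal (Real.exp (g c s a z)) ∂(M.R c s a) ≤ ENNReal.ofReal (Real.exp (B c s a)))
    (hy : ∀ p N, ∑ c, M.D c * ∑ x, pathW M.P M.lay.s0 (p c) H x *
      Real.exp (y p N c x + ∑ h : Fin H, B c (x h.castSucc) (p c (x h.castSucc))) ≤ 1)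
    {t : ℕ} (ht : t ≤ T + 1) {ε : ℝ} (hε : 0 < ε) :
    μ {ω | Real.log (1 / ε) ≤ ∑ i ∈ Ico 1 t,
      (y (pol i ω) (visits H (fun j => σ j ω) i) (σ i ω).ctx ((σ i ω).path H)
        + ∑ h ∈ range H, g (σ i ω).ctx ((σ i ω).st h) ((σ i ω).act h) ((σ i ω).rew h))}
      ≤ ENNReal.ofReal ε := by
  classical
  let k : ℕ → Ω → (C → S → A) × (S → A → ℕ) × C × (Fin (H + 1) → S) := fun i ω =>
    (pol i ω, visits H (fun j => σ j ω) i, (σ i ω).ctx, (σ i ω).path H)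
  let Z : (C → S → A) × (S → A → ℕ) × C × (Fin (H + 1) → S) → (Fin H → ℝ) → ℝ := fun q z =>
    y q.1 q.2.1 q.2.2.1 q.2.2.2 + ∑ h : Fin H, g q.2.2.1 (q.2.2.2 h.castSucc)
      (q.1 q.2.2.1 (q.2.2.2 h.castSucc)) (z h)
  let Y : ℕ → Ω → ℝ := fun i ω => Z (k i ω) fun h => (σ i ω).rew h
  have hZ : ∀ q, Measurable (Z q) := fun q =>
    measurable_const.add (Finset.measurable_sum _ fun h _ => (hg _ _ _).comp (measurable_pi_apply h))
  have hkm : ∀ i ∈ Icc 1 T, ∀ q, MeasurableSet[𝓕 (i + 1)] {ω | k i ω = q} := by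
    rintro i hi ⟨p, N, c, x⟩
    have : {ω | k i ω = (p, N, c, x)} = {ω | pol i ω = p} ∩
        ({ω | (fun s a => visits H (fun j => σ j ω) i s a) = N} ∩
          ({ω | (σ i ω).ctx = c} ∩ {ω | (σ i ω).path H = x})) := by
      ext ω; simp [k]
    rw [this]
    exact (𝓕.mono (Nat.le_succ i) _ (hI.pol_meas i hi p)).inter
      ((𝓕.mono (Nat.le_succ i) _ (measurableSet_visits hI hi N)).inter
        ((hI.ctx_meas i hi c).inter (measurableSet_path hI hi x)))
  have hYm : ∀ i ∈ Icc 1 T, Measurable[𝓕 (i + 1)] (Y i) := by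
    intro i hi
    exact measurable_comp_countable (m := 𝓕 (i + 1)) (hkm i hi)
      (fun h => hI.rew_meas i hi h h.2) hZ
  have hYE : ∀ i ∈ Icc 1 T, ∀ E, MeasurableSet[𝓕 i] E →
      ∫⁻ ω in E, ENNReal.ofReal (Real.exp (Y i ω)) ∂μ ≤ μ E := by
    intro i hi E hE
    -- Conditioning by hand: the policy and the counts take countably many values, each on an event
    -- of `𝓕 i`, and on such an event `law` applies with a fixed policy.
    let d : Ω → (C → S → A) × (S → A → ℕ) := fun ω =>
      (pol i ω, visits H (fun j => σ j ω) i)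
    have hd : ∀ q, MeasurableSet[𝓕 i] {ω | d ω = q} := by
      rintro ⟨p, N⟩
      have : {ω | d ω = (p, N)} = {ω | pol i ω = p} ∩
          {ω | (fun s a => visits H (fun j => σ j ω) i s a) = N} := by
        ext ω; simp [d]
      rw [this]
      exact (hI.pol_meas i hi p).inter (measurableSet_visits hI hi N)
    rw [setLIntegral_eq_tsum_fiber (fun q => 𝓕.le i _ (hd q)) (𝓕.le i _ hE)]
    have hμE : μ E = ∑' q, μ (E ∩ {ω | d ω = q}) := by
      have := setLIntegral_eq_tsum_fiber (μ := μ) (fun q => 𝓕.le i _ (hd q)) (𝓕.le i _ hE)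
        fun _ => 1
      simpa using this
    rw [hμE]
    refine ENNReal.tsum_le_tsum fun q => ?_
    obtain ⟨p, N⟩ := q
    set E' := E ∩ {ω | d ω = (p, N)} with hE'
    have hE'm : MeasurableSet[𝓕 i] E' := hE.inter (hd _)
    have hp : ∀ ω ∈ E', pol i ω = p := fun ω hω => congrArg Prod.fst hω.2
    have hN : ∀ ω ∈ E', visits H (fun j => σ j ω) i = N := fun ω hω => congrArg Prod.snd hω.2
    have hcx : ∀ q : C × (Fin (H + 1) → S),
        MeasurableSet {ω | ((σ i ω).ctx, (σ i ω).path H) = q} := by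
      rintro ⟨c, x⟩
      have : {ω | ((σ i ω).ctx, (σ i ω).path H) = (c, x)}
          = {ω | (σ i ω).ctx = c} ∩ {ω | (σ i ω).path H = x} := by
        ext ω; simp
      rw [this]
      exact 𝓕.le (i + 1) _ ((hI.ctx_meas i hi c).inter (measurableSet_path hI hi x))
    rw [setLIntegral_eq_tsum_fiber hcx (𝓕.le i _ hE'm), tsum_fintype, Fintype.sum_prod_type]
    have hcell : ∀ c x,
        ∫⁻ ω in E' ∩ {ω | ((σ i ω).ctx, (σ i ω).path H) = (c, x)},
          ENNReal.ofReal (Real.exp (Y i ω)) ∂μ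
        ≤ μ E' * ENNReal.ofReal (M.D c * (pathW M.P M.lay.s0 (p c) H x *
          Real.exp (y p N c x + ∑ h : Fin H, B c (x h.castSucc) (p c (x h.castSucc))))) := by
      intro c x
      have hset : {ω | ((σ i ω).ctx, (σ i ω).path H) = (c, x)}
          = {ω | (σ i ω).ctx = c ∧ (σ i ω).path H = x} := by ext ω; simp
      rw [hset]
      have hcm : MeasurableSet (E' ∩ {ω | (σ i ω).ctx = c ∧ (σ i ω).path H = x}) := by
        rw [← hset]; exact (𝓕.le i _ hE'm).inter (hcx _)
      have e1 : ∫⁻ ω in E' ∩ {ω | (σ i ω).ctx = c ∧ (σ i ω).path H = x},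
            ENNReal.ofReal (Real.exp (Y i ω)) ∂μ
          = ∫⁻ ω in E' ∩ {ω | (σ i ω).ctx = c ∧ (σ i ω).path H = x},
            ENNReal.ofReal (Real.exp (y p N c x)) * ∏ h : Fin H, ENNReal.ofReal
              (Real.exp (g c (x h.castSucc) (p c (x h.castSucc)) ((σ i ω).rew h))) ∂μ := by
        refine setLIntegral_congr_fun hcm fun ω hω => ?_
        have hk : k i ω = (p, N, c, x) := by
          simp only [k, hp ω hω.1, hN ω hω.1, hω.2.1, hω.2.2]
        simp only [Y, hk, Z]
        rw [Real.exp_add, Real.exp_sum, ENNReal.ofReal_mul (Real.exp_pos _).le,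
          ENNReal.ofReal_prod_of_nonneg fun _ _ => (Real.exp_pos _).le]
      have hGm : ∀ h : Fin H, Measurable fun z =>
          ENNReal.ofReal (Real.exp (g c (x h.castSucc) (p c (x h.castSucc)) z)) := fun h =>
        (Real.measurable_exp.comp (hg _ _ _)).ennreal_ofReal
      rw [e1, lintegral_const_mul' _ _ ENNReal.ofReal_ne_top,
        lintegral_cell hI hi hE'm hp c x hGm]
      -- The bound `hB` is available at non-final states only, which is all that a path of nonzero
      -- weight visits before step `H`.
      by_cases hw : pathW M.P M.lay.s0 (p c) H x = 0
      · simp [hw]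
      have hle : ∏ h : Fin H, ∫⁻ z, ENNReal.ofReal (Real.exp
            (g c (x h.castSucc) (p c (x h.castSucc)) z)) ∂(M.R c (x h.castSucc) (p c (x h.castSucc)))
          ≤ ∏ h : Fin H, ENNReal.ofReal (Real.exp (B c (x h.castSucc) (p c (x h.castSucc)))) := by
        refine Finset.prod_le_prod' fun h _ => hB _ _ _ ?_
        rw [pathW_layer M.isDynamics le_rfl hw]
        exact h.2
      rw [← ENNReal.ofReal_prod_of_nonneg fun _ _ => (Real.exp_pos _).le, ← Real.exp_sum] at hle
      calc _ ≤ ENNReal.ofReal (Real.exp (y p N c x)) *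
            (μ E' * ENNReal.ofReal (M.D c * pathW M.P M.lay.s0 (p c) H x) * ENNReal.ofReal
              (Real.exp (∑ h : Fin H, B c (x h.castSucc) (p c (x h.castSucc))))) := by gcongr
        _ = _ := by
            rw [Real.exp_add, ← mul_assoc (M.D c), ENNReal.ofReal_mul (mul_nonneg (M.D_nonneg c)
              (pathW_nonneg M.isDynamics _ le_rfl x)), ENNReal.ofReal_mul (Real.exp_pos _).le]
            ring
    calc _ ≤ ∑ c, ∑ x, μ E' * ENNReal.ofReal (M.D c * (pathW M.P M.lay.s0 (p c) H x *
          Real.exp (y p N c x + ∑ h : Fin H, B c (x h.castSucc) (p c (x h.castSucc))))) :=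
          Finset.sum_le_sum fun c _ => Finset.sum_le_sum fun x _ => hcell c x
      _ = μ E' * ENNReal.ofReal (∑ c, M.D c * ∑ x, pathW M.P M.lay.s0 (p c) H x *
          Real.exp (y p N c x + ∑ h : Fin H, B c (x h.castSucc) (p c (x h.castSucc)))) := by
          have hnn : ∀ c x, 0 ≤ M.D c * (pathW M.P M.lay.s0 (p c) H x * Real.exp
              (y p N c x + ∑ h : Fin H, B c (x h.castSucc) (p c (x h.castSucc)))) := fun c x =>
            mul_nonneg (M.D_nonneg c)
              (mul_nonneg (pathW_nonneg M.isDynamics _ le_rfl x) (Real.exp_pos _).le)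
          simp only [← Finset.mul_sum]
          congr 1
          simp only [Finset.mul_sum]
          rw [ENNReal.ofReal_sum_of_nonneg fun c _ => Finset.sum_nonneg fun x _ => hnn c x]
          refine Finset.sum_congr rfl fun c _ => ?_
          rw [ENNReal.ofReal_sum_of_nonneg fun x _ => hnn c x]
      _ ≤ μ E' * ENNReal.ofReal 1 := by gcongr; exact hy p N
      _ = μ E' := by simp
  refine le_trans (measure_mono_ae ?_) (measure_log_le_sum_le hYm hYE ht hε)
  -- The increment `Y` uses the prescribed actions, which agree with the recorded ones almost surely
  -- only.
  have hact : ∀ᵐ ω ∂μ, ∀ i ∈ Icc 1 T, ∀ h : Fin H,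
      (σ i ω).act h = pol i ω (σ i ω).ctx ((σ i ω).st h) :=
    (ae_ball_iff (Set.to_countable _)).2 fun i hi => ae_all_iff.2 fun h => hI.act_eq i hi h h.2
  filter_upwards [hact] with ω hω
  change Real.log (1 / ε) ≤ _ → Real.log (1 / ε) ≤ _
  intro h
  refine h.trans (le_of_eq ?_)
  refine Finset.sum_congr rfl fun i hi => ?_
  simp only [Y, Z, k, Finset.sum_range]
  congr 1
  refine Finset.sum_congr rfl fun h _ => ?_
  rw [hω i (by simp at hi ⊢; omega) h]
  rfl

end Concentration

/-! ### The four concentration statements for fixed parameters. -/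

section Events

open scoped ENNReal

variable {C S A Ω : Type*} [Fintype C] [Fintype S] [Fintype A] {H T : ℕ}
  {mΩ : MeasurableSpace Ω} {μ : Measure Ω} [IsProbabilityMeasure μ] {M : CMDP C S A H}
  {𝓕 : Filtration ℕ mΩ} {σ : ℕ → Ω → Episode C S A} {pol : ℕ → Ω → C → S → A}

/-- On `[0,1]`, 1 ≤ (1 - z/2)(1 + z) ≤ (1 - z/2) exp z. -/
lemma exp_neg_le_one_sub_half {z : ℝ} (h0 : 0 ≤ z) (h1 : z ≤ 1) : Real.exp (-z) ≤ 1 - z / 2 := by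
  rw [Real.exp_neg]
  have h2 : 1 ≤ (1 - z / 2) * (1 + z) := by nlinarith
  have h3 : 1 + z ≤ Real.exp z := by linarith [Real.add_one_le_exp z]
  rw [inv_le_iff_one_le_mul₀ (Real.exp_pos _)]
  exact h2.trans (mul_le_mul_of_nonneg_left h3 (by linarith))

/-- Convexity puts the exponential below its chord on `[0,1]`, whose slope e - 1 is less than 2. -/
lemma exp_le_one_add_two_mul {z : ℝ} (h0 : 0 ≤ z) (h1 : z ≤ 1) : Real.exp z ≤ 1 + 2 * z := by
  have := convexOn_exp.2 (Set.mem_univ 0) (Set.mem_univ 1) (by linarith : 0 ≤ 1 - z) h0 (by ring)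
  simp only [smul_eq_mul, mul_zero, zero_add, mul_one, Real.exp_zero] at this
  nlinarith [Real.exp_one_lt_d9]

/-- Exponential moments of a sum of functions of the states, with values in `[0,1]`. -/
lemma sum_pathW_mul_exp_le (π : S → A) {u : S → ℝ}
    (hu : ∀ s, M.lay.layer s < H → u s ∈ Set.Icc (0 : ℝ) 1) {κ : ℝ} (hκ0 : 0 < κ) (hκ : H ≤ κ) :
    ∑ x, pathW M.P M.lay.s0 π H x * Real.exp (-(∑ h : Fin H, u (x h.castSucc)) / κ)
      ≤ 1 - (∑ h ∈ range H, ∑ s, occ M.P M.lay.s0 π h s * u s) / (2 * κ) := by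
  have h1 : ∀ x, pathW M.P M.lay.s0 π H x * Real.exp (-(∑ h : Fin H, u (x h.castSucc)) / κ)
      ≤ pathW M.P M.lay.s0 π H x
        - (pathW M.P M.lay.s0 π H x * ∑ h : Fin H, u (x h.castSucc)) / (2 * κ) := by
    intro x
    by_cases hx : pathW M.P M.lay.s0 π H x = 0
    · simp [hx]
    have hux : ∀ h : Fin H, u (x h.castSucc) ∈ Set.Icc (0 : ℝ) 1 := fun h => hu _ (by
      rw [pathW_layer M.isDynamics le_rfl hx]; exact h.2)
    have h0 : 0 ≤ ∑ h : Fin H, u (x h.castSucc) := Finset.sum_nonneg fun h _ => (hux h).1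
    have h1 : ∑ h : Fin H, u (x h.castSucc) ≤ H := by
      calc _ ≤ ∑ h : Fin H, (1 : ℝ) := Finset.sum_le_sum fun h _ => (hux h).2
        _ = H := by simp
    have := exp_neg_le_one_sub_half (z := (∑ h : Fin H, u (x h.castSucc)) / κ)
      (div_nonneg h0 hκ0.le) ((div_le_one hκ0).2 (h1.trans hκ))
    rw [neg_div]
    refine (mul_le_mul_of_nonneg_left this (pathW_nonneg M.isDynamics π le_rfl x)).trans
      (le_of_eq ?_)
    field_simp
  refine (Finset.sum_le_sum fun x _ => h1 x).trans (le_of_eq ?_)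
  rw [Finset.sum_sub_distrib, ← Finset.sum_div, sum_pathW M.isDynamics π le_rfl,
    sum_pathW_mul_sum M.isDynamics]

lemma CMDP.r_mem_Icc (M : CMDP C S A H) (c : C) (s : S) (a : A) :
    M.r c s a ∈ Set.Icc (0 : ℝ) 1 := by
  have := M.R_prob c s a
  have hId : Integrable (fun x : ℝ => x) (M.R c s a) :=
    Integrable.of_mem_Icc 0 1 aemeasurable_id (M.R_mem c s a)
  constructor
  · exact integral_nonneg_of_ae ((M.R_mem c s a).mono fun x hx => hx.1)
  · have := integral_mono_ae hId (integrable_const (1 : ℝ)) ((M.R_mem c s a).mono fun x hx => hx.2)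
    simpa [CMDP.r] using this

/-- The expected squared error of `f` in an episode with context `c` played with `p`. -/
def CMDP.sqErr (M : CMDP C S A H) (f : C → S → A → ℝ) (p : C → S → A) (c : C) : ℝ :=
  ∑ h ∈ range H, ∑ s, occ M.P M.lay.s0 (p c) h s * (f c s (p c s) - M.r c s (p c s)) ^ 2

lemma CMDP.sum_D_mul_one_sub (M : CMDP C S A H) (v : C → ℝ) (k : ℝ) :
    ∑ c, M.D c * (1 - v c / k) = 1 - (∑ c, M.D c * v c) / k := by
  simp only [mul_sub, mul_one, Finset.sum_sub_distrib, M.D_sum, Finset.sum_div, mul_div_assoc]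

/-- Concentration for the least squares regression: the excess loss of a fixed `f` controls its
expected squared error. -/
lemma measure_regression_le (hI : IsInteraction M T μ 𝓕 σ pol) (hH : 0 < H)
    {f f₀ : C → S → A → ℝ} (hf : ∀ c s a, f c s a ∈ Set.Icc (0 : ℝ) 1)
    (hf₀ : ∀ c s a, M.lay.layer s < H → f₀ c s a = M.r c s a)
    {t : ℕ} (ht : t ≤ T + 1) {ε : ℝ} (hε : 0 < ε) :
    μ {ω | Real.log (1 / ε) ≤ (∑ i ∈ Ico 1 t, ∑ c, M.D c * M.sqErr f (pol i ω) c) / (4 * H)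
        - (sqLoss H (fun j => σ j ω) t f - sqLoss H (fun j => σ j ω) t f₀) / H}
      ≤ ENNReal.ofReal ε := by
  have hH1 : (1 : ℝ) ≤ H := by exact_mod_cast hH
  have hH0 : (0 : ℝ) < H := by linarith
  have key := measure_log_le_sum_round_le hI
    (fun p _ _ _ => (∑ c, M.D c * M.sqErr f p c) / (4 * H))
    (fun c s a z => -((f c s a - z) ^ 2 - (f₀ c s a - z) ^ 2) / H)
    (fun c s a => by fun_prop)
    -- With d = f - r, the increment has drift -d²/H and noise of slope 2d/H. Hoeffding charges
    -- (2d/H)²/8 = d²/(2H²) ≤ d²/(2H), so half of the drift survives.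
    (fun c s a => -(f c s a - M.r c s a) ^ 2 / (2 * H))
    (fun c s a hs => by
      have := M.R_prob c s a
      set d := f c s a - M.r c s a with hd
      have e : ∀ z, -((f c s a - z) ^ 2 - (f₀ c s a - z) ^ 2) / H
          = -d ^ 2 / H + (2 * d / H) * (z - ∫ x, x ∂(M.R c s a)) := by
        intro z
        rw [hf₀ c s a hs]
        change _ = -d ^ 2 / H + (2 * d / H) * (z - M.r c s a)
        rw [hd]
        ring
      simp only [e, Real.exp_add, ENNReal.ofReal_mul (Real.exp_pos _).le]
      rw [lintegral_const_mul' _ _ ENNReal.ofReal_ne_top]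
      have hoef := lintegral_exp_le_of_mem_Icc (μ := M.R c s a) (X := fun x => x)
        aemeasurable_id (M.R_mem c s a) (2 * d / H)
      refine (mul_le_mul_of_nonneg_left hoef zero_le).trans ?_
      rw [← ENNReal.ofReal_mul (Real.exp_pos _).le, ← Real.exp_add]
      refine ENNReal.ofReal_le_ofReal (Real.exp_le_exp.2 ?_)
      have : -d ^ 2 / H + (2 * d / H) ^ 2 * (1 - 0) ^ 2 / 8
          = -d ^ 2 / (2 * H) - d ^ 2 * (H - 1) / (2 * H ^ 2) := by
        field_simp; ring
      rw [this]
      have : 0 ≤ d ^ 2 * (H - 1) / (2 * H ^ 2) := by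
        have : 0 ≤ (H : ℝ) - 1 := by linarith
        positivity
      linarith)
    (fun p N => by
      set e := (∑ c, M.D c * M.sqErr f p c) / (4 * H) with he
      calc _ ≤ ∑ c, M.D c * (Real.exp e * (1 - M.sqErr f p c / (4 * H))) := by
            refine Finset.sum_le_sum fun c _ => mul_le_mul_of_nonneg_left ?_ (M.D_nonneg c)
            have := sum_pathW_mul_exp_le (M := M) (p c)
              (u := fun s => (f c s (p c s) - M.r c s (p c s)) ^ 2) (fun s _ => by
                have h1 := hf c s (p c s)
                have h2 := M.r_mem_Icc c s (p c s)
                exact ⟨sq_nonneg _, by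
                  rw [sq_le_one_iff_abs_le_one, abs_le]
                  constructor <;> linarith [h1.1, h1.2, h2.1, h2.2]⟩)
              -- The surviving drift is the squared error divided by `2H`; the loss of a factor two
              -- in `sum_pathW_mul_exp_le` makes this `4H`.
              (κ := 2 * H) (by linarith) (by linarith)
            have h2 := mul_le_mul_of_nonneg_left this (Real.exp_pos e).le
            rw [← mul_assoc 2 2 (H : ℝ), show (2 : ℝ) * 2 = 4 by norm_num] at h2
            refine le_trans (le_of_eq ?_) h2
            rw [Finset.mul_sum]
            refine Finset.sum_congr rfl fun x _ => ?_
            rw [Real.exp_add, ← Finset.sum_div, Finset.sum_neg_distrib]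
            ring
        _ = Real.exp e * (1 - e) := by
            simp only [mul_left_comm _ (Real.exp e), ← Finset.mul_sum, M.sum_D_mul_one_sub]
            rw [he]
        _ ≤ Real.exp e * Real.exp (-e) := by
            gcongr
            linarith [Real.add_one_le_exp (-e)]
        _ = 1 := by rw [← Real.exp_add, add_neg_cancel, Real.exp_zero])
    ht hε
  refine le_trans (measure_mono fun ω hω => ?_) key
  change Real.log (1 / ε) ≤ _ at hω
  change Real.log (1 / ε) ≤ _
  refine hω.trans (le_of_eq ?_)
  rw [Finset.sum_add_distrib, ← Finset.sum_div, sub_eq_add_neg]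
  congr 1
  simp only [sqLoss, ← Finset.sum_sub_distrib, Finset.sum_neg_distrib, Finset.sum_div, neg_div]

/-- Observed sums control expected sums of nonnegative functions of the visited pairs. -/
lemma measure_visited_le (hI : IsInteraction M T μ 𝓕 σ pol) (hH : 0 < H)
    {u : (S → A → ℕ) → S → A → ℝ} (hu : ∀ N s a, u N s a ∈ Set.Icc (0 : ℝ) 1)
    {t : ℕ} (ht : t ≤ T + 1) {ε : ℝ} (hε : 0 < ε) :
    μ {ω | Real.log (1 / ε) ≤
        (∑ i ∈ Ico 1 t, ∑ c, M.D c * ∑ h ∈ range H, ∑ s, occ M.P M.lay.s0 (pol i ω c) h s *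
          u (visits H (fun j => σ j ω) i) s (pol i ω c s)) / (2 * H)
        - (∑ i ∈ Ico 1 t, ∑ h ∈ range H, u (visits H (fun j => σ j ω) i) ((σ i ω).st h)
            (pol i ω (σ i ω).ctx ((σ i ω).st h))) / H}
      ≤ ENNReal.ofReal ε := by
  have hH0 : (0 : ℝ) < H := by exact_mod_cast hH
  have key := measure_log_le_sum_round_le hI
    -- A multiplicative lower tail: the expected sum is at most twice the observed one plus a term
    -- `2H log(1/ε)`, without a deviation of order √T.
    (fun p N c x => (∑ c, M.D c * ∑ h ∈ range H, ∑ s, occ M.P M.lay.s0 (p c) h s *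
          u N s (p c s)) / (2 * H)
      + -(∑ h : Fin H, u N (x h.castSucc) (p c (x h.castSucc))) / H)
    (fun _ _ _ _ => 0) (fun _ _ _ => measurable_const) (fun _ _ _ => 0)
    (fun c s a _ => by
      have := M.R_prob c s a
      simp)
    (fun p N => by
      set e := (∑ c, M.D c * ∑ h ∈ range H, ∑ s, occ M.P M.lay.s0 (p c) h s *
          u N s (p c s)) / (2 * H) with he
      calc _ ≤ ∑ c, M.D c * (Real.exp e * (1 - (∑ h ∈ range H, ∑ s,
              occ M.P M.lay.s0 (p c) h s * u N s (p c s)) / (2 * H))) := by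
            refine Finset.sum_le_sum fun c _ => mul_le_mul_of_nonneg_left ?_ (M.D_nonneg c)
            have := sum_pathW_mul_exp_le (M := M) (p c)
              (u := fun s => u N s (p c s)) (fun s _ => hu _ _ _) hH0 le_rfl
            have h2 := mul_le_mul_of_nonneg_left this (Real.exp_pos e).le
            refine le_trans (le_of_eq ?_) h2
            rw [Finset.mul_sum]
            refine Finset.sum_congr rfl fun x _ => ?_
            rw [Finset.sum_const_zero, add_zero, Real.exp_add]
            ring
        _ = Real.exp e * (1 - e) := by
            simp only [mul_left_comm _ (Real.exp e), ← Finset.mul_sum, M.sum_D_mul_one_sub]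
            rw [he]
        _ ≤ Real.exp e * Real.exp (-e) := by
            gcongr
            linarith [Real.add_one_le_exp (-e)]
        _ = 1 := by rw [← Real.exp_add, add_neg_cancel, Real.exp_zero])
    ht hε
  refine le_trans (measure_mono fun ω hω => ?_) key
  change Real.log (1 / ε) ≤ _ at hω
  change Real.log (1 / ε) ≤ _
  refine hω.trans (le_of_eq ?_)
  simp only [Finset.sum_const_zero, add_zero]
  rw [Finset.sum_add_distrib, ← Finset.sum_div, sub_eq_add_neg]
  congr 1
  simp only [Finset.sum_neg_distrib, Finset.sum_div, neg_div, Finset.sum_range]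
  rfl

/-- Sums over the observed contexts are controlled by their expectations. -/
lemma measure_contexts_le (hI : IsInteraction M T μ 𝓕 σ pol) (hH : 0 < H)
    {v : (C → S → A) → C → ℝ} (hv : ∀ p c, v p c ∈ Set.Icc (0 : ℝ) H)
    {t : ℕ} (ht : t ≤ T + 1) {ε : ℝ} (hε : 0 < ε) :
    μ {ω | Real.log (1 / ε) ≤ (∑ i ∈ Ico 1 t, v (pol i ω) (σ i ω).ctx) / H
        - 2 * (∑ i ∈ Ico 1 t, ∑ c, M.D c * v (pol i ω) c) / H}
      ≤ ENNReal.ofReal ε := by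
  have hH0 : (0 : ℝ) < H := by exact_mod_cast hH
  have key := measure_log_le_sum_round_le hI
    -- The multiplicative upper tail: the factor 2 is the slope in `exp_le_one_add_two_mul`.
    (fun p _ c _ => v p c / H + -(2 * (∑ c, M.D c * v p c) / H))
    (fun _ _ _ _ => 0) (fun _ _ _ => measurable_const) (fun _ _ _ => 0)
    (fun c s a _ => by
      have := M.R_prob c s a
      simp)
    (fun p N => by
      set e := 2 * (∑ c, M.D c * v p c) / H with he
      calc _ = ∑ c, M.D c * (Real.exp (v p c / H) * Real.exp (-e)) := by
            refine Finset.sum_congr rfl fun c _ => ?_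
            simp only [Finset.sum_const_zero, add_zero]
            rw [← Finset.sum_mul, sum_pathW M.isDynamics _ le_rfl, one_mul, Real.exp_add]
        _ ≤ ∑ c, M.D c * ((1 + 2 * (v p c / H)) * Real.exp (-e)) := by
            refine Finset.sum_le_sum fun c _ => mul_le_mul_of_nonneg_left ?_ (M.D_nonneg c)
            gcongr
            exact exp_le_one_add_two_mul (div_nonneg (hv p c).1 hH0.le)
              ((div_le_one hH0).2 (hv p c).2)
        _ = (1 + e) * Real.exp (-e) := by
            have : ∀ c, M.D c * ((1 + 2 * (v p c / H)) * Real.exp (-e))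
                = (M.D c * (1 - (-2 * v p c) / H)) * Real.exp (-e) := fun c => by ring
            simp only [this]
            rw [← Finset.sum_mul, M.sum_D_mul_one_sub, he]
            congr 1
            simp only [mul_left_comm _ (-2 : ℝ), ← Finset.mul_sum]
            ring
        _ ≤ Real.exp e * Real.exp (-e) := by
            gcongr
            linarith [Real.add_one_le_exp e]
        _ = 1 := by rw [← Real.exp_add, add_neg_cancel, Real.exp_zero])
    ht hε
  refine le_trans (measure_mono fun ω hω => ?_) key
  change Real.log (1 / ε) ≤ _ at hω
  change Real.log (1 / ε) ≤ _
  refine hω.trans (le_of_eq ?_)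
  simp only [Finset.sum_const_zero, add_zero]
  rw [Finset.sum_add_distrib, ← Finset.sum_div, sub_eq_add_neg]
  congr 1
  rw [Finset.sum_neg_distrib, ← Finset.sum_div, ← Finset.mul_sum]

open scoped Classical in
/-- Concentration of the transitions observed after the visits of one state-action pair, tested
against a function `v`. -/
lemma measure_transitions_le (hI : IsInteraction M T μ 𝓕 σ pol)
    {s : S} (hs : M.lay.layer s < H) (a : A) {v : S → ℝ} (hv : ∀ s', v s' ∈ Set.Icc (-1 : ℝ) 1)
    (l : ℝ) {t : ℕ} (ht : t ≤ T + 1) {ε : ℝ} (hε : 0 < ε) :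
    μ {ω | Real.log (1 / ε) ≤ ∑ i ∈ Ico 1 t,
        if (σ i ω).st (M.lay.layer s) = s ∧ pol i ω (σ i ω).ctx s = a then
          l * (v ((σ i ω).st (M.lay.layer s + 1)) - ∑ s', M.P s a s' * v s') - l ^ 2 / 2 else 0}
      ≤ ENNReal.ofReal ε := by
  set h₀ : Fin H := ⟨M.lay.layer s, hs⟩ with hh₀
  have key := measure_log_le_sum_round_le hI
    (fun p _ c x => if x h₀.castSucc = s ∧ p c s = a then
      l * (v (x h₀.succ) - ∑ s', M.P s a s' * v s') - l ^ 2 / 2 else 0)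
    (fun _ _ _ _ => 0) (fun _ _ _ => measurable_const) (fun _ _ _ => 0)
    (fun c s a _ => by
      have := M.R_prob c s a
      simp)
    (fun p N => by
      simp only [Finset.sum_const_zero, add_zero]
      rw [← M.D_sum]
      refine Finset.sum_le_sum fun c _ => mul_le_of_le_one_right (M.D_nonneg c) ?_
      rw [sum_pathW_mul_pair M.isDynamics (p c) H le_rfl h₀ (fun z z' => Real.exp
        (if z = s ∧ p c s = a then l * (v z' - ∑ s', M.P s a s' * v s') - l ^ 2 / 2 else 0)),
        ← occ_sum M.isDynamics (p c) h₀ h₀.2.le]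
      refine Finset.sum_le_sum fun z _ => ?_
      by_cases hz : M.lay.layer z = h₀
      swap
      · rw [occ_eq_zero M.isDynamics (p c) h₀ h₀.2.le z hz, zero_mul]
      have hzH : M.lay.layer z < H := by rw [hz]; exact h₀.2
      refine mul_le_of_le_one_right (occ_nonneg M.isDynamics (p c) h₀ h₀.2.le z) ?_
      by_cases hza : z = s ∧ p c s = a
      -- For values in `[-1,1]` Hoeffding gives exp(l²/2), which the subtracted `l ^ 2 / 2` cancels
      -- exactly.
      · simp only [hza, and_self, if_true]
        have hoef := sum_mul_exp_le (fun s' => M.isDynamics.nonneg s a s' hs)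
          (M.isDynamics.sum_eq_one s a hs) hv l
        simp only [sub_eq_add_neg _ (l ^ 2 / 2), Real.exp_add, ← mul_assoc, ← Finset.sum_mul]
        refine (mul_le_mul_of_nonneg_right hoef (Real.exp_pos _).le).trans (le_of_eq ?_)
        rw [← Real.exp_add, Real.exp_eq_one_iff]
        ring
      · simp only [hza, if_false, Real.exp_zero, mul_one]
        exact (M.isDynamics.sum_eq_one _ _ hzH).le)
    ht hε
  refine le_trans (measure_mono fun ω hω => ?_) key
  change Real.log (1 / ε) ≤ _ at hω
  change Real.log (1 / ε) ≤ _
  refine hω.trans (le_of_eq ?_)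
  simp only [Finset.sum_const_zero, add_zero]
  rfl

end Events

/-! ### Empirical dynamics on a sample path. -/

section Consistent

variable {C S A : Type*} [Fintype C] [Fintype S] [Fintype A] {H T : ℕ}

/-- The properties that every sample path has almost surely: step `h` is in layer `h`, and the
actions are those of the policies. -/
def IsConsistent (L : Layering S H) (T : ℕ) (σ : ℕ → Episode C S A) (pol : ℕ → C → S → A) : Prop :=
  ∀ i ∈ Icc 1 T, (∀ h ≤ H, L.layer ((σ i).st h) = h) ∧
    ∀ h < H, (σ i).act h = pol i (σ i).ctx ((σ i).st h)

variable {L : Layering S H} {σ : ℕ → Episode C S A} {pol : ℕ → C → S → A}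

/-- A state can be visited only at the step given by its layer, so the search over `h` collapses to
one step. -/
lemma IsConsistent.visited_iff (hc : IsConsistent L T σ pol) {i : ℕ} (hi : i ∈ Icc 1 T) {s : S}
    (hs : L.layer s < H) (a : A) (Q : ℕ → Prop) :
    (∃ h < H, (σ i).st h = s ∧ (σ i).act h = a ∧ Q h)
      ↔ ((σ i).st (L.layer s) = s ∧ pol i (σ i).ctx s = a) ∧ Q (L.layer s) := by
  obtain ⟨h1, h2⟩ := hc i hi
  constructor
  · rintro ⟨h, hh, rfl, rfl, hq⟩
    rw [h1 h hh.le]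
    exact ⟨⟨rfl, (h2 h hh).symm⟩, hq⟩
  · rintro ⟨⟨e1, e2⟩, hq⟩
    exact ⟨L.layer s, hs, e1, by rw [h2 _ hs, e1, e2], hq⟩

open scoped Classical in
lemma IsConsistent.visits_eq (hc : IsConsistent L T σ pol) {t : ℕ} (ht : t ≤ T + 1) {s : S}
    (hs : L.layer s < H) (a : A) :
    (visits H σ t s a : ℝ) = ∑ i ∈ Ico 1 t,
      if (σ i).st (L.layer s) = s ∧ pol i (σ i).ctx s = a then 1 else 0 := by
  rw [visits, Finset.card_filter, Nat.cast_sum]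
  refine Finset.sum_congr rfl fun i hi => ?_
  have := hc.visited_iff (i := i) (by simp at hi ⊢; omega) hs a fun _ => True
  simp only [and_true] at this
  simp only [this]
  split_ifs <;> simp

open scoped Classical in
lemma IsConsistent.sum_visitsNext (hc : IsConsistent L T σ pol) {t : ℕ} (ht : t ≤ T + 1) {s : S}
    (hs : L.layer s < H) (a : A) (v : S → ℝ) :
    ∑ s', v s' * (visitsNext H σ t s a s' : ℝ) = ∑ i ∈ Ico 1 t,
      if (σ i).st (L.layer s) = s ∧ pol i (σ i).ctx s = a then
        v ((σ i).st (L.layer s + 1)) else 0 := by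
  have : ∀ s', v s' * (visitsNext H σ t s a s' : ℝ) = ∑ i ∈ Ico 1 t,
      if (σ i).st (L.layer s) = s ∧ pol i (σ i).ctx s = a then
        (if (σ i).st (L.layer s + 1) = s' then v s' else 0) else 0 := by
    intro s'
    rw [visitsNext, Finset.card_filter, Nat.cast_sum, Finset.mul_sum]
    refine Finset.sum_congr rfl fun i hi => ?_
    have := hc.visited_iff (i := i) (by simp at hi ⊢; omega) hs a fun h => (σ i).st (h + 1) = s'
    simp only [this]
    split_ifs <;> simp_all
  simp only [this]
  rw [Finset.sum_comm]
  refine Finset.sum_congr rfl fun i _ => ?_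
  split_ifs <;> simp

/-- The sign `±1` encoded by a Boolean. -/
def signOf (b : Bool) : ℝ := if b then 1 else -1

lemma signOf_mem (b : Bool) : signOf b ∈ Set.Icc (-1 : ℝ) 1 := by
  cases b <;> simp [signOf]

lemma exists_signOf_mul_eq_abs (z : ℝ) : ∃ b, signOf b * z = |z| := by
  rcases le_total 0 z with h | h
  · exact ⟨true, by simp [signOf, abs_of_nonneg h]⟩
  · exact ⟨false, by simp [signOf, abs_of_nonpos h]⟩

open scoped Classical in
-- An ℓ¹ norm is a maximum over sign vectors. For the maximizing signs, with n visits and D the ℓ¹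
-- norm of the unnormalized deviation, the tested sum is kD - k²n/2. Since n is random, the test is
-- assumed for the optimal slope of every possible n.
lemma IsConsistent.dist_empP_le (hc : IsConsistent L T σ pol) {P : S → A → S → ℝ}
    (hP : L.IsDynamics P) {t : ℕ} (ht : t ∈ Icc 1 T) {s : S} (hs : L.layer s < H) (a : A) {l : ℝ}
    (hl : 0 < l)
    (htest : ∀ n ∈ Icc 1 T, ∀ b : S → Bool, ∑ i ∈ Ico 1 t,
      (if (σ i).st (L.layer s) = s ∧ pol i (σ i).ctx s = a then
        Real.sqrt (2 * l / n) * (signOf (b ((σ i).st (L.layer s + 1)))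
          - ∑ s', P s a s' * signOf (b s')) - Real.sqrt (2 * l / n) ^ 2 / 2 else 0) < l)
    {Λ : ℝ} (hΛ : 2 * l ≤ Λ) (hΛ1 : 1 ≤ Λ) :
    ∑ s', |empP H σ t s a s' - P s a s'| ≤ Real.sqrt (Λ / max 1 (visits H σ t s a : ℝ)) := by
  simp only [Finset.mem_Icc] at ht
  -- At an unvisited pair the empirical row is zero, not a distribution; its distance to `P` is
  -- exactly 1.
  rcases Nat.eq_zero_or_pos (visits H σ t s a) with h0 | hpos
  · have hn0 : ∀ s', visitsNext H σ t s a s' = 0 := by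
      intro s'
      refine Nat.le_zero.1 (le_trans ?_ h0.le)
      refine Finset.card_le_card fun i hi => ?_
      simp only [Finset.mem_filter] at hi ⊢
      obtain ⟨h1, h, h2, h3, h4, -⟩ := hi
      exact ⟨h1, h, h2, h3, h4⟩
    simp only [empP, hn0, h0, Nat.cast_zero, zero_div, zero_sub, abs_neg]
    rw [Finset.sum_congr rfl fun s' _ => abs_of_nonneg (hP.nonneg s a s' hs),
      hP.sum_eq_one s a hs, max_eq_left zero_le_one, div_one]
    exact Real.one_le_sqrt.2 hΛ1
  have hle : visits H σ t s a ≤ T := by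
    refine (Finset.card_filter_le _ _).trans ?_
    simp; omega
  set n := visits H σ t s a with hn
  have hn1 : (1 : ℝ) ≤ n := by exact_mod_cast hpos
  have hn0 : (0 : ℝ) < n := by linarith
  choose b hb using fun s' =>
    exists_signOf_mul_eq_abs ((visitsNext H σ t s a s' : ℝ) - n * P s a s')
  have key := htest n (by simp; omega) b
  -- With this slope the penalty k²n/2 equals `l`, so the test reads kD < 2l = k · kn.
  set k := Real.sqrt (2 * l / n) with hk
  have hk2 : k ^ 2 = 2 * l / n := Real.sq_sqrt (by positivity)
  have hk0 : 0 < k := Real.sqrt_pos.2 (by positivity)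
  have hsum : ∑ i ∈ Ico 1 t, (if (σ i).st (L.layer s) = s ∧ pol i (σ i).ctx s = a then
        k * (signOf (b ((σ i).st (L.layer s + 1)))
          - ∑ s', P s a s' * signOf (b s')) - k ^ 2 / 2 else 0)
      = k * ∑ s', |(visitsNext H σ t s a s' : ℝ) - n * P s a s'| - l := by
    have e1 : ∑ s', |(visitsNext H σ t s a s' : ℝ) - n * P s a s'|
        = ∑ s', signOf (b s') * (visitsNext H σ t s a s' : ℝ)
          - n * ∑ s', P s a s' * signOf (b s') := by
      rw [Finset.mul_sum, ← Finset.sum_sub_distrib]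
      refine Finset.sum_congr rfl fun s' _ => ?_
      rw [← hb s']; ring
    have e2 := hc.sum_visitsNext (t := t) (by omega) hs a fun s' => signOf (b s')
    have e3 := hc.visits_eq (t := t) (by omega) hs a
    have e4 : l = k ^ 2 / 2 * n := by rw [hk2]; field_simp
    rw [e1, e2, e4, ← hn] at *
    rw [e3]
    set q := ∑ s', P s a s' * signOf (b s')
    rw [mul_sub, Finset.mul_sum, Finset.sum_mul, Finset.mul_sum, Finset.mul_sum,
      ← Finset.sum_sub_distrib, ← Finset.sum_sub_distrib]
    refine Finset.sum_congr rfl fun i _ => ?_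
    split_ifs <;> ring
  rw [hsum] at key
  have hD : ∑ s', |(visitsNext H σ t s a s' : ℝ) - n * P s a s'| ≤ k * n := by
    have h2 : 2 * l = k * (k * n) := by
      rw [← mul_assoc, ← pow_two, hk2]; field_simp
    exact le_of_mul_le_mul_left (by linarith) hk0
  rw [max_eq_right hn1]
  calc _ = (∑ s', |(visitsNext H σ t s a s' : ℝ) - n * P s a s'|) / n := by
        rw [Finset.sum_div]
        refine Finset.sum_congr rfl fun s' _ => ?_
        rw [empP, ← hn, max_eq_right hn1]
        have : (visitsNext H σ t s a s' : ℝ) / n - P s a s'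
            = ((visitsNext H σ t s a s' : ℝ) - n * P s a s') / n := by field_simp
        rw [this, abs_div, abs_of_pos hn0]
    _ ≤ k := by rw [div_le_iff₀ hn0]; exact hD
    _ ≤ _ := Real.sqrt_le_sqrt (by gcongr)

end Consistent

/-! ### Union bounds for the confidence set and the regression. -/

section GoodEvent

open scoped ENNReal

variable {C S A Ω : Type*} [Fintype C] [Fintype S] [Fintype A] {H T : ℕ}
  {mΩ : MeasurableSpace Ω} {μ : Measure Ω} [IsProbabilityMeasure μ] {M : CMDP C S A H}
  {𝓕 : Filtration ℕ mΩ} {σ : ℕ → Ω → Episode C S A} {pol : ℕ → Ω → C → S → A}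

lemma ae_isConsistent (hI : IsInteraction M T μ 𝓕 σ pol) :
    ∀ᵐ ω ∂μ, IsConsistent M.lay T (fun t => σ t ω) (fun t => pol t ω) := by
  refine (ae_ball_iff (Set.to_countable _)).2 fun i hi => ?_
  have h2 : ∀ᵐ ω ∂μ, ∀ h < H, (σ i ω).act h = pol i ω (σ i ω).ctx ((σ i ω).st h) :=
    (ae_ball_iff (Set.to_countable {h | h < H})).2 fun h hh => hI.act_eq i hi h hh
  filter_upwards [ae_layer hI hi, h2] with ω h1 h2
  exact ⟨h1, h2⟩

/-- The empirical dynamics are within the confidence radius with high probability. -/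
lemma measure_not_confidence_le [Nonempty A] (hI : IsInteraction M T μ 𝓕 σ pol) (hT : 1 ≤ T)
    {δ : ℝ} (hδ : 0 < δ) (hδ1 : δ < 1) :
    μ {ω | ¬ ∀ t ∈ Icc 1 T, ∀ s a, M.lay.layer s < H →
        ∑ s', |empP H (fun j => σ j ω) t s a s' - M.P s a s'| ≤ xi H T δ (fun j => σ j ω) t s a}
      ≤ ENNReal.ofReal (δ / 4) := by
  classical
  have : Nonempty S := ⟨M.lay.s0⟩
  have hS : (1 : ℝ) ≤ Fintype.card S := by exact_mod_cast Fintype.card_pos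
  have hA : (1 : ℝ) ≤ Fintype.card A := by exact_mod_cast Fintype.card_pos
  have hT1 : (1 : ℝ) ≤ T := by exact_mod_cast hT
  set X : ℝ := 4 * Fintype.card S * Fintype.card A * (T : ℝ) ^ 2 / δ with hX
  have hX1 : 1 < X := by
    rw [hX, lt_div_iff₀ hδ]
    have : 1 ≤ (Fintype.card S : ℝ) * Fintype.card A * (T : ℝ) ^ 2 :=
      one_le_mul_of_one_le_of_one_le (one_le_mul_of_one_le_of_one_le hS hA) (one_le_pow₀ hT1)
    nlinarith
  set ε : ℝ := 1 / (X * 2 ^ Fintype.card S) with hε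
  have hε0 : 0 < ε := by positivity
  set l : ℝ := Real.log (1 / ε) with hl
  have hl' : l = Real.log X + Fintype.card S * Real.log 2 := by
    rw [hl, hε, one_div_one_div, Real.log_mul (by positivity) (by positivity), Real.log_pow]
  have hlX : 0 < Real.log X := Real.log_pos hX1
  have hlog2 : 0 < Real.log 2 := Real.log_pos (by norm_num)
  have hlog2' : Real.log 2 < 1 := by linarith [Real.log_two_lt_d9]
  have hl0 : 0 < l := by rw [hl']; positivity
  -- Rounds and visit counts run over `1, …, T`, encoded in `Fin T` with a shift by one. A visit
  -- count of zero needs no test.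
  let ι := Fin T × Fin T × (S × A) × (S → Bool)
  let bad : ι → Set Ω := fun j => {ω | M.lay.layer j.2.2.1.1 < H ∧ l ≤ ∑ i ∈ Ico 1 (j.1 + 1 : ℕ),
    (if (σ i ω).st (M.lay.layer j.2.2.1.1) = j.2.2.1.1 ∧ pol i ω (σ i ω).ctx j.2.2.1.1 = j.2.2.1.2
      then Real.sqrt (2 * l / (j.2.1 + 1 : ℕ)) * (signOf (j.2.2.2 ((σ i ω).st
          (M.lay.layer j.2.2.1.1 + 1))) - ∑ s', M.P j.2.2.1.1 j.2.2.1.2 s' * signOf (j.2.2.2 s'))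
        - Real.sqrt (2 * l / (j.2.1 + 1 : ℕ)) ^ 2 / 2 else 0)}
  have hbad : ∀ j, μ (bad j) ≤ ENNReal.ofReal ε := by
    rintro ⟨t, n, ⟨s, a⟩, b⟩
    by_cases hs : M.lay.layer s < H
    · refine (measure_mono fun ω hω => hω.2).trans
        (measure_transitions_le hI hs a (v := fun s' => signOf (b s')) (fun s' => signOf_mem _)
          (Real.sqrt (2 * l / (n + 1 : ℕ))) (t := t + 1) (by omega) hε0)
    · have : bad (t, n, ⟨s, a⟩, b) = ∅ := Set.eq_empty_of_forall_notMem fun ω hω => hs hω.1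
      rw [this]; simp
  have hunion : μ (⋃ j, bad j) ≤ ENNReal.ofReal (δ / 4) := by
    refine (measure_iUnion_fintype_le _ _).trans ?_
    refine (Finset.sum_le_sum fun j _ => hbad j).trans (le_of_eq ?_)
    rw [Finset.sum_const, nsmul_eq_mul, ← ENNReal.ofReal_natCast,
      ← ENNReal.ofReal_mul (Nat.cast_nonneg _)]
    congr 1
    simp only [ι, Finset.card_univ, Fintype.card_prod, Fintype.card_fin, Fintype.card_pi,
      Fintype.card_bool, Finset.prod_const]
    push_cast
    rw [hε, hX]
    field_simp
  refine le_trans (measure_mono_ae ?_) hunion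
  filter_upwards [ae_isConsistent hI] with ω hω hnot
  change ¬ _ at hnot
  change ω ∈ ⋃ j, bad j
  by_contra hgood
  apply hnot
  intro t ht s a hs
  -- The factor 2 of `xi` enters the root as 4, which leaves ample room above 2l = 2 log X + 2|S|
  -- log 2.
  have hxi : xi H T δ (fun j => σ j ω) t s a = Real.sqrt ((4 * (Fintype.card S + 2 * Real.log X))
      / max 1 (visits H (fun j => σ j ω) t s a : ℝ)) := by
    rw [xi, ← hX, mul_div_assoc, Real.sqrt_mul (by norm_num), show (4 : ℝ) = 2 ^ 2 by norm_num,
      Real.sqrt_sq (by norm_num)]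
  rw [hxi]
  refine hω.dist_empP_le M.isDynamics ht hs a hl0 ?_ ?_ ?_
  · intro n hn b
    simp only [Finset.mem_Icc] at ht hn
    by_contra hcon
    apply hgood
    refine Set.mem_iUnion.2 ⟨(⟨t - 1, by omega⟩, ⟨n - 1, by omega⟩, (s, a), b), hs, ?_⟩
    simp only [Nat.sub_add_cancel ht.1, Nat.sub_add_cancel hn.1]
    exact not_lt.1 hcon
  · rw [hl']; nlinarith
  · nlinarith

/-- The partial sums are compared with the telescoping 2 - 2/(T+1). This pays for the union over
rounds, with failure probability δ/(8t³) in round t. -/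
lemma sum_one_div_cube_le (T : ℕ) : ∑ t ∈ Icc 1 T, 1 / (t : ℝ) ^ 3 ≤ 2 := by
  have : ∑ t ∈ Icc 1 T, 1 / (t : ℝ) ^ 3 ≤ 2 - 2 / ((T : ℝ) + 1) := by
    induction T with
    | zero => simp
    | succ n ih =>
      rw [Finset.sum_Icc_succ_top (by omega)]
      push_cast
      have hn : (0 : ℝ) ≤ n := Nat.cast_nonneg n
      have : 1 / ((n : ℝ) + 1) ^ 3 ≤ 2 / ((n : ℝ) + 1) - 2 / ((n : ℝ) + 1 + 1) := by
        rw [div_sub_div _ _ (by positivity) (by positivity), div_le_div_iff₀ (by positivity)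
          (by positivity)]
        nlinarith [mul_nonneg hn hn, mul_nonneg (mul_nonneg hn hn) hn]
      linarith
  have h2 : (0 : ℝ) ≤ 2 / ((T : ℝ) + 1) := by positivity
  linarith

/-- All regression errors are small with high probability. -/
lemma measure_not_regression_le (hI : IsInteraction M T μ 𝓕 σ pol) (hH : 0 < H)
    {F : Finset (C → S → A → ℝ)} (hF : ∀ f ∈ F, ∀ c s a, f c s a ∈ Set.Icc (0 : ℝ) 1)
    {f₀ : C → S → A → ℝ} (hf₀F : f₀ ∈ F)
    (hf₀ : ∀ c s a, M.lay.layer s < H → f₀ c s a = M.r c s a) {δ : ℝ} (hδ : 0 < δ) :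
    μ {ω | ¬ ∀ t ∈ Icc 1 T, ∀ f ∈ F,
        (∑ i ∈ Ico 1 t, ∑ c, M.D c * M.sqErr f (pol i ω) c) / (4 * H)
        - (sqLoss H (fun j => σ j ω) t f - sqLoss H (fun j => σ j ω) t f₀) / H
        < Real.log (8 * #F * (t : ℝ) ^ 3 / δ)}
      ≤ ENNReal.ofReal (δ / 4) := by
  have hF0 : (0 : ℝ) < #F := by exact_mod_cast Finset.card_pos.2 ⟨f₀, hf₀F⟩
  let bad : ℕ → (C → S → A → ℝ) → Set Ω := fun t f =>
    {ω | Real.log (1 / (δ / (8 * #F * (t : ℝ) ^ 3))) ≤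
      (∑ i ∈ Ico 1 t, ∑ c, M.D c * M.sqErr f (pol i ω) c) / (4 * H)
        - (sqLoss H (fun j => σ j ω) t f - sqLoss H (fun j => σ j ω) t f₀) / H}
  have hsub : {ω | ¬ ∀ t ∈ Icc 1 T, ∀ f ∈ F,
        (∑ i ∈ Ico 1 t, ∑ c, M.D c * M.sqErr f (pol i ω) c) / (4 * H)
        - (sqLoss H (fun j => σ j ω) t f - sqLoss H (fun j => σ j ω) t f₀) / H
        < Real.log (8 * #F * (t : ℝ) ^ 3 / δ)} ⊆ ⋃ t ∈ Icc 1 T, ⋃ f ∈ F, bad t f := by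
    intro ω hω
    change ¬ _ at hω
    push Not at hω
    obtain ⟨t, ht, f, hf, h⟩ := hω
    simp only [Set.mem_iUnion]
    refine ⟨t, ht, f, hf, ?_⟩
    change Real.log (1 / (δ / (8 * #F * (t : ℝ) ^ 3))) ≤ _
    rwa [one_div_div]
  refine (measure_mono hsub).trans ?_
  have hb : ∀ t ∈ Icc 1 T, μ (⋃ f ∈ F, bad t f) ≤ ENNReal.ofReal (δ / 8 * (1 / (t : ℝ) ^ 3)) := by
    intro t ht
    simp only [Finset.mem_Icc] at ht
    have ht0 : (0 : ℝ) < t := by exact_mod_cast (by omega : 0 < t)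
    refine (measure_biUnion_finset_le _ _).trans ?_
    refine (Finset.sum_le_sum fun f hf => measure_regression_le hI hH (hF f hf) hf₀ (by omega)
      (by positivity : 0 < δ / (8 * #F * (t : ℝ) ^ 3))).trans (le_of_eq ?_)
    rw [Finset.sum_const, nsmul_eq_mul, ← ENNReal.ofReal_natCast,
      ← ENNReal.ofReal_mul (Nat.cast_nonneg _)]
    congr 1
    field_simp
  refine (measure_biUnion_finset_le _ _).trans ((Finset.sum_le_sum hb).trans ?_)
  rw [← ENNReal.ofReal_sum_of_nonneg fun t _ => by positivity, ← Finset.mul_sum]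
  refine ENNReal.ofReal_le_ofReal ?_
  nlinarith [sum_one_div_cube_le T]

end GoodEvent

/-! ### Deterministic sums of inverse counts. -/

section Sums

lemma sum_one_div_sqrt_le (a T : ℕ) :
    ∑ t ∈ Ico (a + 1) (T + 1), 1 / Real.sqrt t ≤ 2 * Real.sqrt T := by
  have h : ∑ t ∈ Ico 1 (T + 1), 1 / Real.sqrt t ≤ 2 * Real.sqrt T := by
    induction T with
    | zero => simp
    | succ n ih =>
      rw [Finset.sum_Ico_succ_top (by omega)]
      have h0 : (0 : ℝ) ≤ n := Nat.cast_nonneg n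
      have hpos : 0 < Real.sqrt ((n + 1 : ℕ) : ℝ) := Real.sqrt_pos.2 (by positivity)
      have hle : Real.sqrt n ≤ Real.sqrt ((n + 1 : ℕ) : ℝ) := Real.sqrt_le_sqrt (by push_cast; linarith)
      have e1 := Real.sq_sqrt h0
      have e2 := Real.sq_sqrt (by positivity : (0 : ℝ) ≤ ((n + 1 : ℕ) : ℝ))
      have : 1 / Real.sqrt ((n + 1 : ℕ) : ℝ)
          ≤ 2 * Real.sqrt ((n + 1 : ℕ) : ℝ) - 2 * Real.sqrt n := by
        rw [div_le_iff₀ hpos]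
        push_cast at *
        nlinarith [sq_nonneg (Real.sqrt ((n : ℝ) + 1) - Real.sqrt n)]
      linarith
  refine le_trans (Finset.sum_le_sum_of_subset_of_nonneg ?_ fun _ _ _ => by positivity) h
  exact Finset.Ico_subset_Ico_left (by omega)

/-- The radius uses the count before the visit, so √n rather than √(n+1) stands in the denominator.
The constant 3 absorbs this and the first visit: for n ≥ 1 the left side squared is 9n + 6 + 1/n ≤
9(n + 1). -/
lemma three_mul_sqrt_add_le (n : ℕ) :
    3 * Real.sqrt n + 1 / Real.sqrt (max 1 (n : ℝ)) ≤ 3 * Real.sqrt ((n : ℝ) + 1) := by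
  rcases Nat.eq_zero_or_pos n with h0 | hpos
  · subst h0; norm_num
  · have hn : (1 : ℝ) ≤ n := by exact_mod_cast hpos
    rw [max_eq_right hn]
    have h1 : 1 ≤ Real.sqrt n := Real.one_le_sqrt.2 hn
    have e1 := Real.sq_sqrt (by linarith : (0 : ℝ) ≤ n)
    have hx : 0 ≤ 3 * Real.sqrt n + 1 / Real.sqrt n := by positivity
    rw [← Real.sqrt_sq hx, show (3 : ℝ) * Real.sqrt (n + 1) = Real.sqrt (9 * (n + 1)) by
      rw [Real.sqrt_mul (by norm_num), show (9 : ℝ) = 3 ^ 2 by norm_num,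
        Real.sqrt_sq (by norm_num)]]
    refine Real.sqrt_le_sqrt ?_
    have e2 : (3 * Real.sqrt n + 1 / Real.sqrt n) ^ 2 = 9 * n + 6 + 1 / n := by
      have : Real.sqrt n ≠ 0 := by positivity
      calc _ = 9 * Real.sqrt n ^ 2 + 6 + 1 / Real.sqrt n ^ 2 := by field_simp; ring
        _ = _ := by rw [e1]
    rw [e2]
    have : 1 / (n : ℝ) ≤ 1 := by rw [div_le_one (by linarith)]; exact hn
    linarith

/-- The logarithmic increment is at least 1/(n+1) ≥ 1/(2n); the factor 2 compensates for counting
before the update. -/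
lemma one_div_le_two_mul_log {n : ℝ} (hn : 1 ≤ n) :
    1 / n ≤ 2 * (Real.log (n + 1) - Real.log n) := by
  rw [← Real.log_div (by linarith) (by linarith)]
  have h := Real.one_sub_inv_le_log_of_pos (by positivity : 0 < (n + 1) / n)
  have : 1 / n ≤ 2 * (1 - ((n + 1) / n)⁻¹) := by
    rw [inv_div, one_sub_div (by linarith), add_sub_cancel_left, mul_one_div,
      div_le_div_iff₀ (by linarith) (by linarith)]
    linarith
  linarith

open scoped Classical in
/-- The number of indices `1 ≤ i < t` with `x i = a`, as a real number. -/
def countBefore {A : Type*} (x : ℕ → A) (t : ℕ) (a : A) : ℝ :=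
  ∑ i ∈ Ico 1 t, if a = x i then (1 : ℝ) else 0

variable {A : Type*} [Fintype A]

open scoped Classical in
lemma countBefore_succ (x : ℕ → A) {t : ℕ} (ht : 1 ≤ t) (a : A) :
    countBefore x (t + 1) a = countBefore x t a + if a = x t then (1 : ℝ) else 0 := by
  rw [countBefore, Finset.sum_Ico_succ_top ht, countBefore]

lemma one_le_countBefore {x : ℕ → A} {t i : ℕ} (hi : i ∈ Ico 1 t) : 1 ≤ countBefore x t (x i) := by
  classical
  have := Finset.single_le_sum (f := fun j => if x i = x j then (1 : ℝ) else 0)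
    (fun j _ => by split_ifs <;> norm_num) hi
  simpa [countBefore] using this

lemma sum_countBefore (x : ℕ → A) {t : ℕ} (ht : 1 ≤ t) :
    ∑ a, countBefore x t a = (t : ℝ) - 1 := by
  classical
  unfold countBefore
  rw [Finset.sum_comm]
  simp [Nat.cast_sub ht]

/-- The sum of inverse counts, once every action has been played. -/
lemma sum_one_div_countBefore_le [Nonempty A] {x : ℕ → A}
    (hx : ∀ a, ∃ i ∈ Icc 1 (Fintype.card A), x i = a) {T : ℕ} (hT : Fintype.card A ≤ T) :
    ∑ t ∈ Ico (Fintype.card A + 1) (T + 1), 1 / countBefore x t (x t)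
      ≤ 2 * (Fintype.card A * Real.log (T / Fintype.card A)) := by
  classical
  have hA : 0 < Fintype.card A := Fintype.card_pos
  have hcount : ∀ t, Fintype.card A < t → ∀ a, 1 ≤ countBefore x t a := by
    intro t ht a
    obtain ⟨i, hi, rfl⟩ := hx a
    exact one_le_countBefore (by simp at hi ⊢; omega)
  have h1 : ∀ T, Fintype.card A ≤ T →
      ∑ t ∈ Ico (Fintype.card A + 1) (T + 1), 1 / countBefore x t (x t)
        ≤ 2 * ∑ a, Real.log (countBefore x (T + 1) a) := by
    intro T hT
    induction T, hT using Nat.le_induction with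
    | base =>
      rw [Finset.Ico_self, Finset.sum_empty]
      exact mul_nonneg (by norm_num) (Finset.sum_nonneg fun a _ =>
        Real.log_nonneg (hcount _ (by omega) a))
    | succ T hT ih =>
      rw [Finset.sum_Ico_succ_top (by omega)]
      refine (add_le_add_left ih _).trans ?_
      have h2 : ∑ a, (Real.log (countBefore x (T + 1 + 1) a) - Real.log (countBefore x (T + 1) a))
          = Real.log (countBefore x (T + 1) (x (T + 1)) + 1)
            - Real.log (countBefore x (T + 1) (x (T + 1))) := by
        rw [Finset.sum_eq_single_of_mem (x (T + 1)) (Finset.mem_univ _)]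
        · rw [countBefore_succ x (by omega), if_pos rfl]
        · intro a _ ha
          rw [countBefore_succ x (by omega), if_neg ha, add_zero, sub_self]
      have h3 := one_div_le_two_mul_log (hcount (T + 1) (by omega) (x (T + 1)))
      rw [← h2, Finset.sum_sub_distrib] at h3
      linarith
  refine (h1 T hT).trans (mul_le_mul_of_nonneg_left ?_ (by norm_num))
  have hA' : (0 : ℝ) < Fintype.card A := by exact_mod_cast hA
  have hT' : (0 : ℝ) < T := by exact_mod_cast (by omega : 0 < T)
  -- Concavity of the logarithm as a tangent bound at the mean count q = T/|A|. The counts sum to T,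
  -- so after summation the linear terms cancel and |A| log q remains.
  have h4 : ∀ a, Real.log (countBefore x (T + 1) a)
      ≤ countBefore x (T + 1) a / (T / Fintype.card A) - 1 + Real.log (T / Fintype.card A) := by
    intro a
    have hc := hcount (T + 1) (by omega) a
    have hq : (0 : ℝ) < T / Fintype.card A := by positivity
    have := Real.log_le_sub_one_of_pos (by positivity :
      0 < countBefore x (T + 1) a / (T / Fintype.card A))
    rw [Real.log_div (by linarith) hq.ne'] at this
    linarith
  refine (Finset.sum_le_sum fun a _ => h4 a).trans (le_of_eq ?_)
  rw [Finset.sum_add_distrib, Finset.sum_sub_distrib, ← Finset.sum_div,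
    sum_countBefore x (by omega)]
  simp only [Finset.sum_const, Finset.card_univ, nsmul_eq_mul]
  push_cast
  field_simp
  ring

end Sums

/-! ### Confidence radii summed along the observed trajectories. -/

section VisitSums

variable {C S A : Type*} [Fintype C] [Fintype S] [Fintype A] {H T : ℕ}
  {L : Layering S H} {σ : ℕ → Episode C S A} {pol : ℕ → C → S → A}

open scoped Classical in
-- Distinct steps are in distinct layers, so an episode meets each pair at most once and a sum over
-- steps is a sum over pairs.
lemma IsConsistent.sum_steps (hc : IsConsistent L T σ pol) {t : ℕ} (ht : t ∈ Icc 1 T)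
    (φ : S → A → ℝ) :
    ∑ h ∈ range H, φ ((σ t).st h) ((σ t).act h)
      = ∑ s, ∑ a, if ∃ h < H, (σ t).st h = s ∧ (σ t).act h = a then φ s a else 0 := by
  have hinj : Set.InjOn (fun h => ((σ t).st h, (σ t).act h)) (range H : Set ℕ) := by
    intro h hh h' hh' e
    simp only [Finset.coe_range, Set.mem_Iio] at hh hh'
    have := congrArg (fun q => L.layer q.1) e
    simp only at this
    rwa [(hc t ht).1 h hh.le, (hc t ht).1 h' hh'.le] at this
  rw [← Finset.sum_image (f := fun q : S × A => φ q.1 q.2) hinj, ← Fintype.sum_prod_type'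
    (f := fun s a => if ∃ h < H, (σ t).st h = s ∧ (σ t).act h = a then φ s a else 0),
    ← Finset.sum_filter]
  refine Finset.sum_congr ?_ fun _ _ => rfl
  ext ⟨s, a⟩
  simp

open scoped Classical in
lemma visits_succ {t : ℕ} (ht : 1 ≤ t) (s : S) (a : A) :
    visits H σ (t + 1) s a = visits H σ t s a +
      if ∃ h < H, (σ t).st h = s ∧ (σ t).act h = a then 1 else 0 := by
  simp only [visits, Finset.card_filter]
  rw [Finset.sum_Ico_succ_top ht]

open scoped Classical in
lemma sum_visited_div_sqrt_le (s : S) (a : A) (T : ℕ) :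
    ∑ t ∈ Ico 1 (T + 1), (if ∃ h < H, (σ t).st h = s ∧ (σ t).act h = a then
      1 / Real.sqrt (max 1 (visits H σ t s a : ℝ)) else 0)
      ≤ 3 * Real.sqrt (visits H σ (T + 1) s a) := by
  induction T with
  | zero => simp
  | succ T ih =>
    rw [Finset.sum_Ico_succ_top (by omega), visits_succ (t := T + 1) (by omega)]
    split_ifs with hv
    · refine (add_le_add_left ih _).trans ?_
      push_cast
      exact three_mul_sqrt_add_le _
    · simpa using ih

/-- The sum of the confidence radii along the observed trajectories. -/
lemma IsConsistent.sum_div_sqrt_visits_le (hc : IsConsistent L T σ pol) :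
    ∑ t ∈ Ico 1 (T + 1), ∑ h ∈ range H,
        1 / Real.sqrt (max 1 (visits H σ t ((σ t).st h) ((σ t).act h) : ℝ))
      ≤ 3 * Real.sqrt (Fintype.card S * Fintype.card A * (H * T)) := by
  classical
  have hmem : ∀ t ∈ Ico 1 (T + 1), t ∈ Icc 1 T := fun t ht => by simp at ht ⊢; omega
  have htotal : ∑ s, ∑ a, (visits H σ (T + 1) s a : ℝ) = H * T := by
    have : ∀ s a, (visits H σ (T + 1) s a : ℝ) = ∑ t ∈ Ico 1 (T + 1),
        if ∃ h < H, (σ t).st h = s ∧ (σ t).act h = a then (1 : ℝ) else 0 := by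
      intro s a
      rw [visits, Finset.card_filter]
      push_cast
      rfl
    simp only [this]
    calc _ = ∑ t ∈ Ico 1 (T + 1), ∑ s, ∑ a,
          (if ∃ h < H, (σ t).st h = s ∧ (σ t).act h = a then (1 : ℝ) else 0) := by
          rw [Finset.sum_congr rfl fun s _ => Finset.sum_comm]
          exact Finset.sum_comm
      _ = ∑ t ∈ Ico 1 (T + 1), (H : ℝ) := Finset.sum_congr rfl fun t ht => by
          rw [← hc.sum_steps (hmem t ht) fun _ _ => 1]; simp
      _ = H * T := by simp [mul_comm]
  calc _ = ∑ t ∈ Ico 1 (T + 1), ∑ s, ∑ a,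
        (if ∃ h < H, (σ t).st h = s ∧ (σ t).act h = a then
          1 / Real.sqrt (max 1 (visits H σ t s a : ℝ)) else 0) :=
        Finset.sum_congr rfl fun t ht => hc.sum_steps (hmem t ht)
          fun s a => 1 / Real.sqrt (max 1 (visits H σ t s a : ℝ))
    _ = ∑ s, ∑ a, ∑ t ∈ Ico 1 (T + 1),
        (if ∃ h < H, (σ t).st h = s ∧ (σ t).act h = a then
          1 / Real.sqrt (max 1 (visits H σ t s a : ℝ)) else 0) := by
        rw [Finset.sum_comm]
        exact Finset.sum_congr rfl fun s _ => Finset.sum_comm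
    _ ≤ ∑ s, ∑ a, 3 * Real.sqrt (visits H σ (T + 1) s a) :=
        Finset.sum_le_sum fun s _ => Finset.sum_le_sum fun a _ => sum_visited_div_sqrt_le s a T
    _ = 3 * ∑ q : S × A, Real.sqrt (visits H σ (T + 1) q.1 q.2) := by
        simp only [← Finset.mul_sum]
        rw [Fintype.sum_prod_type]
    _ ≤ 3 * Real.sqrt (Fintype.card S * Fintype.card A * (H * T)) := by
        refine mul_le_mul_of_nonneg_left (Real.le_sqrt_of_sq_le ?_) (by norm_num)
        -- Cauchy–Schwarz over the |S||A| pairs, whose visit counts total `H * T`.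
        refine (sq_sum_le_card_mul_sum_sq (s := (univ : Finset (S × A)))
          (f := fun q => Real.sqrt (visits H σ (T + 1) q.1 q.2))).trans (le_of_eq ?_)
        rw [Finset.card_univ, Fintype.card_prod]
        push_cast
        congr 1
        rw [← htotal, Fintype.sum_prod_type]
        exact Finset.sum_congr rfl fun s _ => Finset.sum_congr rfl fun a _ =>
          Real.sq_sqrt (Nat.cast_nonneg _)

end VisitSums

/-! ### The regret on a good sample path. -/

section Regret

variable {C S A : Type*} [Fintype C] [Fintype S] [Fintype A] {H T : ℕ} {M : CMDP C S A H}
  {σ : ℕ → Episode C S A} {pol : ℕ → C → S → A} {F : Finset (C → S → A → ℝ)} {δ pmin : ℝ}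
  {enum : Fin (Fintype.card A) ≃ A}

lemma CMDP.V_mem_Icc (M : CMDP C S A H) (c : C) (π : S → A) : M.V c π ∈ Set.Icc (0 : ℝ) H :=
  value_mem_Icc M.isDynamics (fun s a _ => M.r_mem_Icc c s a) π H M.lay.s0
    (by rw [M.lay.layer_s0, zero_add])

/-- Every layer carries occupancy mass one, hence is nonempty. This lets √H be absorbed by |S| in
lower order terms. -/
lemma CMDP.card_states [Nonempty A] (M : CMDP C S A H) : H + 1 ≤ Fintype.card S := by
  classical
  have : range (H + 1) ⊆ univ.image M.lay.layer := by
    intro h hh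
    simp only [Finset.mem_range] at hh
    by_contra hne
    simp only [Finset.mem_image, Finset.mem_univ, true_and, not_exists] at hne
    have := occ_sum M.isDynamics (fun _ => Classical.arbitrary A) h (by omega)
    rw [Finset.sum_eq_zero fun s _ => occ_eq_zero M.isDynamics _ h (by omega) s (hne s)] at this
    exact zero_ne_one this
  calc H + 1 = #(range (H + 1)) := by simp
    _ ≤ #(univ.image M.lay.layer) := Finset.card_le_card this
    _ ≤ _ := Finset.card_image_le

/-- Minimum reachability turns squared errors weighted by action counts into expected squared
errors of the past policies. -/
lemma sum_countBefore_mul_le (hreach : M.MinReach pmin) (f : C → S → A → ℝ) (t : ℕ) (c : C)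
    (π : S → A) :
    ∑ s with M.lay.layer s < H, pmin * countBefore (fun i => pol i c s) t (π s)
        * (f c s (π s) - M.r c s (π s)) ^ 2
      ≤ ∑ i ∈ Ico 1 t, M.sqErr f (pol i) c := by
  classical
  simp only [CMDP.sqErr, sum_occ_mul_eq M.isDynamics]
  rw [Finset.sum_comm]
  refine Finset.sum_le_sum fun s _ => ?_
  rw [countBefore, Finset.mul_sum, Finset.sum_mul]
  refine Finset.sum_le_sum fun i _ => ?_
  have h1 := hreach (pol i c) s
  have h2 := occ_nonneg M.isDynamics (pol i c) _ (M.lay.layer_le s) s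
  split_ifs with h
  · rw [h, mul_one]
    exact mul_le_mul_of_nonneg_right h1 (sq_nonneg _)
  · rw [mul_zero, zero_mul]
    exact mul_nonneg h2 (sq_nonneg _)

/-- AM-GM: the difference of the two sides is a square over a positive number. With w = `pmin` times
the count, `b / w` is the bonus and the rest a weighted squared error. -/
lemma abs_le_div_add {b w d : ℝ} (hb : 0 < b) (hw : 0 < w) :
    |d| ≤ b / w + w * d ^ 2 / (4 * b) := by
  have h : b / w + w * d ^ 2 / (4 * b) - |d| = (w * |d| - 2 * b) ^ 2 / (4 * b * w) := by
    rw [← sq_abs d]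
    field_simp
    ring
  have : 0 ≤ (w * |d| - 2 * b) ^ 2 / (4 * b * w) := by positivity
  linarith

lemma IsRun.exists_played (hrun : IsRun M.lay F T δ pmin enum σ pol) (c : C) (s : S) (a : A) :
    ∃ i ∈ Icc 1 (Fintype.card A), pol i c s = a := by
  refine ⟨enum.symm a + 1, ?_, ?_⟩
  · have := (enum.symm a).2
    simp only [Finset.mem_Icc]
    omega
  · rw [hrun.init, Equiv.apply_symm_apply]

/-- AM-GM is applied along the comparator and along the played policy. Each use costs the past
squared error over `4 * b`, whence `2 * b`. -/
lemma regret_round_context_le [Nonempty A] (hpmin : 0 < pmin) (hreach : M.MinReach pmin)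
    (hrun : IsRun M.lay F T δ pmin enum σ pol) {t : ℕ} (ht : Fintype.card A < t)
    (hconf : ∀ s a, M.lay.layer s < H → ∑ s', |empP H σ t s a s' - M.P s a s'| ≤ xi H T δ σ t s a)
    {f : C → S → A → ℝ} (hf : ∀ c s a, f c s a ∈ Set.Icc (0 : ℝ) 1) {b : ℝ} (hb : 0 < b) {c : C}
    (hFOA : IsFOA M.lay (empP H σ t) (xi H T δ σ t) (rhat b pmin f pol t c) (pol t c))
    (π : S → A) :
    M.V c π - M.V c (pol t c) ≤ (∑ i ∈ Ico 1 t, M.sqErr f (pol i) c) / (2 * b)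
      + 3 * ∑ s with M.lay.layer s < H,
          b / (pmin * countBefore (fun i => pol i c s) t (pol t c s))
      + 2 * H * ∑ h ∈ range H, ∑ s, occ M.P M.lay.s0 (pol t c) h s
          * min 1 (xi H T δ σ t s (pol t c s)) := by
  have hcount : ∀ s a, 0 < pmin * countBefore (fun i => pol i c s) t a := by
    intro s a
    obtain ⟨i, hi, rfl⟩ := hrun.exists_played c s a
    have := one_le_countBefore (x := fun i => pol i c s) (t := t) (i := i)
      (by simp at hi ⊢; omega)
    exact mul_pos hpmin (by linarith)
  have hg : ∀ π : S → A, ∑ h ∈ range H, ∑ s, occ M.P M.lay.s0 π h s *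
      (pmin * countBefore (fun i => pol i c s) t (π s) * (f c s (π s) - M.r c s (π s)) ^ 2 / (4 * b))
      ≤ (∑ i ∈ Ico 1 t, M.sqErr f (pol i) c) / (4 * b) := by
    intro π
    refine (sum_occ_mul_le_sum M.isDynamics π fun s => ?_).trans ?_
    · have := hcount s (π s)
      positivity
    · rw [← Finset.sum_div]
      exact div_le_div_of_nonneg_right (sum_countBefore_mul_le hreach f t c π) (by positivity)
  have key := regret_round_le (L := M.lay) M.isDynamics hconf (r := M.r c) (f := f c)
    (b := fun s a => b / (pmin * countBefore (fun i => pol i c s) t a))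
    (g := fun s a => pmin * countBefore (fun i => pol i c s) t a
      * (f c s a - M.r c s a) ^ 2 / (4 * b))
    (hf c) (fun s a => (div_pos hb (hcount s a)).le) π (pol t c)
    (fun s _ => abs_le_div_add hb (hcount _ _)) (fun s _ => abs_le_div_add hb (hcount _ _)) hFOA
  have h1 := hg π
  have h2 := hg (pol t c)
  have e : (∑ i ∈ Ico 1 t, M.sqErr f (pol i) c) / (2 * b)
      = (∑ i ∈ Ico 1 t, M.sqErr f (pol i) c) / (4 * b)
        + (∑ i ∈ Ico 1 t, M.sqErr f (pol i) c) / (4 * b) := by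
    field_simp; ring
  rw [e]
  refine key.trans ?_
  gcongr

lemma beta_mono {n : ℕ} (hn : 0 < n) {δ : ℝ} (hδ : 0 < δ) (hδ1 : δ < 1) {t T : ℕ} (ht : 1 ≤ t)
    (htT : t ≤ T) : beta S A n δ t ≤ beta S A n δ T := by
  have h1 : (1 : ℝ) ≤ t := by exact_mod_cast ht
  have h2 : (t : ℝ) ≤ T := by exact_mod_cast htT
  have hn1 : (1 : ℝ) ≤ n := by exact_mod_cast hn
  have hlog : 0 ≤ Real.log (8 * n * (t : ℝ) ^ 3 / δ) := by
    refine Real.log_nonneg ?_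
    rw [le_div_iff₀ hδ]
    nlinarith [one_le_mul_of_one_le_of_one_le hn1 (one_le_pow₀ h1 : (1 : ℝ) ≤ (t : ℝ) ^ 3)]
  unfold beta
  gcongr

/-- The regression part of the regret of round `t`. -/
lemma log_div_beta_le [Nonempty S] [Nonempty A] {n : ℕ} (hn : 0 < n) {δ : ℝ} (hδ : 0 < δ)
    (hδ1 : δ < 1) {t T : ℕ} (ht : 1 ≤ t) (htT : t ≤ T) :
    0 < beta S A n δ t ∧ Real.log (8 * n * (t : ℝ) ^ 3 / δ) / beta S A n δ t
      ≤ Real.sqrt (Fintype.card S * Fintype.card A * Real.log (8 * n * (T : ℝ) ^ 3 / δ))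
        * (1 / Real.sqrt t) := by
  have h1 : (1 : ℝ) ≤ t := by exact_mod_cast ht
  have h2 : (t : ℝ) ≤ T := by exact_mod_cast htT
  have hn1 : (1 : ℝ) ≤ n := by exact_mod_cast hn
  have hS : (0 : ℝ) < Fintype.card S := by exact_mod_cast Fintype.card_pos
  have hA : (0 : ℝ) < Fintype.card A := by exact_mod_cast Fintype.card_pos
  set l := Real.log (8 * n * (t : ℝ) ^ 3 / δ) with hl
  set l' := Real.log (8 * n * (T : ℝ) ^ 3 / δ) with hl'
  have hl0 : 0 < l := by
    refine Real.log_pos ?_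
    rw [lt_div_iff₀ hδ]
    nlinarith [one_le_mul_of_one_le_of_one_le hn1 (one_le_pow₀ h1 : (1 : ℝ) ≤ (t : ℝ) ^ 3)]
  have hll : l ≤ l' := by
    rw [hl, hl']
    gcongr
  have hβ : 0 < beta S A n δ t := Real.sqrt_pos.2 (by rw [← hl]; positivity)
  refine ⟨hβ, ?_⟩
  have hst : 0 < Real.sqrt t := Real.sqrt_pos.2 (by linarith)
  have hl'0 : 0 < l' := hl0.trans_le hll
  rw [mul_one_div, div_le_div_iff₀ hβ hst, beta, ← hl, ← Real.sqrt_mul (by positivity)]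
  refine Real.le_sqrt_of_sq_le ?_
  rw [mul_pow, Real.sq_sqrt (by linarith)]
  have e : Fintype.card S * Fintype.card A * l' * (17 * t * l / (Fintype.card S * Fintype.card A))
      = 17 * t * l * l' := by field_simp
  rw [e]
  nlinarith [mul_nonneg (mul_nonneg (by linarith : (0 : ℝ) ≤ t) hl0.le) (sub_nonneg.2 hll),
    mul_nonneg (mul_nonneg (by linarith : (0 : ℝ) ≤ t) hl0.le) (hl0.le.trans hll)]

/-- In a single context the past squared error is not controlled, but it enters
`regret_round_context_le` linearly, so averaging over contexts gives exactly the quantity bounded by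
the regression event. -/
lemma expected_regret_round_le [Nonempty A] (hH : 0 < H) (hδ : 0 < δ) (hδ1 : δ < 1)
    (hpmin : 0 < pmin) (hreach : M.MinReach pmin)
    (hF : ∀ f ∈ F, ∀ c s a, f c s a ∈ Set.Icc (0 : ℝ) 1) {f₀ : C → S → A → ℝ} (hf₀F : f₀ ∈ F)
    (hrun : IsRun M.lay F T δ pmin enum σ pol)
    (hreg : ∀ t ∈ Icc 1 T, ∀ f ∈ F,
      (∑ i ∈ Ico 1 t, ∑ c, M.D c * M.sqErr f (pol i) c) / (4 * H)
        - (sqLoss H σ t f - sqLoss H σ t f₀) / H < Real.log (8 * #F * (t : ℝ) ^ 3 / δ))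
    (hconf : ∀ t ∈ Icc 1 T, ∀ s a, M.lay.layer s < H →
      ∑ s', |empP H σ t s a s' - M.P s a s'| ≤ xi H T δ σ t s a) (πs : C → S → A)
    {t : ℕ} (ht : t ∈ Ico (Fintype.card A + 1) (T + 1)) :
    ∑ c, M.D c * (M.V c (πs c) - M.V c (pol t c))
      ≤ 2 * H * (Real.sqrt (Fintype.card S * Fintype.card A
            * Real.log (8 * (#F : ℝ) * (T : ℝ) ^ 3 / δ)) * (1 / Real.sqrt t))
        + 3 * (beta S A #F δ T / pmin * ∑ c, M.D c * ∑ s with M.lay.layer s < H,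
          1 / countBefore (fun i => pol i c s) t (pol t c s))
        + 2 * H * ∑ c, M.D c * ∑ h ∈ range H, ∑ s, occ M.P M.lay.s0 (pol t c) h s
          * min 1 (xi H T δ σ t s (pol t c s)) := by
  have hneS : Nonempty S := ⟨M.lay.s0⟩
  have hF0 : 0 < #F := Finset.card_pos.2 ⟨f₀, hf₀F⟩
  have hH0 : (0 : ℝ) < H := by exact_mod_cast hH
  simp only [Finset.mem_Ico] at ht
  have htT : t ∈ Icc 1 T := by simp; omega
  obtain ⟨f, ⟨hfF, hfmin⟩, hFOA⟩ := hrun.step t (by omega) (by omega)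
  obtain ⟨hβ, hβ2⟩ := log_div_beta_le (S := S) (A := A) hF0 hδ hδ1 (t := t) (T := T)
    (by omega) (by omega)
  have hβT := beta_mono (S := S) (A := A) hF0 hδ hδ1 (t := t) (T := T) (by omega) (by omega)
  have hsq : (∑ i ∈ Ico 1 t, ∑ c, M.D c * M.sqErr f (pol i) c)
      ≤ 4 * H * Real.log (8 * #F * (t : ℝ) ^ 3 / δ) := by
    have h1 := hreg t htT f hfF
    -- The minimizer does not lose to the realizing function, so the excess loss drops out.
    have h2 : (sqLoss H σ t f - sqLoss H σ t f₀) / H ≤ 0 :=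
      div_nonpos_of_nonpos_of_nonneg (sub_nonpos.2 (hfmin f₀ hf₀F)) hH0.le
    have h3 : (∑ i ∈ Ico 1 t, ∑ c, M.D c * M.sqErr f (pol i) c) / (4 * H)
        ≤ Real.log (8 * #F * (t : ℝ) ^ 3 / δ) := by linarith
    rw [div_le_iff₀ (by positivity)] at h3
    linarith
  have hcount : ∀ c s, 0 < countBefore (fun i => pol i c s) t (pol t c s) := by
    intro c s
    obtain ⟨i, hi, he⟩ := hrun.exists_played c s (pol t c s)
    have := one_le_countBefore (x := fun i => pol i c s) (t := t) (i := i)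
      (by simp at hi ⊢; omega)
    simp only [he] at this
    linarith
  have hcx := fun c => regret_round_context_le hpmin hreach hrun (by omega) (hconf t htT)
    (hF f hfF) hβ (hFOA c) (πs c)
  set X : C → ℝ := fun c => ∑ s with M.lay.layer s < H,
    1 / countBefore (fun i => pol i c s) t (pol t c s) with hX
  set Y : C → ℝ := fun c => ∑ h ∈ range H, ∑ s, occ M.P M.lay.s0 (pol t c) h s
    * min 1 (xi H T δ σ t s (pol t c s)) with hY
  set Z : C → ℝ := fun c => ∑ i ∈ Ico 1 t, M.sqErr f (pol i) c with hZ
  have hZsum : ∑ i ∈ Ico 1 t, ∑ c, M.D c * M.sqErr f (pol i) c = ∑ c, M.D c * Z c := by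
    rw [Finset.sum_comm]
    simp only [hZ, Finset.mul_sum]
  rw [hZsum] at hsq
  have hcx' : ∀ c, M.V c (πs c) - M.V c (pol t c)
      ≤ Z c / (2 * beta S A #F δ t) + 3 * (beta S A #F δ T / pmin * X c) + 2 * H * Y c := by
    intro c
    refine (hcx c).trans (add_le_add_left (add_le_add_right
      (mul_le_mul_of_nonneg_left ?_ (by norm_num)) _) _)
    rw [hX, Finset.mul_sum]
    refine Finset.sum_le_sum fun s _ => ?_
    have := hcount c s
    rw [mul_one_div, div_div]
    gcongr
  calc _ ≤ ∑ c, M.D c * (Z c / (2 * beta S A #F δ t) + 3 * (beta S A #F δ T / pmin * X c)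
        + 2 * H * Y c) :=
        Finset.sum_le_sum fun c _ => mul_le_mul_of_nonneg_left (hcx' c) (M.D_nonneg c)
    _ = (∑ c, M.D c * Z c) / (2 * beta S A #F δ t)
        + 3 * (beta S A #F δ T / pmin * ∑ c, M.D c * X c) + 2 * H * ∑ c, M.D c * Y c := by
        rw [Finset.sum_div, Finset.mul_sum, Finset.mul_sum, Finset.mul_sum,
          ← Finset.sum_add_distrib, ← Finset.sum_add_distrib]
        exact Finset.sum_congr rfl fun c _ => by ring
    _ ≤ _ := by
        refine add_le_add_left (add_le_add_left ?_ _) _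
        calc _ ≤ 4 * H * Real.log (8 * #F * (t : ℝ) ^ 3 / δ) / (2 * beta S A #F δ t) :=
              div_le_div_of_nonneg_right hsq (by positivity)
          _ = 2 * H * (Real.log (8 * #F * (t : ℝ) ^ 3 / δ) / beta S A #F δ t) := by
              field_simp; ring
          _ ≤ _ := mul_le_mul_of_nonneg_left hβ2 (by positivity)

/-- The counts record prescribed actions, defined for every context and state in every round. The
harmonic bound thus holds for each pair (c,s) separately, and averaging over contexts costs nothing.
-/
lemma sum_expected_bonus_le [Nonempty A] (hrun : IsRun M.lay F T δ pmin enum σ pol)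
    (hAT : Fintype.card A ≤ T) :
    ∑ t ∈ Ico (Fintype.card A + 1) (T + 1), ∑ c, M.D c *
        ∑ s with M.lay.layer s < H, 1 / countBefore (fun i => pol i c s) t (pol t c s)
      ≤ Fintype.card S * (2 * (Fintype.card A * Real.log (T / Fintype.card A))) := by
  have hA : (1 : ℝ) ≤ Fintype.card A := by exact_mod_cast Fintype.card_pos
  have hlog : 0 ≤ Real.log (T / Fintype.card A) :=
    Real.log_nonneg (by rw [le_div_iff₀ (by linarith), one_mul]; exact_mod_cast hAT)
  rw [Finset.sum_comm]
  calc _ = ∑ c, M.D c * ∑ s with M.lay.layer s < H, ∑ t ∈ Ico (Fintype.card A + 1) (T + 1),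
        1 / countBefore (fun i => pol i c s) t (pol t c s) := by
        refine Finset.sum_congr rfl fun c _ => ?_
        rw [← Finset.mul_sum, Finset.sum_comm]
    _ ≤ ∑ c, M.D c * ∑ s with M.lay.layer s < H,
        2 * (Fintype.card A * Real.log (T / Fintype.card A)) := by
        refine Finset.sum_le_sum fun c _ => mul_le_mul_of_nonneg_left ?_ (M.D_nonneg c)
        exact Finset.sum_le_sum fun z _ => sum_one_div_countBefore_le
          (x := fun i => pol i c z) (hrun.exists_played c z) hAT
    _ ≤ ∑ c, M.D c * (Fintype.card S * (2 * (Fintype.card A * Real.log (T / Fintype.card A)))) := by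
        refine Finset.sum_le_sum fun c _ => mul_le_mul_of_nonneg_left ?_ (M.D_nonneg c)
        rw [Finset.sum_const, nsmul_eq_mul]
        refine mul_le_mul_of_nonneg_right ?_ (by positivity)
        exact_mod_cast Finset.card_le_univ _
    _ = _ := by rw [← Finset.sum_mul, M.D_sum, one_mul]

set_option maxHeartbeats 400000 in
/-- The regret on a sample path on which all concentration inequalities hold. -/
lemma regret_le_of_concentration [Nonempty A] (hH : 0 < H)
    (hT : Fintype.card S * Fintype.card A ≤ T) (hδ : 0 < δ) (hδ1 : δ < 1) (hpmin : 0 < pmin)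
    (hreach : M.MinReach pmin)
    (hF : ∀ f ∈ F, ∀ c s a, f c s a ∈ Set.Icc (0 : ℝ) 1) {f₀ : C → S → A → ℝ} (hf₀F : f₀ ∈ F)
    {πs : C → S → A}
    (hrun : IsRun M.lay F T δ pmin enum σ pol) (hc : IsConsistent M.lay T σ pol)
    (hreg : ∀ t ∈ Icc 1 T, ∀ f ∈ F,
      (∑ i ∈ Ico 1 t, ∑ c, M.D c * M.sqErr f (pol i) c) / (4 * H)
        - (sqLoss H σ t f - sqLoss H σ t f₀) / H < Real.log (8 * #F * (t : ℝ) ^ 3 / δ))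
    (hconf : ∀ t ∈ Icc 1 T, ∀ s a, M.lay.layer s < H →
      ∑ s', |empP H σ t s a s' - M.P s a s'| ≤ xi H T δ σ t s a)
    (hctx : (∑ i ∈ Ico 1 (T + 1), (M.V (σ i).ctx (πs (σ i).ctx) - M.V (σ i).ctx (pol i (σ i).ctx))) / H
        - 2 * (∑ i ∈ Ico 1 (T + 1), ∑ c, M.D c * (M.V c (πs c) - M.V c (pol i c))) / H
      < Real.log (4 / δ))
    (hvis : (∑ i ∈ Ico 1 (T + 1), ∑ c, M.D c * ∑ h ∈ range H, ∑ s,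
          occ M.P M.lay.s0 (pol i c) h s * min 1 (xi H T δ σ i s (pol i c s))) / (2 * H)
        - (∑ i ∈ Ico 1 (T + 1), ∑ h ∈ range H, min 1 (xi H T δ σ i ((σ i).st h)
            (pol i (σ i).ctx ((σ i).st h)))) / H
      < Real.log (4 / δ)) :
    regret M T πs σ pol ≤
      200 * ((H : ℝ) ^ (3 / 2 : ℝ) * Fintype.card S * Real.sqrt (T * Fintype.card A)
            * Real.log (Fintype.card S * Fintype.card A * (T : ℝ) ^ 2 / δ)
          + (H + (1 + Real.log (T / Fintype.card A)) / pmin)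
            * Real.sqrt (Fintype.card S * Fintype.card A * T
                * Real.log (8 * (#F : ℝ) * (T : ℝ) ^ 3 / δ))
          + Fintype.card A * H) := by
  have hneS : Nonempty S := ⟨M.lay.s0⟩
  have hF0 : 0 < #F := Finset.card_pos.2 ⟨f₀, hf₀F⟩
  have hcardS := M.card_states
  have hcardA : 1 ≤ Fintype.card A := Fintype.card_pos
  have hAT : Fintype.card A ≤ T := le_trans (Nat.le_mul_of_pos_left _ (by omega)) hT
  have hST : Fintype.card S ≤ T := le_trans (Nat.le_mul_of_pos_right _ (by omega)) hT
  set N := Fintype.card A with hN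
  have hH1 : (1 : ℝ) ≤ H := by exact_mod_cast hH
  have hH0 : (0 : ℝ) < H := by linarith
  have hA1 : (1 : ℝ) ≤ N := by exact_mod_cast hcardA
  have hSH : (H : ℝ) + 1 ≤ Fintype.card S := by exact_mod_cast hcardS
  have hT2 : (2 : ℝ) ≤ T := by exact_mod_cast (by omega : 2 ≤ T)
  have hNT : (N : ℝ) ≤ T := by exact_mod_cast hAT
  set s := (Fintype.card S : ℝ) with hs
  set l4 := Real.log (4 / δ) with hl4
  set Λ := Real.log (s * N * (T : ℝ) ^ 2 / δ) with hΛ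
  set LT := Real.log (8 * (#F : ℝ) * (T : ℝ) ^ 3 / δ) with hLT
  set Q := Real.sqrt (s * N * T * LT) with hQ
  set W := (H : ℝ) ^ (3 / 2 : ℝ) * s * Real.sqrt (T * N) * Λ with hW
  set G := Real.log (T / N) with hG
  have hG0 : 0 ≤ G := Real.log_nonneg (by rw [le_div_iff₀ (by linarith)]; linarith)
  have hLT0 : 0 ≤ LT := by
    refine Real.log_nonneg ?_
    rw [le_div_iff₀ hδ]
    have hn1 : (1 : ℝ) ≤ #F := by exact_mod_cast hF0
    have := one_le_mul_of_one_le_of_one_le hn1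
      (one_le_pow₀ (by linarith) : (1 : ℝ) ≤ (T : ℝ) ^ 3)
    rw [mul_assoc]
    linarith
  have hQ0 : 0 ≤ Q := Real.sqrt_nonneg _
  have hNpos : (0 : ℝ) < N := by linarith
  have hspos : (0 : ℝ) < s := by linarith
  -- logarithms
  have h8 : 8 ≤ s * N * (T : ℝ) ^ 2 := by
    have h1 : 2 * 1 ≤ s * N := mul_le_mul (by linarith) hA1 (by norm_num) hspos.le
    have h2 : (2 : ℝ) ^ 2 ≤ (T : ℝ) ^ 2 := pow_le_pow_left₀ (by norm_num) hT2 2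
    calc (8 : ℝ) = 2 * 1 * 2 ^ 2 := by norm_num
      _ ≤ _ := mul_le_mul h1 h2 (by norm_num) (by positivity)
  have hl40 : 0 ≤ l4 := Real.log_nonneg (by rw [le_div_iff₀ hδ]; linarith)
  have hl4Λ : l4 ≤ Λ := by
    refine Real.log_le_log (by positivity) ?_
    gcongr
    linarith
  have hΛ1 : 1 ≤ Λ := by
    rw [hΛ, Real.le_log_iff_exp_le (by positivity), le_div_iff₀ hδ]
    exact (mul_le_of_le_one_right (Real.exp_pos 1).le hδ1.le).trans
      (by linarith [Real.exp_one_lt_d9])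
  have hlogX : Real.log (4 * s * N * (T : ℝ) ^ 2 / δ) ≤ 2 * Λ := by
    have e : 4 * s * N * (T : ℝ) ^ 2 / δ = 4 * (s * N * (T : ℝ) ^ 2 / δ) := by ring
    rw [e, Real.log_mul (by norm_num) (by positivity)]
    have : Real.log 4 ≤ Λ := by
      refine Real.log_le_log (by norm_num) ?_
      rw [le_div_iff₀ hδ]
      linarith
    linarith
  have hlogX0 : 0 ≤ Real.log (4 * s * N * (T : ℝ) ^ 2 / δ) :=
    Real.log_nonneg (by rw [le_div_iff₀ hδ, mul_assoc, mul_assoc, ← mul_assoc s]; linarith)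
  -- the contexts
  have hregret : regret M T πs σ pol ≤
      2 * (∑ i ∈ Ico 1 (T + 1), ∑ c, M.D c * (M.V c (πs c) - M.V c (pol i c))) + H * l4 := by
    rw [← sub_div, div_lt_iff₀ hH0] at hctx
    have e : regret M T πs σ pol = ∑ i ∈ Ico 1 (T + 1),
        (M.V (σ i).ctx (πs (σ i).ctx) - M.V (σ i).ctx (pol i (σ i).ctx)) := rfl
    rw [e]
    linarith
  -- the first rounds
  have hinit : ∑ i ∈ Ico 1 (N + 1), ∑ c, M.D c * (M.V c (πs c) - M.V c (pol i c)) ≤ N * H := by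
    have : ∀ i ∈ Ico 1 (N + 1), ∑ c, M.D c * (M.V c (πs c) - M.V c (pol i c)) ≤ (H : ℝ) := by
      intro i _
      calc _ ≤ ∑ c, M.D c * (H : ℝ) := by
            refine Finset.sum_le_sum fun c _ => mul_le_mul_of_nonneg_left ?_ (M.D_nonneg c)
            linarith [(M.V_mem_Icc c (πs c)).2, (M.V_mem_Icc c (pol i c)).1]
        _ = H := by rw [← Finset.sum_mul, M.D_sum, one_mul]
    refine (Finset.sum_le_sum this).trans (le_of_eq ?_)
    simp
  -- the other rounds
  have hround := fun t (ht : t ∈ Ico (N + 1) (T + 1)) =>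
    expected_regret_round_le hH hδ hδ1 hpmin hreach hF hf₀F hrun hreg hconf πs ht
  have hsplit : ∑ i ∈ Ico 1 (T + 1), ∑ c, M.D c * (M.V c (πs c) - M.V c (pol i c))
      = ∑ i ∈ Ico 1 (N + 1), ∑ c, M.D c * (M.V c (πs c) - M.V c (pol i c))
        + ∑ i ∈ Ico (N + 1) (T + 1), ∑ c, M.D c * (M.V c (πs c) - M.V c (pol i c)) :=
    (Finset.sum_Ico_consecutive _ (by omega) (by omega)).symm
  have hrest := Finset.sum_le_sum hround
  rw [Finset.sum_add_distrib, Finset.sum_add_distrib, ← Finset.mul_sum, ← Finset.mul_sum,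
    ← Finset.mul_sum, ← Finset.mul_sum, ← Finset.mul_sum] at hrest
  -- the regression term
  have hterm1 : 2 * (H : ℝ) * (Real.sqrt (s * N * LT) * ∑ t ∈ Ico (N + 1) (T + 1), 1 / Real.sqrt t)
      ≤ 4 * H * Q := by
    have h1 := sum_one_div_sqrt_le N T
    have e : Q = Real.sqrt (s * N * LT) * Real.sqrt T := by
      rw [hQ, ← Real.sqrt_mul (by positivity)]
      congr 1; ring
    rw [e]
    calc _ ≤ 2 * (H : ℝ) * (Real.sqrt (s * N * LT) * (2 * Real.sqrt T)) := by gcongr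
      _ = _ := by ring
  -- the bonus term
  have hterm2 : 3 * (beta S A #F δ T / pmin * ∑ t ∈ Ico (N + 1) (T + 1), ∑ c, M.D c *
        ∑ s with M.lay.layer s < H, 1 / countBefore (fun i => pol i c s) t (pol t c s))
      ≤ 30 * (G / pmin * Q) := by
    have h1 := sum_expected_bonus_le hrun hAT
    rw [← hs, ← hN, ← hG] at h1
    -- The 17 under the root of `beta` is rounded up to 25.
    have h2 : beta S A #F δ T * (s * N) ≤ 5 * Q := by
      rw [beta, ← hs, ← hN, ← hLT, hQ]
      have e1 : s * N = Real.sqrt ((s * N) ^ 2) := (Real.sqrt_sq (by positivity)).symm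
      have e2 : (5 : ℝ) = Real.sqrt (5 ^ 2) := (Real.sqrt_sq (by norm_num)).symm
      nth_rewrite 2 [e1]
      rw [e2, ← Real.sqrt_mul (by positivity), ← Real.sqrt_mul (by norm_num)]
      refine Real.sqrt_le_sqrt ?_
      have e3 : 17 * T * LT / (s * N) * (s * N) ^ 2 = 17 * (s * N * T * LT) := by field_simp
      rw [e3]
      have : 0 ≤ s * N * T * LT := by positivity
      linarith
    have hβ0 : 0 ≤ beta S A #F δ T := Real.sqrt_nonneg _
    calc _ ≤ 3 * (beta S A #F δ T / pmin * (s * (2 * (N * G)))) := by gcongr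
      _ = 6 * (G / pmin * (beta S A #F δ T * (s * N))) := by ring
      _ ≤ 6 * (G / pmin * (5 * Q)) := by gcongr
      _ = _ := by ring
  -- the dynamics term
  set rH := Real.sqrt H with hrH
  set rTN := Real.sqrt (T * N) with hrTN
  have hrH1 : 1 ≤ rH := Real.one_le_sqrt.2 hH1
  have hrH2 : rH * rH = H := Real.mul_self_sqrt hH0.le
  have hrTN1 : 1 ≤ rTN := Real.one_le_sqrt.2 (one_le_mul_of_one_le_of_one_le (by linarith) hA1)
  have hWe : W = H * rH * s * rTN * Λ := by
    rw [hW, show (3 / 2 : ℝ) = 1 + 1 / 2 by norm_num, Real.rpow_add hH0, Real.rpow_one,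
      ← Real.sqrt_eq_rpow]
  have hs1 : 1 ≤ s := by linarith
  have hsr : 1 ≤ s * rTN := one_le_mul_of_one_le_of_one_le hs1 hrTN1
  have hn1 : H * l4 ≤ W := by
    rw [hWe]
    have h1 : 1 ≤ rH * (s * rTN) := one_le_mul_of_one_le_of_one_le hrH1 hsr
    calc H * l4 ≤ H * Λ := by gcongr
      _ ≤ (H * Λ) * (rH * (s * rTN)) := le_mul_of_one_le_right (by positivity) h1
      _ = _ := by ring
  -- The square of `H`, from simulation error times deviation term, fits because √H ≤ H ≤ |S|.
  have hn2 : H * H * l4 ≤ W := by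
    rw [hWe]
    have h1 : rH ≤ s := (le_mul_of_one_le_left (by linarith) hrH1).trans (by linarith)
    calc H * H * l4 ≤ H * H * Λ := by gcongr
      _ = H * (rH * rH) * Λ := by rw [hrH2]
      _ ≤ H * (rH * s) * Λ := by gcongr
      _ ≤ H * (rH * s) * Λ * rTN := le_mul_of_one_le_right (by positivity) hrTN1
      _ = _ := by ring
  set B := s + 2 * Real.log (4 * s * N * (T : ℝ) ^ 2 / δ) with hB
  have hB0 : 0 ≤ B := by positivity
  -- Since `s` and `Λ` are at least 1, the sum under the root is at most 9sΛ²; the logarithm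
  -- therefore leaves the root at full power.
  have hsqB : Real.sqrt B ≤ 3 * Real.sqrt s * Λ := by
    have e : 3 * Real.sqrt s * Λ = Real.sqrt (9 * s * Λ ^ 2) := by
      rw [Real.sqrt_mul (by positivity), Real.sqrt_mul (by norm_num), Real.sqrt_sq (by linarith),
        show (9 : ℝ) = 3 ^ 2 by norm_num, Real.sqrt_sq (by norm_num)]
    rw [e]
    refine Real.sqrt_le_sqrt ?_
    have h1 : B ≤ s + 4 * Λ := by linarith
    have h2 : Λ ≤ s * Λ := le_mul_of_one_le_left (by linarith) hs1
    have h3 : s ≤ s * Λ := le_mul_of_one_le_right hspos.le hΛ1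
    have h4 : s * Λ ≤ s * Λ * Λ := le_mul_of_one_le_right (by positivity) hΛ1
    have h5 : 9 * s * Λ ^ 2 = 9 * (s * Λ * Λ) := by ring
    linarith
  have hobs : ∑ i ∈ Ico 1 (T + 1), ∑ h ∈ range H, min 1 (xi H T δ σ i ((σ i).st h)
      (pol i (σ i).ctx ((σ i).st h))) ≤ 18 * (rH * s * rTN * Λ) := by
    calc _ ≤ ∑ i ∈ Ico 1 (T + 1), ∑ h ∈ range H, 2 * Real.sqrt B *
          (1 / Real.sqrt (max 1 (visits H σ i ((σ i).st h) ((σ i).act h) : ℝ))) := by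
          refine Finset.sum_le_sum fun i hi => Finset.sum_le_sum fun h hh => ?_
          have hi' : i ∈ Icc 1 T := by simp at hi ⊢; omega
          rw [← (hc i hi').2 h (by simpa using hh)]
          refine (min_le_right _ _).trans (le_of_eq ?_)
          rw [xi, ← hs, ← hN, ← hB, Real.sqrt_div hB0]
          ring
      _ = 2 * Real.sqrt B * ∑ i ∈ Ico 1 (T + 1), ∑ h ∈ range H,
          (1 / Real.sqrt (max 1 (visits H σ i ((σ i).st h) ((σ i).act h) : ℝ))) := by
          simp only [← Finset.mul_sum]
      _ ≤ 2 * (3 * Real.sqrt s * Λ) * (3 * Real.sqrt (s * N * (H * T))) := by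
          have := hc.sum_div_sqrt_visits_le
          gcongr
      _ = 18 * (rH * s * rTN * Λ) := by
          have e : Real.sqrt (s * N * (H * T)) = Real.sqrt s * (rH * rTN) := by
            rw [hrH, hrTN, ← Real.sqrt_mul hH0.le, ← Real.sqrt_mul hspos.le]
            congr 1; ring
          rw [e]
          calc _ = 18 * (rH * (Real.sqrt s * Real.sqrt s) * rTN * Λ) := by ring
            _ = _ := by rw [Real.mul_self_sqrt hspos.le]
  have hterm3 : 2 * (H : ℝ) * ∑ t ∈ Ico (N + 1) (T + 1), ∑ c, M.D c * ∑ h ∈ range H, ∑ s,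
      occ M.P M.lay.s0 (pol t c) h s * min 1 (xi H T δ σ t s (pol t c s)) ≤ 76 * W := by
    -- The deviation bound covers all rounds, so the initial ones, absent from the regret term, are
    -- added back.
    have hnn : ∀ t ∈ Ico 1 (T + 1), 0 ≤ ∑ c, M.D c * ∑ h ∈ range H, ∑ s,
        occ M.P M.lay.s0 (pol t c) h s * min 1 (xi H T δ σ t s (pol t c s)) := by
      intro t _
      refine Finset.sum_nonneg fun c _ => mul_nonneg (M.D_nonneg c) ?_
      refine sum_occ_mul_nonneg M.isDynamics (pol t c)
        (u := fun s => min 1 (xi H T δ σ t s (pol t c s))) fun z _ => le_min zero_le_one ?_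
      unfold xi
      positivity
    have h1 : ∑ t ∈ Ico (N + 1) (T + 1), ∑ c, M.D c * ∑ h ∈ range H, ∑ s,
        occ M.P M.lay.s0 (pol t c) h s * min 1 (xi H T δ σ t s (pol t c s))
        ≤ ∑ t ∈ Ico 1 (T + 1), ∑ c, M.D c * ∑ h ∈ range H, ∑ s,
        occ M.P M.lay.s0 (pol t c) h s * min 1 (xi H T δ σ t s (pol t c s)) :=
      Finset.sum_le_sum_of_subset_of_nonneg (Finset.Ico_subset_Ico_left (by omega))
        fun t ht _ => hnn t ht
    set E := ∑ t ∈ Ico 1 (T + 1), ∑ c, M.D c * ∑ h ∈ range H, ∑ s,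
        occ M.P M.lay.s0 (pol t c) h s * min 1 (xi H T δ σ t s (pol t c s)) with hE
    have h2 : E ≤ 36 * (rH * s * rTN * Λ) + 2 * H * l4 := by
      have h3 : E / (2 * H) < l4 + 18 * (rH * s * rTN * Λ) / H := by
        have := div_le_div_of_nonneg_right hobs hH0.le
        linarith
      rw [div_lt_iff₀ (by positivity)] at h3
      have e : (l4 + 18 * (rH * s * rTN * Λ) / H) * (2 * H)
          = 36 * (rH * s * rTN * Λ) + 2 * H * l4 := by field_simp; ring
      linarith
    calc _ ≤ 2 * (H : ℝ) * (36 * (rH * s * rTN * Λ) + 2 * H * l4) :=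
          mul_le_mul_of_nonneg_left (h1.trans h2) (by positivity)
      _ = 72 * W + 4 * (H * H * l4) := by rw [hWe]; ring
      _ ≤ _ := by linarith
  have hW0 : 0 ≤ W := by rw [hWe]; positivity
  have hNH : 0 ≤ (N : ℝ) * H := by positivity
  have hHQ : 0 ≤ (H : ℝ) * Q := by positivity
  have hGQ : 0 ≤ G / pmin * Q := by positivity
  have hpQ : 0 ≤ 1 / pmin * Q := by positivity
  -- Doubled for the passage to observed contexts, the constants are 2·76 + 1 for `W`, 2·4 for `H *
  -- Q`, 2·30 for the logarithmic bonus and 2 for `N * H`.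
  have e : 200 * (W + (H + (1 + G) / pmin) * Q + N * H)
      = 200 * W + 200 * (H * Q) + 200 * (1 / pmin * Q) + 200 * (G / pmin * Q) + 200 * (N * H) := by
    ring
  rw [e]
  rw [hsplit] at hregret
  linarith

end Regret

/-! ### Probability of the good event and product classes. -/

section Main

open scoped ENNReal

variable {C S A Ω : Type*} [Fintype C] [Fintype S] [Fintype A] [Nonempty A] {H T : ℕ}
  {mΩ : MeasurableSpace Ω} {μ : Measure Ω} [IsProbabilityMeasure μ] {M : CMDP C S A H}
  {𝓕 : Filtration ℕ mΩ} {σ : ℕ → Ω → Episode C S A} {pol : ℕ → Ω → C → S → A}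
  {F : Finset (C → S → A → ℝ)} {δ pmin : ℝ} {πs : C → S → A} {enum : Fin (Fintype.card A) ≃ A}

/-- Subadditivity suffices, so `E` need not be measurable. -/
lemma ofReal_one_sub_le_of_compl_le {E : Set Ω} {δ : ℝ} (hδ : 0 ≤ δ)
    (h : μ Eᶜ ≤ ENNReal.ofReal δ) : ENNReal.ofReal (1 - δ) ≤ μ E := by
  have h1 : (1 : ℝ≥0∞) ≤ μ E + μ Eᶜ := by
    rw [← measure_univ (μ := μ), ← Set.union_compl_self E]
    exact measure_union_le _ _
  rw [ENNReal.ofReal_sub _ hδ, ENNReal.ofReal_one]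
  exact tsub_le_iff_right.2 (h1.trans (by gcongr))

/-- The regret bound holds outside of an event of probability `δ`, for a positive horizon. -/
lemma ofReal_one_sub_le_measure_regret (hH : 0 < H)
    (hT : Fintype.card S * Fintype.card A ≤ T) (hδ : 0 < δ) (hδ1 : δ < 1) (hpmin : 0 < pmin)
    (hreach : M.MinReach pmin)
    (hF : ∀ f ∈ F, ∀ c s a, f c s a ∈ Set.Icc (0 : ℝ) 1) {f₀ : C → S → A → ℝ} (hf₀F : f₀ ∈ F)
    (hf₀ : ∀ c s a, M.lay.layer s < H → f₀ c s a = M.r c s a)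
    (hopt : M.IsOptimal πs) (hI : IsInteraction M T μ 𝓕 σ pol)
    (hrun : ∀ᵐ ω ∂μ, IsRun M.lay F T δ pmin enum (fun t => σ t ω) (fun t => pol t ω)) :
    ENNReal.ofReal (1 - δ) ≤ μ {ω |
      regret M T πs (fun t => σ t ω) (fun t => pol t ω) ≤
        200 * ((H : ℝ) ^ (3 / 2 : ℝ) * Fintype.card S * Real.sqrt (T * Fintype.card A)
              * Real.log (Fintype.card S * Fintype.card A * (T : ℝ) ^ 2 / δ)
            + (H + (1 + Real.log (T / Fintype.card A)) / pmin)
              * Real.sqrt (Fintype.card S * Fintype.card A * T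
                  * Real.log (8 * (#F : ℝ) * (T : ℝ) ^ 3 / δ))
            + Fintype.card A * H)} := by
  have hneS : Nonempty S := ⟨M.lay.s0⟩
  have hT1 : 1 ≤ T := le_trans (Nat.mul_pos Fintype.card_pos Fintype.card_pos) hT
  have hδ4 : 0 < δ / 4 := by linarith
  have b1 := measure_not_regression_le hI hH hF hf₀F hf₀ hδ
  have b2 := measure_not_confidence_le hI hT1 hδ hδ1
  -- Optimality of `πs` makes the per-context regret nonnegative, as the multiplicative bound
  -- requires.
  have b3 := measure_contexts_le hI hH (v := fun p c => M.V c (πs c) - M.V c (p c))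
    (fun p c => ⟨sub_nonneg.2 (hopt c (p c)), by
      linarith [(M.V_mem_Icc c (πs c)).2, (M.V_mem_Icc c (p c)).1]⟩) (le_refl (T + 1)) hδ4
  -- The radius is clipped at 1 to be an admissible test function.
  have b4 := measure_visited_le hI hH (u := fun N s a => min 1 (2 * Real.sqrt
      ((Fintype.card S + 2 * Real.log (4 * Fintype.card S * Fintype.card A * (T : ℝ) ^ 2 / δ))
        / max 1 (N s a : ℝ))))
    (fun N s a => ⟨le_min zero_le_one (by positivity), min_le_left _ _⟩) (le_refl (T + 1)) hδ4
  rw [one_div_div] at b3 b4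
  refine ofReal_one_sub_le_of_compl_le hδ.le ?_
  have hsum : ENNReal.ofReal δ = ENNReal.ofReal (δ / 4) + ENNReal.ofReal (δ / 4)
      + ENNReal.ofReal (δ / 4) + ENNReal.ofReal (δ / 4) := by
    rw [← ENNReal.ofReal_add hδ4.le hδ4.le, ← ENNReal.ofReal_add (by linarith) hδ4.le,
      ← ENNReal.ofReal_add (by linarith) hδ4.le]
    congr 1; ring
  rw [hsum]
  refine le_trans ?_ (add_le_add (add_le_add (add_le_add b1 b2) b3) b4)
  refine le_trans (measure_mono_ae ?_) ((measure_union_le _ _).trans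
    (add_le_add_left ((measure_union_le _ _).trans (add_le_add_left (measure_union_le _ _) _)) _))
  filter_upwards [hrun, ae_isConsistent hI] with ω hω hc hnot
  by_contra hgood
  apply hnot
  have hgood1 := fun h => hgood (Or.inl (Or.inl (Or.inl h)))
  have hgood2 := fun h => hgood (Or.inl (Or.inl (Or.inr h)))
  have hgood3 := fun h => hgood (Or.inl (Or.inr h))
  have hgood4 := fun h => hgood (Or.inr h)
  exact regret_le_of_concentration hH hT hδ hδ1 hpmin hreach hF hf₀F hω hc
    (not_not.1 hgood1) (not_not.1 hgood2) (not_le.1 hgood3) (not_le.1 hgood4)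

/-- The size of a product class. -/
lemma card_le_pow_of_product {G : Finset (C → A → ℝ)}
    (hG : ∀ f, f ∈ F ↔ ∃ g : S → C → A → ℝ, (∀ s, g s ∈ G) ∧ f = fun c s a => g s c a) :
    #F ≤ #G ^ Fintype.card S := by
  classical
  have : F ⊆ (Fintype.piFinset fun _ : S => G).image fun g c s a => g s c a := by
    intro f hf
    obtain ⟨g, hg, rfl⟩ := (hG f).1 hf
    exact Finset.mem_image.2 ⟨g, Fintype.mem_piFinset.2 hg, rfl⟩
  calc #F ≤ _ := Finset.card_le_card this
    _ ≤ _ := Finset.card_image_le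
    _ = _ := by simp

/-- Since 8T³/δ ≥ 1, it may be raised to the power k along with m. Hence the logarithm grows by at
most a factor k, and with the k already under the root a full k comes out. -/
lemma sqrt_log_card_le_of_product {n m k N T : ℕ} (hn : 0 < n) (hm : 0 < m) (hk : 0 < k)
    (hnm : n ≤ m ^ k) (hT : 1 ≤ T) {δ : ℝ} (hδ : 0 < δ) (hδ1 : δ < 1) :
    Real.sqrt (k * N * T * Real.log (8 * (n : ℝ) * (T : ℝ) ^ 3 / δ))
      ≤ k * Real.sqrt (N * T * Real.log (8 * (m : ℝ) * (T : ℝ) ^ 3 / δ)) := by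
  have hT1 : (1 : ℝ) ≤ (T : ℝ) ^ 3 := one_le_pow₀ (by exact_mod_cast hT)
  have hn' : (0 : ℝ) < n := by exact_mod_cast hn
  have hm' : (0 : ℝ) < m := by exact_mod_cast hm
  have hq : 1 ≤ 8 * (T : ℝ) ^ 3 / δ := by rw [le_div_iff₀ hδ]; linarith
  have hlog : Real.log (8 * (n : ℝ) * (T : ℝ) ^ 3 / δ)
      ≤ k * Real.log (8 * (m : ℝ) * (T : ℝ) ^ 3 / δ) := by
    rw [← Real.log_pow]
    refine Real.log_le_log (by positivity) ?_
    calc 8 * (n : ℝ) * (T : ℝ) ^ 3 / δ = 8 * (T : ℝ) ^ 3 / δ * n := by ring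
      _ ≤ (8 * (T : ℝ) ^ 3 / δ) ^ k * (m : ℝ) ^ k := by
          refine mul_le_mul (le_self_pow₀ hq hk.ne') (by exact_mod_cast hnm) hn'.le (by positivity)
      _ = (8 * (m : ℝ) * (T : ℝ) ^ 3 / δ) ^ k := by rw [← mul_pow]; congr 1; ring
  have e : (k : ℝ) * Real.sqrt (N * T * Real.log (8 * (m : ℝ) * (T : ℝ) ^ 3 / δ))
      = Real.sqrt ((k : ℝ) ^ 2 * (N * T * Real.log (8 * (m : ℝ) * (T : ℝ) ^ 3 / δ))) := by
    rw [Real.sqrt_mul (sq_nonneg (k : ℝ)), Real.sqrt_sq (by positivity)]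
  rw [e]
  refine Real.sqrt_le_sqrt ?_
  calc _ ≤ (k : ℝ) * N * T * (k * Real.log (8 * (m : ℝ) * (T : ℝ) ^ 3 / δ)) := by gcongr
    _ = _ := by ring

lemma bound_nonneg {h s a n t : ℝ} (hh : 0 ≤ h) (hs : 1 ≤ s) (ha : 1 ≤ a) (hat : a ≤ t)
    (hn : 0 ≤ n) (hδ : 0 < δ) (hδ1 : δ < 1) (hpmin : 0 < pmin) :
    0 ≤ h ^ (3 / 2 : ℝ) * s * Real.sqrt (t * a) * Real.log (s * a * t ^ 2 / δ)
      + (h + (1 + Real.log (t / a)) / pmin) * n + a * h := by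
  have h1 : 0 ≤ Real.log (s * a * t ^ 2 / δ) := by
    refine Real.log_nonneg ?_
    rw [le_div_iff₀ hδ]
    have := one_le_mul_of_one_le_of_one_le (one_le_mul_of_one_le_of_one_le hs ha)
      (one_le_pow₀ (ha.trans hat) : 1 ≤ t ^ 2)
    linarith
  have h2 : 0 ≤ Real.log (t / a) :=
    Real.log_nonneg (by rw [le_div_iff₀ (by linarith)]; linarith)
  positivity

end Main

end RMUCID

end

open RMUCID in
theorem mainTheorem2 :
    ∃ K : ℝ, 0 < K ∧
      ∀ (C S A Ω : Type*) [Fintype C] [Fintype S] [Fintype A] [Nonempty A]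
        [mΩ : MeasurableSpace Ω] (μ : Measure Ω) [IsProbabilityMeasure μ]
        (H T : ℕ) (δ pmin : ℝ) (M : CMDP C S A H) (F : Finset (C → S → A → ℝ))
        (πs : C → S → A) (enum : Fin (Fintype.card A) ≃ A)
        (𝓕 : Filtration ℕ mΩ) (σ : ℕ → Ω → Episode C S A) (pol : ℕ → Ω → C → S → A),
        Fintype.card S * Fintype.card A ≤ T →
        0 < δ → δ < 1 →
        0 < pmin → pmin ≤ 1 → M.MinReach pmin →
        (∀ f ∈ F, ∀ c s a, f c s a ∈ Set.Icc (0 : ℝ) 1) →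
        (∃ f ∈ F, ∀ c s a, M.lay.layer s < H → f c s a = M.r c s a) →
        M.IsOptimal πs →
        IsInteraction M T μ 𝓕 σ pol →
        (∀ᵐ ω ∂μ, IsRun M.lay F T δ pmin enum (fun t => σ t ω) (fun t => pol t ω)) →
        ENNReal.ofReal (1 - δ) ≤ μ {ω |
          regret M T πs (fun t => σ t ω) (fun t => pol t ω) ≤
            K * ((H : ℝ) ^ (3 / 2 : ℝ) * Fintype.card S * Real.sqrt (T * Fintype.card A)
                  * Real.log (Fintype.card S * Fintype.card A * (T : ℝ) ^ 2 / δ)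
                + (H + (1 + Real.log (T / Fintype.card A)) / pmin)
                  * Real.sqrt (Fintype.card S * Fintype.card A * T
                      * Real.log (8 * (#F : ℝ) * (T : ℝ) ^ 3 / δ))
                + Fintype.card A * H)} ∧
        ∀ G : Finset (C → A → ℝ),
          (∀ f, f ∈ F ↔ ∃ g : S → C → A → ℝ, (∀ s, g s ∈ G) ∧ f = fun c s a => g s c a) →
          ENNReal.ofReal (1 - δ) ≤ μ {ω |
            regret M T πs (fun t => σ t ω) (fun t => pol t ω) ≤
              K * ((H : ℝ) ^ (3 / 2 : ℝ) * Fintype.card S * Real.sqrt (T * Fintype.card A)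
                    * Real.log (Fintype.card S * Fintype.card A * (T : ℝ) ^ 2 / δ)
                  + (H + (1 + Real.log (T / Fintype.card A)) / pmin)
                    * (Fintype.card S * Real.sqrt (Fintype.card A * T
                        * Real.log (8 * (#G : ℝ) * (T : ℝ) ^ 3 / δ)))
                  + Fintype.card A * H)} := by
  refine ⟨200, by norm_num, ?_⟩
  intro C S A Ω _ _ _ _ mΩ μ _ H T δ pmin M F πs enum 𝓕 σ pol hT hδ hδ1 hpmin hpmin1 hreach hF
    hreal hopt hI hrun
  obtain ⟨f₀, hf₀F, hf₀⟩ := hreal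
  have hneS : Nonempty S := ⟨M.lay.s0⟩
  have hS : 0 < Fintype.card S := Fintype.card_pos
  have hA : 0 < Fintype.card A := Fintype.card_pos
  have hAT : Fintype.card A ≤ T := (Nat.le_mul_of_pos_left _ hS).trans hT
  have hF0 : 0 < #F := Finset.card_pos.2 ⟨f₀, hf₀F⟩
  have hS1 : (1 : ℝ) ≤ Fintype.card S := by exact_mod_cast hS
  have hA1 : (1 : ℝ) ≤ Fintype.card A := by exact_mod_cast hA
  have hAT1 : (Fintype.card A : ℝ) ≤ T := by exact_mod_cast hAT
  have main : ENNReal.ofReal (1 - δ) ≤ μ {ω |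
      regret M T πs (fun t => σ t ω) (fun t => pol t ω) ≤
        200 * ((H : ℝ) ^ (3 / 2 : ℝ) * Fintype.card S * Real.sqrt (T * Fintype.card A)
              * Real.log (Fintype.card S * Fintype.card A * (T : ℝ) ^ 2 / δ)
            + (H + (1 + Real.log (T / Fintype.card A)) / pmin)
              * Real.sqrt (Fintype.card S * Fintype.card A * T
                  * Real.log (8 * (#F : ℝ) * (T : ℝ) ^ 3 / δ))
            + Fintype.card A * H)} := by
    -- The concentration bounds divide by `H`; for `H = 0` the regret vanishes identically.
    rcases Nat.eq_zero_or_pos H with hH | hH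
    · subst hH
      refine ofReal_one_sub_le_of_compl_le hδ.le (le_of_eq_of_le ?_ zero_le)
      convert measure_empty (μ := μ)
      rw [Set.compl_empty_iff, Set.eq_univ_iff_forall]
      intro ω
      have h0 : regret M T πs (fun t => σ t ω) (fun t => pol t ω) = 0 :=
        Finset.sum_eq_zero fun t _ => sub_self (0 : ℝ)
      change regret M T πs (fun t => σ t ω) (fun t => pol t ω) ≤ _
      rw [h0]
      exact mul_nonneg (by norm_num) (bound_nonneg (Nat.cast_nonneg _) hS1 hA1 hAT1
        (Real.sqrt_nonneg _) hδ hδ1 hpmin)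
    · exact ofReal_one_sub_le_measure_regret hH hT hδ hδ1 hpmin hreach hF hf₀F hf₀ hopt hI hrun
  refine ⟨main, fun G hG => main.trans (measure_mono fun ω hω => ?_)⟩
  change regret M T πs (fun t => σ t ω) (fun t => pol t ω) ≤ _ at hω
  change regret M T πs (fun t => σ t ω) (fun t => pol t ω) ≤ _
  refine hω.trans ?_
  have hG0 : 0 < #G := by
    obtain ⟨g, hg, -⟩ := (hG f₀).1 hf₀F
    exact Finset.card_pos.2 ⟨g M.lay.s0, hg _⟩
  have hlog : 0 ≤ Real.log ((T : ℝ) / Fintype.card A) :=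
    Real.log_nonneg (by rw [le_div_iff₀ (by linarith)]; linarith)
  have hsqrt := sqrt_log_card_le_of_product (N := Fintype.card A) hF0 hG0 hS
    (card_le_pow_of_product hG) (hA.trans_le hAT) hδ hδ1
  gcongr
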